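/- **Conventions.** Let $\partial$ be the boundary of the complete rooted binary tree, i.e. the set of infinite words in $\{0,1\}$; the vertices of the tree are the finite words $u$, and $\partial_u\subset\partial$ is the set of infinite words beginning with $u$. *Neretin's group.* $N$ is the group of bijections $g$ of $\partial$ for which there is an $n$ such that, for each word $u$ of length $n$, $g$ maps $\partial_u$ onto some $\partial_v$ by a map induced by an isomorphism of the rooted binary tree below $u$ onto the one below $v$. *The tower.* Let $\tilde{\mathcal M}_{0,2^n+1}$ be the two-sheeted cover of the real moduli space $\overline{\mathcal M}_{0,2^n+1}(\mathbb R)$ of stable $(2^n+1)$-pointed curves of genus $0$, with its stratification, and $\tilde{\mathcal M}_{0,2^\infty}$ the inductive limit of these stratified spaces along dyadic expansion. It is considered through its strata, described combinatorially as follows. A *labelled tree* is a planar rooted tree, each of whose inner vertices has at least two sons, with leaves labelled bijectively by finite words $u_1,\dots,u_m$ $(m\ge 2)$ such that $\partial=\partial_{u_1}\sqcup\dots\sqcup\partial_{u_m}$. The strata of $\tilde{\mathcal M}_{0,2^\infty}$ are the classes of labelled trees modulo the reflections of the planar subtree above an inner vertex different from the root and modulo simple dyadic expansion (replacing a leaf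 labelled $u$ by an inner vertex carrying two leaves labelled $u0$ and $u1$). The stratum of $x$ lies in the closure of the stratum of $y$ if $x$ can be transformed into $y$ by contractions of inner edges, reflections at non-root vertices, simple dyadic expansions and their inverses. $N$ acts on the tower: to apply $g$ to a labelled tree, expand it until $g$ maps $\partial_{u}$ onto some $\partial_{v}$ as above for each label $u$, and replace each label $u$ by this $v$. The dimension of strata and the points of $\tilde{\mathcal M}_{0,2^\infty}$ play no other role: its fundamental group, edge paths and universal cover are those of the poset of strata. The base point is the stratum of the planar tree with one inner vertex and two leaves labelled $0,1$ from left to right. *Quasi-braids.* For $n\ge 1$ let $S=\{\sigma_1,\dots,\sigma_{n-1}\}$ be the set of Coxeter generators of the symmetric group $\Sigma_n$. For a proper non-empty subset $T\subset S$ with connected Coxeter graph, let $\omega_T\in\Sigma_n$ be the permutation reversing the interval of letters permuted by $T$, and let $|T|$ be the number of these letters. The quasi-braid group $J_n$ has a generator $\alpha_T$ for each such $T$, and the relations $\alpha_T^2=1$; $\alpha_T\alpha_U=\alpha_{\omega_TU\omega_T}\alpha_T$ if $U\subset T$; $\alpha_T\alpha_U=\alpha_U\alpha_T$ if the intervals of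 letters of $T$ and $U$ are disjoint. Let $PJ_n$ be the kernel of $J_n\to\Sigma_n$, $\alpha_T\mapsto\omega_T$, and let $\ell_n:J_n\to\mathbb Z/2\mathbb Z$ be the homomorphism with $\ell_n(\alpha_T)=1+|T| \bmod 2$. A word $\alpha_{T_1}\cdots\alpha_{T_r}$ representing an element of $PJ_{2^n}$ $(n\ge1)$ defines an edge loop in the tower, through the top-dimensional cells $1,\ \omega_{T_1},\ \omega_{T_1}\omega_{T_2},\ \dots,\ \omega_{T_1}\cdots\omega_{T_r}=1$ of $\tilde{\mathcal M}_{0,2^n+1}$ and their common walls. *The quasi-braid extension.* $PJ_{2^\infty}=\varinjlim PJ_{2^n}$ is the fundamental group of the tower $\tilde{\mathcal M}_{0,2^\infty}$, and $\tilde{\mathcal A}_N$ is the group of all pairs $(g,f)$ with $g\in N$ and $f$ a cellular automorphism of the universal cover of the tower lifting the action of $g$. The group $PJ_{2^\infty}$ acts on the universal cover by deck transformations and so maps to $\tilde{\mathcal A}_N$, with $p\mapsto (1,p)$, and $\tilde{\mathcal A}_N$ maps to $N$ by $(g,f)\mapsto g$. **Theorem (analogue of the Euler class for $N$).** 1. There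 is a unique homomorphism $\ell_\infty:PJ_{2^\infty}\to\mathbb Z/2\mathbb Z$ (the stable length) whose value on the class of the edge loop of each word $\alpha_{T_1}\cdots\alpha_{T_r}$ representing an element of $PJ_{2^n}$ is $\ell_n(\alpha_{T_1}\cdots\alpha_{T_r})=r+|T_1|+\dots+|T_r| \bmod 2$, for all $n\ge1$; every element of $PJ_{2^\infty}$ is the class of such a loop, and $\ell_\infty$ is onto. 2. The sequence $1\to PJ_{2^\infty}\to\tilde{\mathcal A}_N\to N\to1$ is exact, $\operatorname{Ker}\ell_\infty$ is normal in $\tilde{\mathcal A}_N$, and the induced sequence $$1\to\mathbb Z/2\mathbb Z\cong PJ_{2^\infty}/\operatorname{Ker}\ell_\infty\to\mathcal A_N:=\tilde{\mathcal A}_N/\operatorname{Ker}\ell_\infty\to N\to1$$ is a central extension of $N$ by $\mathbb Z/2\mathbb Z$. 3. This extension is non-trivial: it does not split. Moreover, some $p\in PJ_{2^\infty}$ with $\ell_\infty(p)=1$ is a product of commutators of elements of $\tilde{\mathcal A}_N$. 4. The class $Eu\in H^2(N,\mathbb Z/2\mathbb Z)$ of this central extension is non-zero. Here $N$ acts trivially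 on $\mathbb Z/2\mathbb Z$, and $Eu$ is the class of the cocycle $(g,h)\mapsto s(g)s(h)s(gh)^{-1}$, for any set-theoretic section $s$ of $\mathcal A_N\to N$. -/

import Mathlib

open CategoryTheory

namespace DyadicCircle

/-- The boundary of the rooted complete dyadic tree: infinite binary words. -/
abbrev Bdry : Type := Stream' Bool

/-- The set of boundary points below the vertex `u` of the dyadic tree. -/
def cone (u : List Bool) : Set Bdry := Set.range fun x : Bdry => u ++ₛ x

/-- `q` is (the boundary map of) an automorphism of the rooted complete dyadic tree. -/
def IsTreeAut (q : Equiv.Perm Bdry) : Prop :=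
  ∀ (x y : Bdry) (k : ℕ), (q x).take k = (q y).take k ↔ x.take k = y.take k

/-- `g` maps the complete dyadic tree below `u` onto the one below `v`
by an isomorphism of rooted trees. -/
def MapsCone (g : Equiv.Perm Bdry) (u v : List Bool) : Prop :=
  ∃ q : Equiv.Perm Bdry, IsTreeAut q ∧ ∀ x : Bdry, g (u ++ₛ x) = v ++ₛ q x

lemma take_append_le (u : List Bool) (x : Bdry) (k : ℕ) (h : k ≤ u.length) :
    (u ++ₛ x).take k = u.take k := by
  induction u generalizing k with
  | nil => simp at h; subst h; rfl
  | cons a u ih =>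
    cases k with
    | zero => rfl
    | succ k =>
      simp only [Stream'.cons_append_stream, Stream'.take_succ_cons, List.take_succ_cons]
      rw [ih k (by simpa using h)]

lemma take_append (u : List Bool) (x : Bdry) : (u ++ₛ x).take u.length = u := by
  rw [take_append_le u x _ le_rfl, List.take_length]

lemma append_right_inj (u : List Bool) {x y : Bdry} (h : u ++ₛ x = u ++ₛ y) : x = y := by
  have := congrArg (Stream'.drop u.length) h
  simpa [Stream'.drop_append_stream] using this

lemma append_take_drop (x : Bdry) (n : ℕ) : x.take n ++ₛ x.drop n = x :=
  Stream'.append_take_drop n x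

lemma isTreeAut_one : IsTreeAut 1 := fun _ _ _ => Iff.rfl

lemma IsTreeAut.mul {q r : Equiv.Perm Bdry} (hq : IsTreeAut q) (hr : IsTreeAut r) :
    IsTreeAut (q * r) := fun x y k => (hq _ _ k).trans (hr x y k)

lemma IsTreeAut.inv {q : Equiv.Perm Bdry} (hq : IsTreeAut q) : IsTreeAut q⁻¹ := fun x y k => by
  rw [← hq]; simp

lemma take_append_take (u : List Bool) (x y : Bdry) (k : ℕ) :
    (u ++ₛ x).take (u.length + k) = (u ++ₛ y).take (u.length + k) ↔ x.take k = y.take k := by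
  induction u with
  | nil => simp
  | cons a u ih =>
    rw [List.length_cons, show u.length + 1 + k = (u.length + k) + 1 by ring]
    simp only [Stream'.cons_append_stream, Stream'.take_succ_cons, List.cons.injEq, true_and]
    exact ih

lemma take_of_take_le {x y : Bdry} {m n : ℕ} (h : x.take n = y.take n) (hmn : m ≤ n) :
    x.take m = y.take m := by
  have := congrArg (List.take m) h
  simpa [Stream'.take_take, hmn] using this

/-- A tree automorphism restricts to an isomorphism below every vertex. -/
lemma IsTreeAut.restrict {q : Equiv.Perm Bdry} (hq : IsTreeAut q) (u : List Bool) :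
    ∃ v, v.length = u.length ∧ MapsCone q u v := by
  have x0 : Bdry := Stream'.const false
  have key : ∀ x y : Bdry, (q (u ++ₛ x)).take u.length = (q (u ++ₛ y)).take u.length :=
    fun x y => (hq _ _ _).2 (by simp only [take_append])
  have keyi : ∀ z : Bdry, z.take u.length = (q (u ++ₛ x0)).take u.length →
      (q⁻¹ z).take u.length = u := fun z hz => by
    have : (q⁻¹ z).take u.length = (u ++ₛ x0).take u.length := by
      rw [← hq]; simpa using hz
    rw [this, take_append]
  have hlen : ((q (u ++ₛ x0)).take u.length).length = u.length := by simp
  have e1 : ∀ x : Bdry, q (u ++ₛ x) =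
      (q (u ++ₛ x0)).take u.length ++ₛ (q (u ++ₛ x)).drop u.length := fun x => by
    rw [key x0 x, append_take_drop]
  have e2 : ∀ y : Bdry, u ++ₛ (q⁻¹ ((q (u ++ₛ x0)).take u.length ++ₛ y)).drop u.length =
      q⁻¹ ((q (u ++ₛ x0)).take u.length ++ₛ y) := fun y => by
    conv_rhs => rw [← append_take_drop (q⁻¹ ((q (u ++ₛ x0)).take u.length ++ₛ y)) u.length]
    rw [keyi]
    have := take_append ((q (u ++ₛ x0)).take u.length) y
    rwa [hlen] at this
  refine ⟨(q (u ++ₛ x0)).take u.length, hlen, ⟨fun x => (q (u ++ₛ x)).drop u.length,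
    fun y => (q⁻¹ ((q (u ++ₛ x0)).take u.length ++ₛ y)).drop u.length, fun x => ?_,
    fun y => ?_⟩, ?_, e1⟩
  · apply append_right_inj u
    rw [e2, ← e1]; simp
  · apply append_right_inj ((q (u ++ₛ x0)).take u.length)
    rw [← e1, e2]; simp
  · intro x y k
    have h1 := take_append_take ((q (u ++ₛ x0)).take u.length)
      ((q (u ++ₛ x)).drop u.length) ((q (u ++ₛ y)).drop u.length) k
    rw [← e1, ← e1, hlen, hq] at h1
    rw [take_append_take] at h1
    exact h1.symm

lemma MapsCone.extend {g : Equiv.Perm Bdry} {u v : List Bool} (h : MapsCone g u v)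
    (w : List Bool) : ∃ w', w'.length = w.length ∧ MapsCone g (u ++ w) (v ++ w') := by
  obtain ⟨q, hq, hg⟩ := h
  obtain ⟨w', hl, r, hr, hw⟩ := hq.restrict w
  exact ⟨w', hl, r, hr, fun x => by
    rw [Stream'.append_append_stream, hg, hw, Stream'.append_append_stream]⟩

lemma MapsCone.mul {g h : Equiv.Perm Bdry} {u v w : List Bool} (hg : MapsCone g v w)
    (hh : MapsCone h u v) : MapsCone (g * h) u w := by
  obtain ⟨q, hq, hg⟩ := hg
  obtain ⟨r, hr, hh⟩ := hh
  exact ⟨q * r, hq.mul hr, fun x => by simp [hh, hg]⟩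

lemma MapsCone.inv {g : Equiv.Perm Bdry} {u v : List Bool} (h : MapsCone g u v) :
    MapsCone g⁻¹ v u := by
  obtain ⟨q, hq, hg⟩ := h
  refine ⟨q⁻¹, hq.inv, fun x => ?_⟩
  rw [Equiv.Perm.inv_eq_iff_eq, hg]; simp

lemma MapsCone.image {g : Equiv.Perm Bdry} {u v : List Bool} (h : MapsCone g u v) :
    g '' cone u = cone v := by
  obtain ⟨q, -, hg⟩ := h
  ext y; constructor
  · rintro ⟨_, ⟨x, rfl⟩, rfl⟩
    exact ⟨q x, (hg x).symm⟩
  · rintro ⟨x, rfl⟩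
    exact ⟨_, ⟨q⁻¹ x, rfl⟩, by simp [hg]⟩

/-- Neretin's spheromorphism group: the bijections of the boundary which, for some `n`, carry the
dyadic tree below each of the `2 ^ n` vertices of depth `n` isomorphically onto the dyadic tree
below some vertex. -/
def neretin : Subgroup (Equiv.Perm Bdry) where
  carrier := {g | ∃ n, ∀ u : List Bool, u.length = n → ∃ v, MapsCone g u v}
  one_mem' := ⟨0, fun u _ => ⟨u, 1, isTreeAut_one, fun _ => rfl⟩⟩
  mul_mem' := by
    rintro g h ⟨m, hg⟩ ⟨n, hh⟩
    refine ⟨n + m, fun u hu => ?_⟩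
    obtain ⟨v, hv⟩ := hh (u.take n) (by simp [hu])
    obtain ⟨w, hw, hv'⟩ := hv.extend (u.drop n)
    rw [List.take_append_drop] at hv'
    obtain ⟨z, hz⟩ := hg ((v ++ w).take m) (by simp [hw, hu])
    obtain ⟨z', -, hz'⟩ := hz.extend ((v ++ w).drop m)
    rw [List.take_append_drop] at hz'
    exact ⟨_, hz'.mul hv'⟩
  inv_mem' := by
    rintro g ⟨n, hg⟩
    have hfin : {u : List Bool | u.length = n}.Finite := List.finite_length_eq Bool n
    choose! f hf using hg
    obtain ⟨M, hM⟩ := (hfin.image fun u => (f u).length).bddAbove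
    refine ⟨M, fun w hw => ?_⟩
    set x : Bdry := g⁻¹ (w ++ₛ Stream'.const false) with hx
    have hu : (x.take n).length = n := by simp
    have hle : (f (x.take n)).length ≤ M := hM ⟨_, hu, rfl⟩
    obtain ⟨q, hq, hgq⟩ := hf _ hu
    have hgx : w ++ₛ Stream'.const false = f (x.take n) ++ₛ q (x.drop n) := by
      rw [← hgq, append_take_drop, hx]; simp
    have hpre : w.take (f (x.take n)).length = f (x.take n) := by
      have := congrArg (Stream'.take (f (x.take n)).length) hgx
      rwa [take_append, take_append_le _ _ _ (by omega)] at this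
    obtain ⟨z, -, hz⟩ := (MapsCone.inv ⟨q, hq, hgq⟩).extend (w.drop (f (x.take n)).length)
    refine ⟨x.take n ++ z, ?_⟩
    rwa [show f (x.take n) ++ w.drop (f (x.take n)).length = w by
      conv_rhs => rw [← List.take_append_drop (f (x.take n)).length w, hpre]] at hz


lemma MapsCone.eq_of {g : Equiv.Perm Bdry} {u v v' : List Bool} (h : MapsCone g u v)
    (h' : MapsCone g u v') : v = v' := by
  have key : ∀ {a b : List Bool}, cone a = cone b → a.length ≤ b.length := by
    intro a b hab
    by_contra hlt
    push Not at hlt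
    obtain ⟨x, hx⟩ : b ++ₛ (Stream'.const true) ∈ cone a := hab ▸ ⟨_, rfl⟩
    obtain ⟨y, hy⟩ : b ++ₛ (Stream'.const false) ∈ cone a := hab ▸ ⟨_, rfl⟩
    have h1 : (b ++ₛ (Stream'.const true)).take (b.length + 1) =
        (b ++ₛ (Stream'.const false)).take (b.length + 1) := by
      rw [← hx, ← hy]
      simp only
      rw [take_append_le _ _ _ (by omega), take_append_le _ _ _ (by omega)]
    rw [take_append_take] at h1
    simp [Stream'.take_succ] at h1
  have hc : cone v = cone v' := by rw [← h.image, ← h'.image]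
  obtain ⟨x, hx⟩ : v ++ₛ (Stream'.const true) ∈ cone v' := hc ▸ ⟨_, rfl⟩
  have hl : v.length = v'.length := le_antisymm (key hc) (key hc.symm)
  have := congrArg (Stream'.take v.length) hx
  simp only at this
  rw [take_append, hl, take_append] at this
  exact this.symm

/-- The children of `u` are mapped to the children of its image, in one of the two orders. -/
lemma MapsCone.child {g : Equiv.Perm Bdry} {u v : List Bool} (h : MapsCone g u v) (s : Bool) :
    ∃ t, MapsCone g (u ++ [s]) (v ++ [t]) ∧ MapsCone g (u ++ [!s]) (v ++ [!t]) := by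
  obtain ⟨q, hq, hg⟩ := h
  obtain ⟨a, ha, ra, hra, ha'⟩ := hq.restrict [s]
  obtain ⟨b, hb, rb, hrb, hb'⟩ := hq.restrict [!s]
  obtain ⟨t, rfl⟩ := List.length_eq_one_iff.1 ha
  obtain ⟨t', rfl⟩ := List.length_eq_one_iff.1 hb
  have hne : t' = !t := by
    have h1 := hq ([s] ++ₛ Stream'.const false) ([!s] ++ₛ Stream'.const false) 1
    rw [ha', hb'] at h1
    have h2 : t = t' ↔ s = !s := by simpa [Stream'.take_succ] using h1
    cases s <;> cases t <;> cases t' <;> simp_all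
  subst hne
  refine ⟨t, ⟨ra, hra, fun x => ?_⟩, ⟨rb, hrb, fun x => ?_⟩⟩
  · rw [Stream'.append_append_stream, hg, ha', Stream'.append_append_stream]
  · rw [Stream'.append_append_stream, hg, hb', Stream'.append_append_stream]

lemma cone_child (u : List Bool) (s : Bool) :
    cone u = cone (u ++ [s]) ∪ cone (u ++ [!s]) := by
  ext z; constructor
  · rintro ⟨x, rfl⟩
    have hx : x = [x.head] ++ₛ x.tail := (Stream'.append_stream_head_tail x).symm
    by_cases h : x.head = s
    · left
      refine ⟨x.tail, ?_⟩
      simp only [Stream'.append_append_stream]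
      rw [← h, ← hx]
    · right
      have h' : x.head = !s := by revert h; cases x.head <;> cases s <;> simp
      refine ⟨x.tail, ?_⟩
      simp only [Stream'.append_append_stream]
      rw [← h', ← hx]
  · rintro (⟨x, rfl⟩ | ⟨x, rfl⟩) <;> exact ⟨_, (Stream'.append_append_stream _ _ _).symm⟩

lemma cone_child_disjoint (u : List Bool) (s : Bool) :
    Disjoint (cone (u ++ [s])) (cone (u ++ [!s])) := by
  rw [Set.disjoint_left]
  rintro _ ⟨x, rfl⟩ ⟨y, hy⟩
  have := congrArg (Stream'.take (u.length + 1)) hy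
  simp only at this
  rw [take_append_le _ _ _ (by simp), take_append_le _ _ _ (by simp),
    List.take_of_length_le (by simp), List.take_of_length_le (by simp)] at this
  cases s <;> simp at this

lemma cone_nonempty (u : List Bool) : (cone u).Nonempty := ⟨_, Stream'.const false, rfl⟩

/-- The part of the boundary below a list of vertices of the dyadic tree. -/
def region (b : List (List Bool)) : Set Bdry := {x | ∃ u ∈ b, x ∈ cone u}

lemma region_append (a b : List (List Bool)) : region (a ++ b) = region a ∪ region b := by
  ext x; simp [region, or_and_right, exists_or]

lemma region_cons (u : List Bool) (b : List (List Bool)) :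
    region (u :: b) = cone u ∪ region b := by
  ext x; simp [region]

lemma region_nil : region [] = ∅ := by
  ext x; simp [region]

lemma region_reverse (b : List (List Bool)) : region b.reverse = region b := by
  ext x; simp [region]

/-- A planar rooted tree (every inner vertex having at least two sons) whose leaves are labelled
bijectively by the leaves of a finite dyadic tree with at least two leaves. `labels` lists the
labels of the leaves from left to right. An inner vertex other than the root is recorded through
the set of boundary points below the labels of the leaves descending from it, and `verts` is the
set of these vertices; thus `verts` is a nested collection of proper blocks of at least two
consecutive leaves. -/
@[ext] structure LTree where
  labels : List (List Bool)
  verts : Set (Set Bdry)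
  two_le : 2 ≤ labels.length
  disj : labels.Pairwise fun u v => Disjoint (cone u) (cone v)
  cover : ∀ x : Bdry, ∃ u ∈ labels, x ∈ cone u
  block : ∀ A ∈ verts, ∃ l b r, labels = l ++ b ++ r ∧ 2 ≤ b.length ∧
    b.length < labels.length ∧ region b = A
  nested : ∀ A ∈ verts, ∀ B ∈ verts, A ⊆ B ∨ B ⊆ A ∨ Disjoint A B

/-- `y` is obtained from `x` by a simple dyadic expansion: a leaf labelled `u` is replaced by an
inner vertex carrying two leaves labelled by the two sons of `u`. (The two planar orders of the two
new leaves are exchanged by the reflection at the new vertex, so either may be used.) -/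
def Expand (x y : LTree) : Prop :=
  ∃ l u r s, x.labels = l ++ u :: r ∧ y.labels = l ++ (u ++ [s]) :: (u ++ [!s]) :: r ∧
    y.verts = insert (cone u) x.verts

/-- The elementary moves generating the incidence relation between the strata of the tower:
contraction of inner edges (the stratum of `x` lies in the closure of the stratum of `y`),
reflection of the subtree below an inner vertex other than the root (same stratum), and simple
dyadic expansion together with its inverse (same stratum of the tower). -/
inductive Step (x y : LTree) : Prop
  | contract (hl : y.labels = x.labels) (hv : y.verts ⊆ x.verts) : Step x y
  | flip (l b r : List (List Bool)) (hx : x.labels = l ++ b ++ r)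
      (hy : y.labels = l ++ b.reverse ++ r) (hb : region b ∈ x.verts)
      (hv : y.verts = x.verts) : Step x y
  | expand (h : Expand x y) : Step x y
  | collapse (h : Expand y x) : Step x y

/-- `x ≤ y` when the stratum of `x` is contained in the closure of the stratum of `y`. -/
instance : Preorder LTree where
  le := Relation.ReflTransGen Step
  le_refl _ := .refl
  le_trans _ _ _ := .trans

/-- The poset of strata of the tower of two-sheeted covers of the real moduli spaces
(the inductive limit over all dyadic expansions): labelled planar trees up to reflections at inner
vertices other than the root and up to dyadic expansion. -/
abbrev Stratum : Type := Antisymmetrization LTree (· ≤ ·)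

abbrev stratum (x : LTree) : Stratum := toAntisymmetrization (· ≤ ·) x

lemma Step.le {x y : LTree} (h : Step x y) : x ≤ y := Relation.ReflTransGen.single h

lemma Expand.le {x y : LTree} (h : Expand x y) : x ≤ y := (Step.expand h).le

lemma Expand.ge {x y : LTree} (h : Expand x y) : y ≤ x := (Step.collapse h).le

lemma split3 {l b r l₁ r₁ : List (List Bool)} {u : List Bool} (h : l ++ b ++ r = l₁ ++ u :: r₁) :
    (∃ a, r = a ++ u :: r₁ ∧ l₁ = l ++ b ++ a) ∨
    (∃ a c, b = a ++ u :: c ∧ l₁ = l ++ a ∧ r₁ = c ++ r) ∨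
    (∃ d, l = l₁ ++ u :: d ∧ r₁ = d ++ b ++ r) := by
  rcases List.append_eq_append_iff.1 h with ⟨a, h1, h2⟩ | ⟨c, h1, h2⟩
  · exact .inl ⟨a, h2, h1⟩
  · rcases List.cons_eq_append_iff.1 h2 with ⟨rfl, h3⟩ | ⟨c', rfl, h3⟩
    · exact .inl ⟨[], by simp [h3], by simpa using h1.symm⟩
    · rcases List.append_eq_append_iff.1 h1 with ⟨a, h4, h5⟩ | ⟨d, h4, h5⟩
      · exact .inr (.inl ⟨a, c', h5, h4, h3⟩)
      · rcases List.cons_eq_append_iff.1 h5 with ⟨rfl, h6⟩ | ⟨d', rfl, h6⟩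
        · exact .inr (.inl ⟨[], c', by simp [h6], by simpa using h4.symm, h3⟩)
        · exact .inr (.inr ⟨d', h4, by simp [h3, h6]⟩)

/-- The result of a simple dyadic expansion. -/
def LTree.grow (x : LTree) (l : List (List Bool)) (u : List Bool) (r : List (List Bool)) (s : Bool)
    (h : x.labels = l ++ u :: r) : LTree where
  labels := l ++ (u ++ [s]) :: (u ++ [!s]) :: r
  verts := insert (cone u) x.verts
  two_le := by simp; omega
  disj := by
    have hd := x.disj
    have hc := cone_child u s
    have h1 : cone (u ++ [s]) ⊆ cone u := hc ▸ Set.subset_union_left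
    have h2 : cone (u ++ [!s]) ⊆ cone u := hc ▸ Set.subset_union_right
    rw [h, List.pairwise_append, List.pairwise_cons] at hd
    obtain ⟨hl, ⟨hu, hr⟩, hlr⟩ := hd
    refine List.pairwise_append.2 ⟨hl, List.pairwise_cons.2 ⟨?_, List.pairwise_cons.2 ⟨?_, hr⟩⟩, ?_⟩
    · intro v hv
      rcases List.mem_cons.1 hv with rfl | hv
      · exact cone_child_disjoint u s
      · exact (hu v hv).mono_left h1
    · intro v hv
      exact (hu v hv).mono_left h2
    · intro a ha v hv
      rcases List.mem_cons.1 hv with rfl | hv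
      · exact (hlr a ha u (by simp)).mono_right h1
      rcases List.mem_cons.1 hv with rfl | hv
      · exact (hlr a ha u (by simp)).mono_right h2
      · exact hlr a ha v (by simp [hv])
  cover := fun z => by
    obtain ⟨v, hv, hz⟩ := x.cover z
    rw [h] at hv
    rcases List.mem_append.1 hv with hv | hv
    · exact ⟨v, by simp [hv], hz⟩
    rcases List.mem_cons.1 hv with rfl | hv
    · rw [cone_child v s] at hz
      rcases hz with hz | hz
      · exact ⟨_, by simp, hz⟩
      · exact ⟨v ++ [!s], by simp, hz⟩
    · exact ⟨v, by simp [hv], hz⟩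
  block := by
    have h2 := x.two_le
    rw [h] at h2
    have hc := cone_child u s
    intro A hA
    rcases hA with rfl | hA
    · refine ⟨l, [u ++ [s], u ++ [!s]], r, by simp, by simp, ?_, ?_⟩
      · simp at h2 ⊢; omega
      · rw [region_cons, region_cons, region_nil, hc]; simp
    · obtain ⟨l', b, r', hx, hb, hb', rfl⟩ := x.block A hA
      rw [hx] at h hb'
      rcases split3 h with ⟨a, rfl, rfl⟩ | ⟨a, c, rfl, rfl, rfl⟩ | ⟨d, rfl, rfl⟩
      · exact ⟨l', b, a ++ (u ++ [s]) :: (u ++ [!s]) :: r, by simp, hb, by simp; omega, rfl⟩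
      · refine ⟨l', a ++ (u ++ [s]) :: (u ++ [!s]) :: c, r', by simp, by simp; omega, ?_, ?_⟩
        · simp at hb' ⊢; omega
        · simp only [region_append, region_cons, hc, Set.union_assoc]
      · exact ⟨l ++ (u ++ [s]) :: (u ++ [!s]) :: d, b, r', by simp, hb, by simp; omega, rfl⟩
  nested := by
    have key : ∀ A ∈ x.verts, cone u ⊆ A ∨ Disjoint (cone u) A := by
      intro A hA
      obtain ⟨l', b, r', hx, hb, hb', rfl⟩ := x.block A hA
      by_cases hu : u ∈ b
      · exact .inl fun z hz => ⟨u, hu, hz⟩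
      · right
        rw [Set.disjoint_left]
        rintro z hz ⟨v, hv, hzv⟩
        have hne : u ≠ v := fun e => hu (e ▸ hv)
        have hmu : u ∈ x.labels := by simp [h]
        have hmv : v ∈ x.labels := by simp [hx, hv]
        have hsym : Std.Symm fun u v : List Bool => Disjoint (cone u) (cone v) :=
          ⟨fun _ _ h => h.symm⟩
        have := x.disj.forall hmu hmv hne
        exact Set.disjoint_left.1 this hz hzv
    rintro A (rfl | hA) B (rfl | hB)
    · exact .inl subset_rfl
    · rcases key B hB with h | h
      · exact .inl h
      · exact .inr (.inr h)
    · rcases key A hA with h | h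
      · exact .inr (.inl h)
      · exact .inr (.inr h.symm)
    · exact x.nested A hA B hB

lemma LTree.expand_grow (x : LTree) {l u r} (s) (h : x.labels = l ++ u :: r) :
    Expand x (x.grow l u r s h) := ⟨l, u, r, s, h, rfl, rfl⟩

/-- Moves which do not shorten labels. -/
def Fwd (x y : LTree) : Prop :=
  (y.labels = x.labels ∧ y.verts ⊆ x.verts) ∨
  (∃ l b r, x.labels = l ++ b ++ r ∧ y.labels = l ++ b.reverse ++ r ∧ region b ∈ x.verts ∧
    y.verts = x.verts) ∨ Expand x y

lemma Fwd.step {x y : LTree} : Fwd x y → Step x y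
  | .inl ⟨h, h'⟩ => .contract h h'
  | .inr (.inl ⟨l, b, r, h₁, h₂, h₃, h₄⟩) => .flip l b r h₁ h₂ h₃ h₄
  | .inr (.inr h) => .expand h

lemma diamond {x y x' : LTree} (h : Step x y) (hx : Expand x x') :
    ∃ y', Relation.ReflTransGen Expand y y' ∧ (x' = y' ∨ Fwd x' y') := by
  obtain ⟨l, u, r, s, h1, h2, h3⟩ := hx
  rcases h with ⟨hl, hv⟩ | ⟨l', b, r', hx, hy, hb, hv⟩ | ⟨l', u', r', s', h1', h2', h3'⟩ | h
  · refine ⟨y.grow l u r s (hl.trans h1), .single (y.expand_grow _ _), .inr (.inl ⟨h2.symm, ?_⟩)⟩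
    rw [h3]
    exact Set.insert_subset_insert hv
  · rw [hx] at h1
    rcases split3 h1 with ⟨a, rfl, rfl⟩ | ⟨a, c, rfl, rfl, rfl⟩ | ⟨d, rfl, rfl⟩
    · refine ⟨y.grow (l' ++ b.reverse ++ a) u r s (by simp [hy]), .single (y.expand_grow _ _),
        .inr (.inr (.inl ⟨l', b, a ++ (u ++ [s]) :: (u ++ [!s]) :: r, by simp [h2],
          by simp [LTree.grow], by simp [h3, hb], by simp [LTree.grow, h3, hv]⟩))⟩
    · refine ⟨y.grow (l' ++ c.reverse) u (a.reverse ++ r') (!s) (by simp [hy]),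
        .single (y.expand_grow _ _),
        .inr (.inr (.inl ⟨l', a ++ (u ++ [s]) :: (u ++ [!s]) :: c, r', by simp [h2],
          by simp [LTree.grow], ?_, by simp [LTree.grow, h3, hv]⟩))⟩
      rw [h3]; right
      have hc := cone_child u s
      simpa only [region_append, region_cons, hc, Set.union_assoc] using hb
    · refine ⟨y.grow l u (d ++ b.reverse ++ r') s (by simp [hy]), .single (y.expand_grow _ _),
        .inr (.inr (.inl ⟨l ++ (u ++ [s]) :: (u ++ [!s]) :: d, b, r', by simp [h2],
          by simp [LTree.grow], by simp [h3, hb], by simp [LTree.grow, h3, hv]⟩))⟩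
  · rw [h1'] at h1
    rcases split3 (b := [u']) (by simpa using h1) with ⟨a, rfl, rfl⟩ | ⟨a, c, hac, rfl, rfl⟩ |
      ⟨d, rfl, rfl⟩
    · refine ⟨y.grow (l' ++ (u' ++ [s']) :: (u' ++ [!s']) :: a) u r s (by simp [h2']),
        .single (y.expand_grow _ _), .inr (.inr (.inr ⟨l', u', a ++ (u ++ [s]) :: (u ++ [!s]) :: r,
        s', by simp [h2], by simp [LTree.grow], ?_⟩))⟩
      simp [LTree.grow, h3, h3', Set.insert_comm]
    · have hn : a = [] ∧ u = u' ∧ c = [] := by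
        rcases a with _ | ⟨a₁, a₂⟩
        · simp at hac; exact ⟨rfl, hac.1.symm, hac.2⟩
        · simp at hac
      obtain ⟨rfl, rfl, rfl⟩ := hn
      by_cases hs : s = s'
      · subst hs
        refine ⟨y, .refl, .inl ?_⟩
        ext1
        · simp [h2, h2']
        · rw [h3, h3']
      · have hs' : s' = !s := by revert hs; cases s <;> cases s' <;> simp
        subst hs'
        refine ⟨y, .refl, .inr (.inr (.inl ⟨l', [u ++ [s], u ++ [!s]], r', by simp [h2],
          by simp [h2'], ?_, by rw [h3, h3']⟩))⟩
        rw [h3]; left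
        rw [region_cons, region_cons, region_nil, cone_child u s]; simp
    · refine ⟨y.grow l u (d ++ (u' ++ [s']) :: (u' ++ [!s']) :: r') s (by simp [h2']),
        .single (y.expand_grow _ _), .inr (.inr (.inr ⟨l ++ (u ++ [s]) :: (u ++ [!s]) :: d, u', r',
        s', by simp [h2], by simp [LTree.grow], ?_⟩))⟩
      simp [LTree.grow, h3, h3', Set.insert_comm]
  · exact ⟨x', (Relation.ReflTransGen.single h).tail ⟨l, u, r, s, h1, h2, h3⟩, .inl rfl⟩

/-- `g` is an isomorphism of dyadic trees below every label of `x`. -/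
def Regular (g : Equiv.Perm Bdry) (x : LTree) : Prop := ∀ u ∈ x.labels, ∃ v, MapsCone g u v

open Classical in
/-- The vertex to which `g` maps the vertex `u`, if `g` is an isomorphism of dyadic trees
below `u`. -/
noncomputable def vmap (g : Equiv.Perm Bdry) (u : List Bool) : List Bool :=
  if h : ∃ v, MapsCone g u v then h.choose else []

lemma vmap_spec {g : Equiv.Perm Bdry} {u : List Bool} (h : ∃ v, MapsCone g u v) :
    MapsCone g u (vmap g u) := by
  rw [vmap, dif_pos h]; exact h.choose_spec

lemma MapsCone.vmap_eq {g : Equiv.Perm Bdry} {u v : List Bool} (h : MapsCone g u v) :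
    vmap g u = v := (vmap_spec ⟨v, h⟩).eq_of h

lemma region_map {g : Equiv.Perm Bdry} {b : List (List Bool)}
    (h : ∀ u ∈ b, ∃ v, MapsCone g u v) : region (b.map (vmap g)) = g '' region b := by
  induction b with
  | nil => simp [region_nil]
  | cons u b ih =>
    rw [List.map_cons, region_cons, region_cons, Set.image_union,
      (vmap_spec (h u (by simp))).image, ih fun v hv => h v (by simp [hv])]

/-- Replacing each label of a labelled tree by its image under `g`. -/
noncomputable def relabel (g : Equiv.Perm Bdry) (x : LTree) (h : Regular g x) : LTree where
  labels := x.labels.map (vmap g)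
  verts := (fun A => g '' A) '' x.verts
  two_le := by simpa using x.two_le
  disj := by
    rw [List.pairwise_map]
    refine x.disj.imp_of_mem fun {u v} hu hv huv => ?_
    rw [← (vmap_spec (h u hu)).image, ← (vmap_spec (h v hv)).image]
    exact (Set.disjoint_image_iff g.injective).2 huv
  cover := fun z => by
    obtain ⟨u, hu, hz⟩ := x.cover (g⁻¹ z)
    refine ⟨_, List.mem_map_of_mem hu, ?_⟩
    rw [← (vmap_spec (h u hu)).image]
    exact ⟨_, hz, by simp⟩
  block := by
    rintro _ ⟨A, hA, rfl⟩
    obtain ⟨l, b, r, hx, h1, h2, rfl⟩ := x.block A hA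
    exact ⟨l.map (vmap g), b.map (vmap g), r.map (vmap g), by simp [hx], by simpa using h1,
      by simpa using h2, region_map fun u hu => h u (by simp [hx, hu])⟩
  nested := by
    rintro _ ⟨A, hA, rfl⟩ _ ⟨B, hB, rfl⟩
    rcases x.nested A hA B hB with h | h | h
    · exact .inl (Set.image_mono h)
    · exact .inr (.inl (Set.image_mono h))
    · exact .inr (.inr ((Set.disjoint_image_iff g.injective).2 h))

lemma Regular.expand {g : Equiv.Perm Bdry} {x y : LTree} (hx : Regular g x) (h : Expand x y) :
    Regular g y := by
  obtain ⟨l, u, r, s, h1, h2, h3⟩ := h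
  obtain ⟨v, hv⟩ := hx u (by simp [h1])
  obtain ⟨t, ht, ht'⟩ := hv.child s
  intro w hw
  rw [h2] at hw
  simp only [List.mem_append, List.mem_cons] at hw
  rcases hw with hw | rfl | rfl | hw
  · exact hx w (by simp [h1, hw])
  · exact ⟨_, ht⟩
  · exact ⟨_, ht'⟩
  · exact hx w (by simp [h1, hw])

lemma Regular.expands {g : Equiv.Perm Bdry} {x y : LTree} (hx : Regular g x)
    (h : Relation.ReflTransGen Expand x y) : Regular g y := by
  induction h with
  | refl => exact hx
  | tail _ h ih => exact ih.expand h

lemma Regular.fwd {g : Equiv.Perm Bdry} {x y : LTree} (hx : Regular g x) (h : Fwd x y) :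
    Regular g y := by
  rcases h with ⟨h, -⟩ | ⟨l, b, r, h1, h2, -, -⟩ | h
  · intro u hu; exact hx u (h ▸ hu)
  · intro u hu; refine hx u ?_
    rw [h2] at hu; rw [h1]; simpa using hu
  · exact hx.expand h

lemma Expand.relabel {g : Equiv.Perm Bdry} {x y : LTree} (h : Expand x y) (hx : Regular g x)
    (hy : Regular g y) : Expand (relabel g x hx) (relabel g y hy) := by
  obtain ⟨l, u, r, s, h1, h2, h3⟩ := h
  obtain ⟨v, hv⟩ := hx u (by simp [h1])
  obtain ⟨t, ht, ht'⟩ := hv.child s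
  refine ⟨l.map (vmap g), v, r.map (vmap g), t, ?_, ?_, ?_⟩
  · simp [DyadicCircle.relabel, h1, hv.vmap_eq]
  · simp [DyadicCircle.relabel, h2, ht.vmap_eq, ht'.vmap_eq]
  · simp [DyadicCircle.relabel, h3, Set.image_insert_eq, hv.image]

lemma Fwd.relabel {g : Equiv.Perm Bdry} {x y : LTree} (h : Fwd x y) (hx : Regular g x)
    (hy : Regular g y) : Step (relabel g x hx) (relabel g y hy) := by
  rcases h with ⟨h, h'⟩ | ⟨l, b, r, h1, h2, h3, h4⟩ | h
  · exact .contract (by simp [DyadicCircle.relabel, h]) (Set.image_mono h')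
  · refine .flip (l.map (vmap g)) (b.map (vmap g)) (r.map (vmap g)) ?_ ?_ ?_ ?_
    · simp [DyadicCircle.relabel, h1]
    · simp [DyadicCircle.relabel, h2]
    · exact ⟨_, h3, (region_map fun u hu => hx u (by simp [h1, hu])).symm⟩
    · simp [DyadicCircle.relabel, h4]
  · exact .expand (h.relabel hx hy)

lemma expands_relabel {g : Equiv.Perm Bdry} {x y : LTree}
    (h : Relation.ReflTransGen Expand x y) (hx : Regular g x) (hy : Regular g y) :
    relabel g x hx ≤ relabel g y hy ∧ relabel g y hy ≤ relabel g x hx := by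
  induction h with
  | refl => exact ⟨le_rfl, le_rfl⟩
  | @tail b c hb h ih =>
    have hb' := hx.expands hb
    have := h.relabel hb' hy
    exact ⟨(ih hb').1.trans this.le, this.ge.trans (ih hb').2⟩

lemma strip {x x' : LTree} (hx : Relation.ReflTransGen Expand x x') : ∀ {y : LTree}, Step x y →
    ∃ y', Relation.ReflTransGen Expand y y' ∧ (x' = y' ∨ Fwd x' y') := by
  induction hx using Relation.ReflTransGen.head_induction_on with
  | refl =>
    intro y h
    rcases h with ⟨h, h'⟩ | ⟨l, b, r, h1, h2, h3, h4⟩ | h | h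
    · exact ⟨y, .refl, .inr (.inl ⟨h, h'⟩)⟩
    · exact ⟨y, .refl, .inr (.inr (.inl ⟨l, b, r, h1, h2, h3, h4⟩))⟩
    · exact ⟨y, .refl, .inr (.inr (.inr h))⟩
    · exact ⟨x', .single h, .inl rfl⟩
  | head hab hbc ih =>
    intro y h
    obtain ⟨y₁, hy, h1⟩ := diamond h hab
    rcases h1 with rfl | h1
    · exact ⟨x', hy.trans hbc, .inl rfl⟩
    · obtain ⟨y', hy', h2⟩ := ih h1.step
      exact ⟨y', hy.trans hy', h2⟩

lemma relabel_simulate {g : Equiv.Perm Bdry} {x y x' : LTree} (h : x ≤ y)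
    (hx : Relation.ReflTransGen Expand x x') (hr : Regular g x') :
    ∃ y', ∃ hy : Regular g y', Relation.ReflTransGen Expand y y' ∧
      relabel g x' hr ≤ relabel g y' hy := by
  change Relation.ReflTransGen Step x y at h
  induction h with
  | refl => exact ⟨x', hr, hx, le_rfl⟩
  | tail _ h ih =>
    obtain ⟨b', hb, hb', hle⟩ := ih
    obtain ⟨c', hc, h1⟩ := strip hb' h
    rcases h1 with rfl | h1
    · exact ⟨b', hb, hc, hle⟩
    · exact ⟨c', hb.fwd h1, hc, hle.trans (h1.relabel hb (hb.fwd h1)).le⟩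

lemma relabel_mono {g : Equiv.Perm Bdry} {x y : LTree} (h : x ≤ y) (hx : Regular g x)
    (hy : Regular g y) : relabel g x hx ≤ relabel g y hy := by
  obtain ⟨y', hy', h1, h2⟩ := relabel_simulate h .refl hx
  exact h2.trans (expands_relabel h1 hy hy').2

lemma expands_le {x y : LTree} (h : Relation.ReflTransGen Expand x y) : x ≤ y ∧ y ≤ x := by
  induction h with
  | refl => exact ⟨le_rfl, le_rfl⟩
  | tail _ h ih => exact ⟨ih.1.trans h.le, h.ge.trans ih.2⟩

lemma exists_regular (g : neretin) (x : LTree) :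
    ∃ x', Relation.ReflTransGen Expand x x' ∧ Regular g x' := by
  obtain ⟨n, hn⟩ := g.2
  suffices H : ∀ (N : ℕ) (x : LTree), (x.labels.map fun u => 2 ^ (n - u.length) - 1).sum ≤ N →
      ∃ x', Relation.ReflTransGen Expand x x' ∧ Regular g x' from H _ x le_rfl
  intro N
  induction N with
  | zero =>
    intro x hx
    refine ⟨x, .refl, fun u hu => ?_⟩
    have h0 := List.sum_eq_zero_iff.1 (Nat.le_zero.1 hx) _ (List.mem_map_of_mem hu)
    have hle : n ≤ u.length := by
      by_contra hlt
      have : 1 < 2 ^ (n - u.length) := Nat.one_lt_two_pow (by omega)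
      omega
    obtain ⟨v, hv⟩ := hn (u.take n) (by simpa using hle)
    obtain ⟨w, -, hw⟩ := hv.extend (u.drop n)
    rw [List.take_append_drop] at hw
    exact ⟨_, hw⟩
  | succ N ih =>
    intro x hx
    by_cases h : ∃ u ∈ x.labels, u.length < n
    · obtain ⟨u, hu, hlt⟩ := h
      obtain ⟨l, r, hlr⟩ := List.append_of_mem hu
      obtain ⟨x', h1, h2⟩ := ih (x.grow l u r false hlr) (by
        rw [hlr] at hx
        simp only [LTree.grow, List.map_append, List.map_cons, List.sum_append, List.sum_cons,
          List.length_append, List.length_singleton] at hx ⊢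
        have e : n - u.length = (n - (u.length + 1)) + 1 := by omega
        rw [e, pow_succ] at hx
        have : 0 < 2 ^ (n - (u.length + 1)) := by positivity
        omega)
      exact ⟨x', .head (x.expand_grow _ _) h1, h2⟩
    · push Not at h
      refine ih x ?_
      have : (x.labels.map fun u => 2 ^ (n - u.length) - 1).sum = 0 := by
        rw [List.sum_eq_zero_iff]
        intro a ha
        obtain ⟨u, hu, rfl⟩ := List.mem_map.1 ha
        simp [Nat.sub_eq_zero_of_le (h u hu)]
      omega

/-- The action of an element of Neretin's group on the strata of the tower: expand until `g` is an
isomorphism of dyadic trees below every label, and then replace each label by its image. -/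
noncomputable def actFun (g : neretin) (s : Stratum) : Stratum :=
  Quotient.liftOn s (fun x => stratum
    (relabel g (exists_regular g x).choose (exists_regular g x).choose_spec.2))
    fun x y h => by
      have hx := (exists_regular g x).choose_spec
      have hy := (exists_regular g y).choose_spec
      have ex := expands_le hx.1
      have ey := expands_le hy.1
      exact Quotient.sound ⟨relabel_mono (ex.2.trans (h.1.trans ey.1)) _ _,
        relabel_mono (ey.2.trans (h.2.trans ex.1)) _ _⟩

lemma actFun_mk (g : neretin) (x : LTree) (hx : Regular g x) :
    actFun g (stratum x) = stratum (relabel g x hx) := by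
  have hx' := (exists_regular g x).choose_spec
  have e := expands_le hx'.1
  exact Quotient.sound ⟨relabel_mono e.2 _ _, relabel_mono e.1 _ _⟩

lemma stratum_eq {x y : LTree} (h : Relation.ReflTransGen Expand x y) : stratum x = stratum y :=
  Quotient.sound (expands_le h)

lemma stratum_le {x y : LTree} (h : x ≤ y) : stratum x ≤ stratum y :=
  toAntisymmetrization_le_toAntisymmetrization_iff.2 h

lemma actFun_mono (g : neretin) : Monotone (actFun g) := by
  intro s t
  induction s using Quotient.inductionOn with | h x => ?_
  induction t using Quotient.inductionOn with | h y => ?_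
  intro h
  have h : x ≤ y := toAntisymmetrization_le_toAntisymmetrization_iff.1 h
  obtain ⟨x', hx, hx'⟩ := exists_regular g x
  obtain ⟨y', hy, hy'⟩ := exists_regular g y
  change actFun g (stratum x) ≤ actFun g (stratum y)
  rw [stratum_eq hx, stratum_eq hy, actFun_mk g x' hx', actFun_mk g y' hy']
  exact stratum_le (relabel_mono ((expands_le hx).2.trans (h.trans (expands_le hy).1)) _ _)

lemma actFun_one (s : Stratum) : actFun 1 s = s := by
  induction s using Quotient.inductionOn with | h x => ?_
  have h1 : ∀ u, MapsCone ((1 : neretin) : Equiv.Perm Bdry) u u :=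
    fun u => ⟨1, isTreeAut_one, fun _ => rfl⟩
  have hx : Regular (1 : neretin) x := fun u _ => ⟨u, h1 u⟩
  refine (actFun_mk 1 x hx).trans (congrArg _ ?_)
  ext1
  · have : vmap ((1 : neretin) : Equiv.Perm Bdry) = id := funext fun u => (h1 u).vmap_eq
    simp only [relabel, this, List.map_id]
  · simp [relabel]

lemma actFun_mul (g h : neretin) (s : Stratum) : actFun (g * h) s = actFun g (actFun h s) := by
  induction s using Quotient.inductionOn with | h x => ?_
  obtain ⟨x₁, hx₁, h1⟩ := exists_regular h x
  obtain ⟨x₂, hx₂, h2⟩ := exists_regular (g * h) x₁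
  have h1 := h1.expands hx₂
  have key : ∀ u ∈ x₂.labels, MapsCone g (vmap h u) (vmap (g * h : neretin) u) := fun u hu => by
    have e := (vmap_spec (h2 u hu)).mul (vmap_spec (h1 u hu)).inv
    simpa using e
  have h3 : Regular g (relabel h x₂ h1) := by
    intro v hv
    obtain ⟨u, hu, rfl⟩ := List.mem_map.1 hv
    exact ⟨_, key u hu⟩
  change actFun (g * h) (stratum x) = actFun g (actFun h (stratum x))
  rw [stratum_eq (hx₁.trans hx₂), actFun_mk _ _ h2, actFun_mk _ _ h1, actFun_mk _ _ h3]
  congr 1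
  ext1
  · simp only [relabel, List.map_map]
    exact List.map_congr_left fun u hu => ((key u hu).vmap_eq).symm
  · simp only [relabel, Set.image_image]
    simp

/-- The action of Neretin's group on the poset of strata of the tower. -/
noncomputable def act : neretin →* (Stratum ≃o Stratum) where
  toFun g :=
    { toFun := actFun g
      invFun := actFun g⁻¹
      left_inv := fun s => by rw [← actFun_mul, inv_mul_cancel, actFun_one]
      right_inv := fun s => by rw [← actFun_mul, mul_inv_cancel, actFun_one]
      map_rel_iff' := by
        intro s t
        refine ⟨fun h => ?_, fun h => actFun_mono g h⟩
        have := actFun_mono g⁻¹ h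
        simpa [← actFun_mul, actFun_one] using this }
  map_one' := by ext s; exact actFun_one s
  map_mul' g h := by ext s; exact actFun_mul g h s

/-- The vertices of depth `n` of the dyadic tree, from left to right. -/
def dyadicWords : ℕ → List (List Bool)
  | 0 => [[]]
  | n + 1 => (dyadicWords n).flatMap fun u => [u ++ [false], u ++ [true]]

lemma length_dyadicWords (n : ℕ) : (dyadicWords n).length = 2 ^ n := by
  induction n with
  | zero => rfl
  | succ n ih => simp [dyadicWords, List.length_flatMap, ih, pow_succ]

/-- The `i`-th vertex of depth `n` of the dyadic tree. -/
def dyadicWord (n : ℕ) (i : Fin (2 ^ n)) : List Bool :=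
  (dyadicWords n)[(i : ℕ)]'((length_dyadicWords n).symm ▸ i.2)

lemma dyadicWords_spec (n : ℕ) :
    (dyadicWords n).Pairwise (fun u v => Disjoint (cone u) (cone v)) ∧
      ∀ x : Bdry, ∃ u ∈ dyadicWords n, x ∈ cone u := by
  induction n with
  | zero => exact ⟨List.pairwise_singleton _ _, fun x => ⟨[], by simp [dyadicWords], x, rfl⟩⟩
  | succ n ih =>
    have hc : ∀ u, cone (u ++ [false]) ⊆ cone u ∧ cone (u ++ [true]) ⊆ cone u := fun u =>
      ⟨cone_child u false ▸ Set.subset_union_left, cone_child u false ▸ Set.subset_union_right⟩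
    constructor
    · rw [dyadicWords, List.pairwise_flatMap]
      refine ⟨fun u _ => by simpa using cone_child_disjoint u false, ih.1.imp ?_⟩
      intro u v huv a ha b hb
      simp only [List.mem_cons, List.not_mem_nil, or_false] at ha hb
      refine huv.mono ?_ ?_
      · rcases ha with rfl | rfl
        exacts [(hc u).1, (hc u).2]
      · rcases hb with rfl | rfl
        exacts [(hc v).1, (hc v).2]
    · intro x
      obtain ⟨u, hu, hx⟩ := ih.2 x
      rw [cone_child u false] at hx
      rcases hx with hx | hx
      · exact ⟨_, List.mem_flatMap.2 ⟨u, hu, by simp⟩, hx⟩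
      · exact ⟨_, List.mem_flatMap.2 ⟨u, hu, by simp⟩, hx⟩

lemma ofFn_dyadicWord (n : ℕ) : List.ofFn (dyadicWord n) = dyadicWords n := by
  apply List.ext_getElem
  · simp [length_dyadicWords]
  · intro i h1 h2
    simp [dyadicWord]

/-- The labels of the leaves of the planar tree `T(σ)`, when `1, ..., 2 ^ n` are identified with
the vertices of depth `n` of the dyadic tree. -/
def permLabels (n : ℕ) (σ : Equiv.Perm (Fin (2 ^ n))) : List (List Bool) :=
  List.ofFn fun i => dyadicWord n (σ i)

lemma disj_permLabels (n : ℕ) (σ : Equiv.Perm (Fin (2 ^ n))) :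
    (permLabels n σ).Pairwise fun u v => Disjoint (cone u) (cone v) := by
  have h := (dyadicWords_spec n).1
  rw [← ofFn_dyadicWord, List.pairwise_ofFn] at h
  rw [permLabels, List.pairwise_ofFn]
  intro i j hij
  rcases lt_or_gt_of_ne (σ.injective.ne hij.ne) with h' | h'
  · exact h h'
  · exact (h h').symm

lemma cover_permLabels (n : ℕ) (σ : Equiv.Perm (Fin (2 ^ n))) (x : Bdry) :
    ∃ u ∈ permLabels n σ, x ∈ cone u := by
  obtain ⟨u, hu, hx⟩ := (dyadicWords_spec n).2 x
  rw [← ofFn_dyadicWord, List.mem_ofFn] at hu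
  obtain ⟨i, rfl⟩ := hu
  exact ⟨_, List.mem_ofFn.2 ⟨σ⁻¹ i, by simp⟩, hx⟩

lemma length_permLabels (n : ℕ) (σ : Equiv.Perm (Fin (2 ^ n))) :
    (permLabels n σ).length = 2 ^ n := by simp [permLabels]

/-- The star with `2 ^ (n + 1)` leaves labelled by `σ`: it labels the top-dimensional cell `σ` of
the two-sheeted cover with `2 ^ (n + 1) + 1` marked points. -/
def topTree (n : ℕ) (σ : Equiv.Perm (Fin (2 ^ (n + 1)))) : LTree where
  labels := permLabels (n + 1) σ
  verts := ∅
  two_le := by rw [length_permLabels, pow_succ]; have := Nat.one_le_two_pow (n := n); omega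
  disj := disj_permLabels _ σ
  cover := cover_permLabels _ σ
  block := fun _ h => h.elim
  nested := fun _ h => h.elim

/-- The proper subset `{σ_a, ..., σ_(b-1)}` of the set of Coxeter generators of the symmetric group
on `n` letters, with connected Coxeter graph; it is given by the interval `a, ..., b` of letters
which it permutes (letters are numbered from `0` to `n - 1`). -/
structure Itv (n : ℕ) where
  a : ℕ
  b : ℕ
  lt : a < b
  lt_n : b < n
  proper : ¬ (a = 0 ∧ b + 1 = n)

namespace Itv

variable {n : ℕ}

/-- The number of letters of the interval. -/
def size (T : Itv n) : ℕ := T.b - T.a + 1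

/-- The permutation reversing the interval. -/
def rev (T : Itv n) : Equiv.Perm (Fin n) :=
  Function.Involutive.toPerm
    (fun i => if h : T.a ≤ i ∧ (i : ℕ) ≤ T.b then
      ⟨T.a + T.b - i, by have := T.lt_n; omega⟩ else i)
    (fun i => by
      by_cases h : T.a ≤ i ∧ (i : ℕ) ≤ T.b
      · have h' : T.a ≤ T.a + T.b - i ∧ T.a + T.b - i ≤ T.b := by omega
        ext; simp only [dif_pos h, dif_pos h']; omega
      · simp only [dif_neg h])

lemma rev_val (T : Itv n) (i : Fin n) :
    (T.rev i : ℕ) = if T.a ≤ i ∧ (i : ℕ) ≤ T.b then T.a + T.b - i else i := by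
  by_cases h : T.a ≤ i ∧ (i : ℕ) ≤ T.b
  · rw [if_pos h]; simp [rev, Function.Involutive.toPerm, dif_pos h]
  · rw [if_neg h]; simp [rev, Function.Involutive.toPerm, dif_neg h]

/-- The image of the interval `U ⊆ T` under the reversal of `T`. -/
def conj (T U : Itv n) (h : T.a ≤ U.a ∧ U.b ≤ T.b) : Itv n where
  a := T.a + T.b - U.b
  b := T.a + T.b - U.a
  lt := by have := U.lt; omega
  lt_n := by have := T.lt_n; omega
  proper := by have := T.proper; have := T.lt; have := T.lt_n; have := U.lt; omega

end Itv

/-- The relations of the quasi-braid group. -/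
inductive QRel (n : ℕ) : FreeGroup (Itv n) → Prop
  | sq (T : Itv n) : QRel n (.of T * .of T)
  | nest (T U : Itv n) (h : T.a ≤ U.a ∧ U.b ≤ T.b) :
      QRel n (.of T * .of U * (.of (T.conj U h) * .of T)⁻¹)
  | comm (T U : Itv n) (h : T.b < U.a) : QRel n (.of T * .of U * (.of U * .of T)⁻¹)

/-- The quasi-braid group on `n` strands. -/
abbrev QBraid (n : ℕ) : Type := PresentedGroup {r | QRel n r}

/-- The generators of the quasi-braid group. -/
def QBraid.gen {n : ℕ} (T : Itv n) : QBraid n := PresentedGroup.of T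

/-- The projection of the quasi-braid group to the symmetric group. -/
def QBraid.perm (n : ℕ) : QBraid n →* Equiv.Perm (Fin n) :=
  PresentedGroup.toGroup (f := Itv.rev) (by
    rintro _ (T | ⟨T, U, h⟩ | ⟨T, U, h⟩)
    · ext i
      simp only [map_mul, FreeGroup.lift_apply_of, Equiv.Perm.mul_apply, Itv.rev_val,
        Equiv.Perm.one_apply]
      split_ifs <;> omega
    · rw [map_mul, map_inv, mul_inv_eq_one]
      ext i
      have := T.lt; have := U.lt
      simp only [map_mul, FreeGroup.lift_apply_of, Equiv.Perm.mul_apply, Itv.rev_val, Itv.conj]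
      split_ifs <;> omega
    · rw [map_mul, map_inv, mul_inv_eq_one]
      ext i
      have := T.lt; have := U.lt
      simp only [map_mul, FreeGroup.lift_apply_of, Equiv.Perm.mul_apply, Itv.rev_val]
      split_ifs <;> omega)

/-- The length modulo two of quasi-braids: a word `T_1, ..., T_r` in the generators has length
`r + |T_1| + ... + |T_r|`. -/
def QBraid.length (n : ℕ) : QBraid n →* Multiplicative (ZMod 2) :=
  PresentedGroup.toGroup (f := fun T : Itv n => Multiplicative.ofAdd ((1 + T.size : ℕ) : ZMod 2)) (by
    have h2 : ∀ z : Multiplicative (ZMod 2), z * z = 1 := by decide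
    rintro _ (T | ⟨T, U, h⟩ | ⟨T, U, h⟩)
    · rw [map_mul, h2]
    · have e : (T.conj U h).size = U.size := by
        have := U.lt; simp only [Itv.size, Itv.conj]; omega
      simp only [map_mul, map_inv, FreeGroup.lift_apply_of, e]
      rw [mul_inv_eq_one, mul_comm]
    · simp only [map_mul, map_inv, FreeGroup.lift_apply_of]
      rw [mul_inv_eq_one, mul_comm])

/-- The pure quasi-braid group on `n` strands, inside the quasi-braid group. -/
def QBraid.pure (n : ℕ) : Subgroup (QBraid n) := (QBraid.perm n).ker

/-- The word `T_1, ..., T_r` as an element of the quasi-braid group. -/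
def wordBraid {n : ℕ} (t : List (Itv n)) : QBraid n := (t.map QBraid.gen).prod

/-- The tree with one inner vertex other than the root, situated above the interval `T` of leaves:
it labels the wall between the top cells `σ` and `σ * T.rev`. -/
def wallTree (n : ℕ) (σ : Equiv.Perm (Fin (2 ^ (n + 1)))) (T : Itv (2 ^ (n + 1))) : LTree where
  labels := permLabels (n + 1) σ
  verts := {region (((permLabels (n + 1) σ).drop T.a).take T.size)}
  two_le := (topTree n σ).two_le
  disj := disj_permLabels _ σ
  cover := cover_permLabels _ σ
  block := by
    rintro _ rfl
    have h1 := T.lt; have h2 := T.lt_n; have h3 := T.proper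
    have hl := length_permLabels (n + 1) σ
    refine ⟨(permLabels (n + 1) σ).take T.a, _, ((permLabels (n + 1) σ).drop T.a).drop T.size,
      ?_, ?_, ?_, rfl⟩
    · rw [List.append_assoc, List.take_append_drop, List.take_append_drop]
    · rw [List.length_take, List.length_drop, hl, Itv.size]; omega
    · rw [List.length_take, List.length_drop, hl, Itv.size]; omega
  nested := by
    rintro _ rfl _ rfl
    exact .inl subset_rfl

/-- The top cell `σ` of the two-sheeted cover with `2 ^ (n + 1) + 1` marked points, as a stratum
of the tower. -/
abbrev cell (n : ℕ) (σ : Equiv.Perm (Fin (2 ^ (n + 1)))) : Stratum := stratum (topTree n σ)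

/-- The wall between two adjacent top cells, as a stratum of the tower. -/
abbrev wall (n : ℕ) (σ : Equiv.Perm (Fin (2 ^ (n + 1)))) (T : Itv (2 ^ (n + 1))) : Stratum :=
  stratum (wallTree n σ T)

lemma wall_le_left (n : ℕ) (σ : Equiv.Perm (Fin (2 ^ (n + 1)))) (T : Itv (2 ^ (n + 1))) :
    wall n σ T ≤ cell n σ :=
  stratum_le (show Step (wallTree n σ T) (topTree n σ) from
    .contract rfl (Set.empty_subset _)).le

lemma wall_le_right (n : ℕ) (σ : Equiv.Perm (Fin (2 ^ (n + 1)))) (T : Itv (2 ^ (n + 1))) :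
    wall n σ T ≤ cell n (σ * T.rev) := by
  have h1 := T.lt; have h2 := T.lt_n; have h3 := T.proper
  have hl := length_permLabels (n + 1) σ
  set L := permLabels (n + 1) σ with hL
  have e1 : L = L.take T.a ++ (L.drop T.a).take T.size ++ (L.drop T.a).drop T.size := by
    rw [List.append_assoc, List.take_append_drop, List.take_append_drop]
  have e2 : permLabels (n + 1) (σ * T.rev) =
      L.take T.a ++ ((L.drop T.a).take T.size).reverse ++ (L.drop T.a).drop T.size := by
    apply List.ext_getElem
    · simp [length_permLabels, hl, Itv.size]; omega
    · intro i hi hi'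
      have hin : i < 2 ^ (n + 1) := by simpa [length_permLabels] using hi
      have key : ∀ j k : Fin (2 ^ (n + 1)), T.rev j = k →
          (permLabels (n + 1) (σ * T.rev))[(j : ℕ)]'(by simp [length_permLabels]) =
            L[(k : ℕ)]'(by simp [hl]) := by
        rintro j _ rfl
        simp [hL, permLabels]
      simp only [List.getElem_append, List.getElem_reverse, List.getElem_take, List.getElem_drop,
        List.length_take, List.length_drop, List.length_append, List.length_reverse, hl, Itv.size]
      split_ifs with c1 c2
      · exact key ⟨i, hin⟩ ⟨_, by omega⟩ (by
          ext; rw [Itv.rev_val]; rw [if_neg] <;> simp <;> omega)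
      · exact key ⟨i, hin⟩ ⟨_, by omega⟩ (by
          ext; rw [Itv.rev_val]; rw [if_pos] <;> simp <;> omega)
      · exact key ⟨i, hin⟩ ⟨_, by omega⟩ (by
          ext; rw [Itv.rev_val]; rw [if_neg] <;> simp <;> omega)
  let W : LTree :=
    { topTree n (σ * T.rev) with
      verts := {region ((L.drop T.a).take T.size)}
      block := by
        rintro _ rfl
        refine ⟨_, _, _, e2, ?_, ?_, region_reverse _⟩
        · simp [hl, Itv.size]; omega
        · rw [show (topTree n (σ * T.rev)).labels.length = 2 ^ (n + 1) from length_permLabels _ _]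
          simp [hl, Itv.size]; omega
      nested := by
        rintro _ rfl _ rfl
        exact .inl subset_rfl }
  have s1 : Step (wallTree n σ T) W := .flip _ _ _ e1 e2 rfl rfl
  have s2 : Step W (topTree n (σ * T.rev)) := .contract rfl (Set.empty_subset _)
  exact stratum_le (s1.le.trans s2.le)

/-- The base point of the tower. -/
abbrev base : Stratum := cell 0 1

lemma expand_all (l r : List (List Bool)) : ∀ x : LTree, x.labels = l ++ r →
    ∃ y, x ≤ y ∧ y.labels = l ++ r.flatMap fun u => [u ++ [false], u ++ [true]] := by
  induction r generalizing l with
  | nil => intro x hx; exact ⟨x, le_rfl, by simpa using hx⟩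
  | cons u r ih =>
    intro x hx
    obtain ⟨y, hy, h⟩ := ih (l ++ [u ++ [false], u ++ [true]]) (x.grow l u r false hx)
      (by simp [LTree.grow])
    exact ⟨y, (x.expand_grow _ hx).le.trans hy, by simp [h]⟩

lemma base_le (n : ℕ) : base ≤ cell n 1 := by
  have hp : ∀ m, permLabels m 1 = dyadicWords m := fun m => by
    rw [← ofFn_dyadicWord]; rfl
  induction n with
  | zero => exact le_rfl
  | succ n ih =>
    obtain ⟨y, hy, h⟩ := expand_all [] _ (topTree n 1) (by rw [List.nil_append])
    have : y ≤ topTree (n + 1) 1 := by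
      refine (Step.contract ?_ (Set.empty_subset _)).le
      rw [h]
      simp only [topTree, hp, List.nil_append]
      rfl
    exact ih.trans (stratum_le (hy.trans this))

/-- The infinite pure quasi-braid group: the fundamental group of the tower at its base point, that
is, the vertex group of the fundamental groupoid of the poset of strata. -/
abbrev PureQBraid : Type := FreeGroupoid.mk base ⟶ FreeGroupoid.mk base

/-- The elementary edge path from the top cell `σ` to the adjacent top cell `σ * T.rev`, through
their common wall. -/
noncomputable def cross (n : ℕ) (σ : Equiv.Perm (Fin (2 ^ (n + 1)))) (T : Itv (2 ^ (n + 1))) :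
    FreeGroupoid.mk (cell n σ) ⟶ FreeGroupoid.mk (cell n (σ * T.rev)) :=
  Groupoid.inv (FreeGroupoid.homMk (homOfLE (wall_le_left n σ T))) ≫
    FreeGroupoid.homMk (homOfLE (wall_le_right n σ T))

/-- The end of the edge path given by a word, starting at the top cell `σ`. -/
def walkEnd {n : ℕ} : Equiv.Perm (Fin n) → List (Itv n) → Equiv.Perm (Fin n)
  | σ, [] => σ
  | σ, T :: t => walkEnd (σ * T.rev) t

/-- The edge path `σ → σ * T_1.rev → σ * T_1.rev * T_2.rev → ...` given by a word
`T_1, T_2, ...`. -/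
noncomputable def walk (n : ℕ) : (σ : Equiv.Perm (Fin (2 ^ (n + 1)))) →
    (t : List (Itv (2 ^ (n + 1)))) →
      (FreeGroupoid.mk (cell n σ) ⟶ FreeGroupoid.mk (cell n (walkEnd σ t)))
  | _, [] => 𝟙 _
  | σ, T :: t => cross n σ T ≫ walk n (σ * T.rev) t

lemma walkEnd_eq {n : ℕ} (σ : Equiv.Perm (Fin n)) (t : List (Itv n)) :
    walkEnd σ t = σ * QBraid.perm n (wordBraid t) := by
  induction t generalizing σ with
  | nil => simp [walkEnd, wordBraid]
  | cons T t ih =>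
    have h : QBraid.perm n (QBraid.gen T) = T.rev := PresentedGroup.toGroup.of _
    rw [walkEnd, ih]
    simp [wordBraid, h, mul_assoc]

/-- The homotopy class of the edge loop given by a word representing a pure quasi-braid on
`2 ^ (n + 1)` strands. -/
noncomputable def loop (n : ℕ) (t : List (Itv (2 ^ (n + 1))))
    (h : wordBraid t ∈ QBraid.pure (2 ^ (n + 1))) : PureQBraid :=
  FreeGroupoid.homMk (homOfLE (base_le n)) ≫ walk n 1 t ≫
    eqToHom (by rw [walkEnd_eq, MonoidHom.mem_ker.1 h, mul_one]) ≫
    Groupoid.inv (FreeGroupoid.homMk (homOfLE (base_le n)))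

/-- `p` comes from a pure quasi-braid of length `a` on `2 ^ (n + 1)` strands, for some `n`. -/
def HasStableLength (p : PureQBraid) (a : Multiplicative (ZMod 2)) : Prop :=
  ∃ (n : ℕ) (t : List (Itv (2 ^ (n + 1)))) (h : wordBraid t ∈ QBraid.pure (2 ^ (n + 1))),
    p = loop n t h ∧ a = QBraid.length _ (wordBraid t)

/-- The cells of the universal cover of the tower: a stratum with a homotopy class of paths
from the base point to it. -/
@[ext] structure Cover where
  pt : Stratum
  path : FreeGroupoid.mk base ⟶ FreeGroupoid.mk pt

/-- Incidence of the cells of the universal cover. -/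
instance : Preorder Cover where
  le x y := ∃ h : x.pt ≤ y.pt, y.path = x.path ≫ FreeGroupoid.homMk (homOfLE h)
  le_refl x := ⟨le_rfl, by
    rw [show homOfLE (le_refl x.pt) = 𝟙 _ from rfl, FreeGroupoid.homMk, CategoryTheory.Functor.map_id,
      Category.comp_id]⟩
  le_trans := by
    rintro x y z ⟨h, e⟩ ⟨h', e'⟩
    refine ⟨h.trans h', ?_⟩
    rw [e', e, Category.assoc, ← Functor.map_comp]
    rfl

/-- The group of the cellular transformations of the universal cover of the tower lifting the
action of Neretin's group on the tower. -/
def liftGroup : Subgroup (neretin × (Cover ≃o Cover)) where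
  carrier := {p | ∀ x : Cover, (p.2 x).pt = act p.1 x.pt}
  one_mem' := fun x => by simp
  mul_mem' := by
    intro p q hp hq x
    change (p.2 (q.2 x)).pt = _
    rw [hp, hq, Prod.fst_mul, map_mul]; rfl
  inv_mem' := by
    intro p hp x
    change ((p.2⁻¹) x).pt = act p.1⁻¹ x.pt
    apply (act p.1).injective
    rw [← hp]
    simp

/-- The projection of the group of lifts to Neretin's group. -/
def proj : liftGroup →* neretin := (MonoidHom.fst _ _).comp liftGroup.subtype

/-- The action of the fundamental group of the tower on its universal cover, by deck
transformations. -/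
noncomputable def deckIso (p : PureQBraid) : Cover ≃o Cover where
  toFun x := ⟨x.pt, p ≫ x.path⟩
  invFun x := ⟨x.pt, Groupoid.inv p ≫ x.path⟩
  left_inv x := by ext <;> simp
  right_inv x := by ext <;> simp
  map_rel_iff' := by
    intro x y
    refine exists_congr fun h => ?_
    simp only [Equiv.coe_fn_mk, Category.assoc]
    exact cancel_epi p

/-- The infinite pure quasi-braid group as the group of lifts of the identity. -/
noncomputable def deck : PureQBraid →* liftGroup where
  toFun p := ⟨(1, deckIso p), fun x => by simp [deckIso]⟩
  map_one' := by
    refine Subtype.ext (Prod.ext rfl (RelIso.ext fun x => ?_))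
    exact Cover.ext rfl (heq_of_eq (Category.id_comp x.path))
  map_mul' p q := by
    refine Subtype.ext (Prod.ext (mul_one _).symm (RelIso.ext fun x => ?_))
    exact Cover.ext rfl (heq_of_eq (Category.assoc p q x.path))

open groupCohomology in
/-- The class `e` is the class of the central extension `E`: for every set-theoretic section `σ`
of `E`, the cochain `σ(g) σ(h) σ(gh)⁻¹` is a cocycle in the class `e`. -/
def IsExtensionClass {A G : Type} [Group A] [Group G]
    (E : GroupExtension (Multiplicative (ZMod 2)) A G)
    (e : H2 (Rep.trivial (ZMod 2) G (ZMod 2))) : Prop :=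
  ∀ σ : E.Section, ∃ c : cocycles₂ (Rep.trivial (ZMod 2) G (ZMod 2)),
    (∀ g h : G, E.inl (Multiplicative.ofAdd (c (g, h) : ZMod 2)) * σ (g * h) = σ g * σ h) ∧
      H2π _ c = e

end DyadicCircle

/-! The stable length is the class of an explicit cocycle on the poset of strata. Two labelled
trees, expanded completely to a common depth, are compared by the parity of the number of descents
of one order of leaves with respect to the other. Reversing a block that is also a block of the
reference order changes this parity by the number of gaps inside the block, whatever the reference
order (`desc_flip`): an outside leaf compares in the same way with all members of the block. The
vertices of a tree and of its expansions form a nested family, and reversing one member keeps the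
others contiguous. Hence the parity is additive along `x ≤ y ≤ z` (`Flips.desc_eq`,
`descParity_add`), and further expansion does not affect it (`desc_deepen`). It therefore extends to
homotopy classes of paths. Crossing the wall of `T` contributes `|T| - 1`, which gives the
prescribed values; uniqueness holds because every loop is homotopic to one given by a word
(`eventually_isWalk`).

Exactness of the quasi-braid extension is covering theory: lifts are determined by one value
(`lift_ext`), and they exist because the tower is connected (`exists_cover_pt_eq`). The parity of
paths is equivariant up to a coboundary: relabelling preserves relative orders, so only the
arbitrary choice of a tree in each stratum intervenes (`coverParity_liftAct`). Conjugation by lifts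
thus preserves the stable length, which makes the kernel normal and the quotient extension central.

For non-triviality, let `t` be the lift of `swap` (exchange of 000 and 001) that fixes the base
point of the cover. A swindle shows that `t` is a commutator: the self-similar automorphism
`flipAfter` below 0 is `swap` times its copy below 01, and `shift` conjugates the copy to the
original (`exists_commutator_lift_swap`). On the other hand `swap` is conjugate, by `swapMiddle`, to
the commutator of `swapFirst` and `swap`; this gives a second lift of `swap` inside the commutator
subgroup, fixing a translate of the base point. The two lifts differ by a deck transformation, whose
parity is the difference between the twists of `swap` at two explicit trees, namely 1
(`exists_odd_mem_commutator`).

A splitting of a central extension would give a retraction onto its abelian kernel, which kills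
commutators; so the extension does not split (`isEmpty_splitting`), and its class is non-zero since
a trivial cocycle would correct a section into a splitting. -/

namespace DyadicCircle

/-! ### Parity of descents and reversal of blocks -/

section Descents

variable {α β : Type*} [DecidableEq α] [DecidableEq β]

/-- `inv M a b` is `1` if `b` occurs before `a` in `M`. -/
def inv (M : List α) (a b : α) : ZMod 2 := if [b, a].Sublist M then 1 else 0

/-- The parity of the number of descents of the list `L` with respect to the order of `M`. -/
def desc (M : List α) : List α → ZMod 2
  | [] => 0
  | [_] => 0
  | a :: b :: t => inv M a b + desc M (b :: t)

lemma desc_append_cons (M l r : List α) (a : α) :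
    desc M (l ++ a :: r) = desc M (l ++ [a]) + desc M (a :: r) := by
  induction l with
  | nil => simp [desc]
  | cons x l ih =>
    cases l with
    | nil => simp [desc]
    | cons y l =>
      simp only [List.cons_append, desc] at ih ⊢
      rw [ih, add_assoc]

omit [DecidableEq α] in
lemma before_total {M : List α} {a b : α} (ha : a ∈ M) (hb : b ∈ M) (hab : a ≠ b) :
    [a, b].Sublist M ∨ [b, a].Sublist M := by
  induction M with
  | nil => simp at ha
  | cons x M ih =>
    rcases List.mem_cons.1 ha with rfl | ha'
    · rcases List.mem_cons.1 hb with rfl | hb'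
      · exact (hab rfl).elim
      · exact .inl (List.Sublist.cons_cons _ (List.singleton_sublist.2 hb'))
    · rcases List.mem_cons.1 hb with rfl | hb'
      · exact .inr (List.Sublist.cons_cons _ (List.singleton_sublist.2 ha'))
      · exact (ih ha' hb').imp (fun h => h.cons _) (fun h => h.cons _)

omit [DecidableEq α] in
lemma before_asymm {M : List α} (hM : M.Nodup) {a b : α} (h : [a, b].Sublist M) :
    ¬ [b, a].Sublist M := by
  induction M with
  | nil => simp at h
  | cons x M ih =>
    obtain ⟨hx, hM⟩ := List.nodup_cons.1 hM
    intro h'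
    cases h with
    | cons _ h =>
      cases h' with
      | cons _ h' => exact ih hM h h'
      | cons_cons _ h' => exact hx (h.subset (by simp))
    | cons_cons _ h =>
      cases h' with
      | cons _ h' => exact hx (h'.subset (by simp))
      | cons_cons _ h' => exact hx (h.subset (by simp))

lemma inv_add_inv {M : List α} (hM : M.Nodup) {a b : α} (ha : a ∈ M) (hb : b ∈ M) (hab : a ≠ b) :
    inv M a b = inv M b a + 1 := by
  rcases before_total ha hb hab with h | h
  · simp only [inv, if_pos h, if_neg (before_asymm hM h)]; decide
  · simp only [inv, if_pos h, if_neg (before_asymm hM h)]; decide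

lemma desc_of_sublist {M L : List α} (hM : M.Nodup) (h : L.Sublist M) : desc M L = 0 := by
  induction L with
  | nil => rfl
  | cons a L ih =>
    cases L with
    | nil => rfl
    | cons b L =>
      rw [desc, ih ((List.sublist_cons_self _ _).trans h), add_zero, inv, if_neg]
      refine before_asymm hM (List.Sublist.trans ?_ h)
      simp

/-- Each of the `b.length` adjacent pairs is a descent in exactly one of the two reading directions.
-/
lemma desc_reverse {M : List α} (hM : M.Nodup) (a : α) (b : List α) (hb : (a :: b).Nodup)
    (h : ∀ x ∈ a :: b, x ∈ M) :
    desc M (a :: b) = desc M (a :: b).reverse + b.length := by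
  induction b generalizing a with
  | nil => simp [desc]
  | cons c t ih =>
    have h1 := ih c hb.of_cons fun x hx => h x (List.mem_cons_of_mem _ hx)
    have h2 : (a :: c :: t).reverse = t.reverse ++ c :: [a] := by simp
    have h3 : (c :: t).reverse = t.reverse ++ [c] := by simp
    rw [h2, desc_append_cons, ← h3, desc, h1, desc, desc,
      inv_add_inv hM (h a (by simp)) (h c (by simp)) (by rintro rfl; simp at hb)]
    push_cast [List.length_cons]
    ring

/-- An element outside a block lies on one side of the whole block, so its comparison with a member
does not depend on the member. -/
lemma inv_block {l b r : List α} (hM : (l ++ b ++ r).Nodup) {x c d : α}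
    (hx : x ∈ l ++ b ++ r) (hxb : x ∉ b) (hc : c ∈ b) (hd : d ∈ b) :
    inv (l ++ b ++ r) x c = inv (l ++ b ++ r) x d ∧
      inv (l ++ b ++ r) c x = inv (l ++ b ++ r) d x := by
  have key : (∀ c ∈ b, [x, c].Sublist (l ++ b ++ r)) ∨ (∀ c ∈ b, [c, x].Sublist (l ++ b ++ r)) := by
    rcases List.mem_append.1 hx with hx | hx
    · rcases List.mem_append.1 hx with hx | hx
      · left
        intro c hc
        exact ((List.singleton_sublist.2 hx).append (List.singleton_sublist.2 hc)).trans
          (List.sublist_append_left _ _)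
      · exact (hxb hx).elim
    · right
      intro c hc
      rw [List.append_assoc]
      exact ((List.singleton_sublist.2 hc).append (List.singleton_sublist.2 hx)).trans
          (List.sublist_append_right _ _)
  rcases key with key | key
  · simp only [inv, if_pos (key c hc), if_pos (key d hd), if_neg (before_asymm hM (key c hc)),
      if_neg (before_asymm hM (key d hd)), and_self]
  · simp only [inv, if_pos (key c hc), if_pos (key d hd), if_neg (before_asymm hM (key c hc)),
      if_neg (before_asymm hM (key d hd)), and_self]

/-- Reversing a block of `L` which is also a block of `M` changes the parity of the number of
descents by the number of gaps inside the block. -/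
lemma desc_flip {l r l' b b' r' : List α} {c : α} (hL : (l ++ (c :: b) ++ r).Nodup)
    (hM : (l' ++ b' ++ r').Nodup) (hb : b'.Perm (c :: b))
    (hLM : (l ++ (c :: b) ++ r).Perm (l' ++ b' ++ r')) :
    desc (l' ++ b' ++ r') (l ++ (c :: b) ++ r) =
      b.length + desc (l' ++ b' ++ r') (l ++ (c :: b).reverse ++ r) := by
  set M := l' ++ b' ++ r' with hMd
  obtain ⟨e, d, he⟩ : ∃ e d, c :: b = e ++ [d] :=
    ⟨_, _, (List.dropLast_append_getLast (List.cons_ne_nil c b)).symm⟩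
  have hd : d ∈ c :: b := by rw [he]; simp
  have hnd := List.nodup_append.1 hL
  have hnd' := List.nodup_append.1 hnd.1
  have hcM : ∀ x ∈ c :: b, x ∈ M := fun x hx => hLM.subset (by simp only [List.mem_append]; tauto)
  -- The descents are cut at the two ends `c` and `d` of the block. Reversal exchanges these ends,
  -- and `inv_block` shows that the outer contributions do not notice it; only the middle one
  -- changes.
  have e1 : desc M (l ++ (c :: b) ++ r) =
      desc M (l ++ [c]) + desc M (c :: b) + desc M (d :: r) := by
    rw [List.append_assoc, List.cons_append, desc_append_cons, ← List.cons_append, he,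
      List.append_assoc, List.singleton_append, desc_append_cons M e, add_assoc]
  have e2 : desc M (l ++ (c :: b).reverse ++ r) =
      desc M (l ++ [d]) + desc M (c :: b).reverse + desc M (c :: r) := by
    have h1 : (c :: b).reverse = d :: e.reverse := by rw [he]; simp
    rw [h1, List.append_assoc, List.cons_append, desc_append_cons, ← List.cons_append, ← h1,
      List.reverse_cons, List.append_assoc, List.singleton_append, desc_append_cons M b.reverse,
      add_assoc]
  have e3 : desc M (l ++ [c]) = desc M (l ++ [d]) := by
    rcases l.eq_nil_or_concat with rfl | ⟨l0, x, rfl⟩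
    · rfl
    · have hx : x ∉ b' := fun hx => hnd'.2.2 x (by simp) x (hb.subset hx) rfl
      have := (inv_block hM (hLM.subset (by simp) : x ∈ M) hx (hb.symm.subset (by simp : c ∈ c :: b))
        (hb.symm.subset hd)).1
      rw [← hMd] at this
      rw [List.concat_eq_append, List.append_assoc, List.append_assoc, List.singleton_append,
        List.singleton_append,
        desc_append_cons, desc_append_cons M l0 [d]]
      simp only [desc, this]
  have e4 : desc M (d :: r) = desc M (c :: r) := by
    cases r with
    | nil => rfl
    | cons x r =>
      have hx : x ∉ b' := fun hx =>
        hnd.2.2 x (by simp only [List.mem_append]; exact .inr (hb.subset hx)) x (by simp) rfl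
      have := (inv_block hM (hLM.subset (by simp) : x ∈ M) hx (hb.symm.subset (by simp : c ∈ c :: b))
        (hb.symm.subset hd)).2
      rw [← hMd] at this
      simp only [desc, this]
  rw [e1, e2, e3, e4, desc_reverse hM c b hnd'.2.1 hcM]
  ring

/-- Substituting lists for letters creates no descent inside a substituted list, since the same list
occurs in the reference order; at a junction the last letter of `φ u` compares with the first letter
of `φ v` as `u` does with `v`. -/
lemma desc_flatMap {φ : α → List β} {L M : List α} (hLM : ∀ u ∈ L, u ∈ M) (hL : L.Nodup)
    (hM : (M.flatMap φ).Nodup) (hφ : ∀ u ∈ M, φ u ≠ []) :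
    desc (M.flatMap φ) (L.flatMap φ) = desc M L := by
  have hsub : ∀ u ∈ M, (φ u).Sublist (M.flatMap φ) := fun u hu => by
    have := (List.singleton_sublist.2 hu).flatMap (f := φ)
    simpa using this
  induction L with
  | nil => rfl
  | cons u L ih =>
    have hu := hLM u (by simp)
    cases L with
    | nil =>
      simpa using! desc_of_sublist hM (hsub u hu)
    | cons v L =>
      have hv := hLM v (by simp)
      have huv : u ≠ v := by rintro rfl; simp at hL
      obtain ⟨p, x, hp⟩ : ∃ p x, φ u = p ++ [x] :=
        ⟨_, _, (List.dropLast_append_getLast (hφ u hu)).symm⟩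
      obtain ⟨y, q, hq⟩ := List.exists_cons_of_ne_nil (hφ v hv)
      have ih := ih (fun w hw => hLM w (List.mem_cons_of_mem _ hw)) hL.of_cons
      have h1 : inv (M.flatMap φ) x y = inv M u v := by
        have hx : [x].Sublist (φ u) := List.singleton_sublist.2 (by simp [hp])
        have hy : [y].Sublist (φ v) := List.singleton_sublist.2 (by simp [hq])
        rcases before_total hu hv huv with h | h
        · have hMn : ¬ [v, u].Sublist M := fun h' => by
            have h1 := (hx.append hy).trans (by simpa using! h.flatMap (f := φ))
            have h2 := (hy.append hx).trans (by simpa using! h'.flatMap (f := φ))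
            exact before_asymm hM h1 h2
          have h1 := (hx.append hy).trans (by simpa using! h.flatMap (f := φ))
          simp only [inv, if_neg hMn]
          rw [if_neg (before_asymm hM h1)]
        · have h1 := (hy.append hx).trans (by simpa using! h.flatMap (f := φ))
          simp only [inv, if_pos h]
          exact if_pos h1
      rw [List.flatMap_cons, hp, desc, ← ih, List.flatMap_cons, hq, List.append_assoc,
        List.singleton_append, desc_append_cons, ← hp, desc_of_sublist hM (hsub u hu), zero_add,
        List.cons_append, desc, h1]

omit [DecidableEq α] in
-- Reversing `b` breaks the contiguity of `b'` only when the two blocks overlap properly. If they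
-- are disjoint or nested, `b'` stays in place, moves along inside `b`, or has its own part `b`
-- reversed.
lemma block_reverse {L l b r l' b' r' : List α} (hL : L.Nodup) (h : L = l ++ b ++ r)
    (h' : L = l' ++ b' ++ r')
    (hn : (∀ x ∈ b, x ∈ b') ∨ (∀ x ∈ b', x ∈ b) ∨ (∀ x ∈ b, x ∉ b')) :
    ∃ l₂ b₂ r₂, l ++ b.reverse ++ r = l₂ ++ b₂ ++ r₂ ∧ b₂.Perm b' := by
  have key := h.symm.trans h'
  rw [List.append_assoc, List.append_assoc] at key
  rcases List.append_eq_append_iff.1 key with ⟨a, rfl, h2⟩ | ⟨a, rfl, h2⟩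
  · rcases List.append_eq_append_iff.1 h2 with ⟨e, rfl, rfl⟩ | ⟨e, rfl, h3⟩
    · exact ⟨l ++ b.reverse ++ e, b', r', by simp, .refl _⟩
    · rcases List.append_eq_append_iff.1 h3 with ⟨f, rfl, rfl⟩ | ⟨f, rfl, rfl⟩
      · exact ⟨l ++ f.reverse, b'.reverse, a.reverse ++ r, by simp, List.reverse_perm b'⟩
      · rcases a with _ | ⟨x, a⟩
        · exact ⟨l, e.reverse ++ f, r', by simp, (List.reverse_perm e).append_right f⟩
        rcases e with _ | ⟨y, e⟩
        · exact ⟨l ++ (x :: a).reverse, f, r', by simp, .refl _⟩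
        rcases f with _ | ⟨z, f⟩
        · exact ⟨l, (y :: e).reverse, (x :: a).reverse ++ r', by simp, by simpa using List.reverse_perm (y :: e)⟩
        -- The proper overlap: `x` lies only in `b`, `y` in both blocks and `z` only in `b'`, which
        -- contradicts each of the three alternatives.
        exfalso
        rw [h] at hL
        rcases hn with hn | hn | hn
        · have := hn x (by simp)
          simp [List.nodup_append] at hL this
          grind
        · have := hn z (by simp)
          simp [List.nodup_append] at hL this
          grind
        · exact hn y (by simp) (by simp)
  · rcases List.append_eq_append_iff.1 h2 with ⟨e, rfl, rfl⟩ | ⟨e, rfl, h3⟩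
    · exact ⟨l', b', e ++ b.reverse ++ r, by simp, .refl _⟩
    · rcases List.append_eq_append_iff.1 h3 with ⟨f, rfl, rfl⟩ | ⟨f, rfl, rfl⟩
      · exact ⟨l', a ++ b.reverse ++ f, r', by simp, by
          simpa using ((List.reverse_perm b).append_right f).append_left a⟩
      · rcases a with _ | ⟨x, a⟩
        · exact ⟨l' ++ f.reverse, e.reverse, r, by simp, by simp⟩
        rcases e with _ | ⟨y, e⟩
        · exact ⟨l', x :: a, f.reverse ++ r, by simp, by simp⟩
        rcases f with _ | ⟨z, f⟩
        · exact ⟨l', x :: a ++ (y :: e).reverse, r, by simp, by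
            simpa using (List.reverse_perm (y :: e)).append_left (x :: a)⟩
        exfalso
        rw [h] at hL
        rcases hn with hn | hn | hn
        · have := hn z (by simp)
          simp [List.nodup_append] at hL this
          grind
        · have := hn x (by simp)
          simp [List.nodup_append] at hL this
          grind
        · exact hn y (by simp) (by simp)

end Descents

/-! ### Reversals of blocks from a nested family -/

/-- The cones of the members of the list are pairwise disjoint. -/
abbrev DisjCones (L : List (List Bool)) : Prop :=
  L.Pairwise fun u v => Disjoint (cone u) (cone v)

lemma DisjCones.nodup {L : List (List Bool)} (h : DisjCones L) : L.Nodup :=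
  h.imp fun {u v} huv e => by
    subst e
    obtain ⟨x, hx⟩ := cone_nonempty u
    exact Set.disjoint_left.1 huv hx hx

lemma DisjCones.perm {L L' : List (List Bool)} (h : DisjCones L) (p : L.Perm L') : DisjCones L' :=
  p.pairwise h fun hxy => hxy.symm

lemma DisjCones.eq_of_mem {L : List (List Bool)} (h : DisjCones L) {u v : List Bool} (hu : u ∈ L)
    (hv : v ∈ L) {x : Bdry} (hx : x ∈ cone u) (hx' : x ∈ cone v) : u = v := by
  by_contra hne
  have hsym : Std.Symm fun u v : List Bool => Disjoint (cone u) (cone v) := ⟨fun _ _ h => h.symm⟩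
  exact Set.disjoint_left.1 (List.Pairwise.forall h hu hv hne) hx hx'

lemma DisjCones.mem_of_mem_region {L b : List (List Bool)} (h : DisjCones L) {u : List Bool}
    (hu : u ∈ L) (hb : ∀ v ∈ b, v ∈ L) {x : Bdry} (hx : x ∈ cone u) (hx' : x ∈ region b) :
    u ∈ b := by
  obtain ⟨v, hv, hxv⟩ := hx'
  rwa [h.eq_of_mem hu (hb v hv) hx hxv]

lemma region_perm {b b' : List (List Bool)} (h : b.Perm b') : region b = region b' := by
  ext x; simp [region, h.mem_iff]

/-- Any two members of the family are nested or disjoint. -/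
def Nested (V : Set (Set Bdry)) : Prop := ∀ A ∈ V, ∀ B ∈ V, A ⊆ B ∨ B ⊆ A ∨ Disjoint A B

/-- Cones are non-empty and those of `L` are disjoint, so nesting and disjointness of regions amount
to nesting and disjointness of the blocks, and `block_reverse` applies. -/
lemma block_flip {L l b r l' b' r' : List (List Bool)} (hL : DisjCones L) (h : L = l ++ b ++ r)
    (h' : L = l' ++ b' ++ r')
    (hn : region b ⊆ region b' ∨ region b' ⊆ region b ∨ Disjoint (region b) (region b')) :
    ∃ l₂ b₂ r₂, l ++ b.reverse ++ r = l₂ ++ b₂ ++ r₂ ∧ b₂.Perm b' := by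
  have hb : ∀ v ∈ b, v ∈ L := fun v hv => by rw [h]; simp [hv]
  have hb' : ∀ v ∈ b', v ∈ L := fun v hv => by rw [h']; simp [hv]
  refine block_reverse hL.nodup h h' ?_
  rcases hn with hn | hn | hn
  · refine .inl fun u hu => ?_
    obtain ⟨x, hx⟩ := cone_nonempty u
    exact hL.mem_of_mem_region (hb u hu) hb' hx (hn ⟨u, hu, hx⟩)
  · refine .inr (.inl fun u hu => ?_)
    obtain ⟨x, hx⟩ := cone_nonempty u
    exact hL.mem_of_mem_region (hb' u hu) hb hx (hn ⟨u, hu, hx⟩)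
  · refine .inr (.inr fun u hu hu' => ?_)
    obtain ⟨x, hx⟩ := cone_nonempty u
    exact Set.disjoint_left.1 hn ⟨u, hu, hx⟩ ⟨u, hu', hx⟩

/-- The reversal of a block whose region belongs to `V`. -/
def FlipStep (V : Set (Set Bdry)) (L L' : List (List Bool)) : Prop :=
  ∃ l b r, L = l ++ b ++ r ∧ L' = l ++ b.reverse ++ r ∧ region b ∈ V

/-- The relation generated by the reversals of blocks whose regions belong to `V`. -/
abbrev Flips (V : Set (Set Bdry)) : List (List Bool) → List (List Bool) → Prop :=
  Relation.ReflTransGen (FlipStep V)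

lemma FlipStep.symm {V : Set (Set Bdry)} {L L' : List (List Bool)} (h : FlipStep V L L') :
    FlipStep V L' L := by
  obtain ⟨l, b, r, rfl, rfl, hb⟩ := h
  exact ⟨l, b.reverse, r, rfl, by simp, by rwa [region_reverse]⟩

lemma FlipStep.perm {V : Set (Set Bdry)} {L L' : List (List Bool)} (h : FlipStep V L L') :
    L.Perm L' := by
  obtain ⟨l, b, r, rfl, rfl, hb⟩ := h
  exact ((List.reverse_perm b).symm.append_left l).append_right r

lemma Flips.symm {V : Set (Set Bdry)} {L L' : List (List Bool)} (h : Flips V L L') :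
    Flips V L' L := by
  induction h with
  | refl => exact .refl
  | tail _ h ih => exact .head h.symm ih

lemma Flips.perm {V : Set (Set Bdry)} {L L' : List (List Bool)} (h : Flips V L L') :
    L.Perm L' := by
  induction h with
  | refl => exact .refl _
  | tail _ h ih => exact ih.trans h.perm

lemma Flips.mono {V W : Set (Set Bdry)} (hVW : V ⊆ W) {L L' : List (List Bool)}
    (h : Flips V L L') : Flips W L L' := by
  induction h with
  | refl => exact .refl
  | tail _ h ih =>
    obtain ⟨l, b, r, h1, h2, h3⟩ := h
    exact ih.tail ⟨l, b, r, h1, h2, hVW h3⟩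

lemma Flips.append {V : Set (Set Bdry)} {L L' : List (List Bool)} (h : Flips V L L')
    (p q : List (List Bool)) : Flips V (p ++ L ++ q) (p ++ L' ++ q) := by
  induction h with
  | refl => exact .refl
  | tail _ h ih =>
    obtain ⟨l, b, r, rfl, rfl, hb⟩ := h
    exact ih.tail ⟨p ++ l, b, r ++ q, by simp, by simp, hb⟩

lemma Flips.block {V : Set (Set Bdry)} (hV : Nested V) {L M : List (List Bool)}
    (h : Flips V L M) (hL : DisjCones L) {l b r : List (List Bool)} (hb : L = l ++ b ++ r)
    (hbV : region b ∈ V) : ∃ l' b' r', M = l' ++ b' ++ r' ∧ b'.Perm b := by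
  induction h with
  | refl => exact ⟨l, b, r, hb, .refl _⟩
  | tail h hs ih =>
    obtain ⟨l', b', r', h1, hp⟩ := ih
    obtain ⟨l₁, b₁, r₁, h2, rfl, h3⟩ := hs
    obtain ⟨l₂, b₂, r₂, h4, h5⟩ := block_flip (hL.perm (Flips.perm h)) h2 h1
      (hV _ h3 _ (by rwa [region_perm hp]))
    exact ⟨l₂, b₂, r₂, h4, h5.trans hp⟩

/-- The reversed blocks are still blocks, up to order, of every `M` reachable by flips. By
`desc_flip` each reversal then contributes its number of gaps, and the sum `w` does not depend on
`M`. -/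
lemma Flips.exists_weight {V : Set (Set Bdry)} (hV : Nested V) {L L' : List (List Bool)}
    (h : Flips V L L') (hL : DisjCones L) :
    ∃ w, ∀ M, Flips V L M → desc M L = w + desc M L' := by
  induction h with
  | refl => exact ⟨0, fun M _ => (zero_add _).symm⟩
  | @tail L₁ L₂ h hs ih =>
    obtain ⟨w, hw⟩ := ih
    have hL₁ := hL.perm (Flips.perm h)
    obtain ⟨l, b, r, rfl, rfl, hb⟩ := hs
    rcases b with _ | ⟨c, b⟩
    · exact ⟨w, by simpa using hw⟩
    refine ⟨w + b.length, fun M hM => ?_⟩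
    have hM₁ : Flips V _ M := (Flips.symm h).trans hM
    obtain ⟨l', b', r', rfl, hp⟩ := hM₁.block hV hL₁ rfl hb
    rw [hw _ hM, desc_flip hL₁.nodup (hL₁.perm hM₁.perm).nodup hp hM₁.perm, add_assoc]

/-- Descents are additive along reversals of nested blocks. -/
lemma Flips.desc_eq {V : Set (Set Bdry)} (hV : Nested V) {L L' M : List (List Bool)}
    (h : Flips V L L') (hM : Flips V L M) (hL : DisjCones L) :
    desc M L = desc L' L + desc M L' := by
  obtain ⟨w, hw⟩ := h.exists_weight hV hL
  -- Taking `L'` itself as the reference order identifies the universal weight `w`, since `L'` has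
  -- no descents with respect to itself.
  rw [hw M hM, hw L' h, desc_of_sublist (hL.perm h.perm).nodup (List.Sublist.refl _), add_zero]

/-! ### Cones and complete expansion to a given depth -/

lemma cone_append_subset (u w : List Bool) : cone (u ++ w) ⊆ cone u := by
  rintro _ ⟨x, rfl⟩
  exact ⟨w ++ₛ x, (Stream'.append_append_stream _ _ _).symm⟩

lemma cone_subset_of_prefix {u v : List Bool} (h : u <+: v) : cone v ⊆ cone u := by
  obtain ⟨w, rfl⟩ := h
  exact cone_append_subset u w

lemma take_of_mem_cone {u : List Bool} {x : Bdry} (h : x ∈ cone u) : x.take u.length = u := by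
  obtain ⟨y, rfl⟩ := h
  exact take_append u y

lemma mem_cone_iff {u : List Bool} {x : Bdry} : x ∈ cone u ↔ x.take u.length = u :=
  ⟨take_of_mem_cone, fun h => ⟨x.drop u.length, by
    have := append_take_drop x u.length
    rwa [h] at this⟩⟩

lemma prefix_of_mem_cone {u v : List Bool} {x : Bdry} (hu : x ∈ cone u) (hv : x ∈ cone v)
    (h : u.length ≤ v.length) : u <+: v := by
  have h1 := take_of_mem_cone hu
  have h2 := take_of_mem_cone hv
  rw [List.prefix_iff_eq_take, ← h2, Stream'.take_take, min_eq_right h, h1]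

lemma cone_nested (u v : List Bool) :
    cone u ⊆ cone v ∨ cone v ⊆ cone u ∨ Disjoint (cone u) (cone v) := by
  by_cases h : Disjoint (cone u) (cone v)
  · exact .inr (.inr h)
  · obtain ⟨x, hu, hv⟩ := Set.not_disjoint_iff.1 h
    rcases le_total u.length v.length with hl | hl
    · exact .inr (.inl (cone_subset_of_prefix (prefix_of_mem_cone hu hv hl)))
    · exact .inl (cone_subset_of_prefix (prefix_of_mem_cone hv hu hl))

lemma disjoint_cone {u v : List Bool} (h : ¬ u <+: v) (h' : ¬ v <+: u) :
    Disjoint (cone u) (cone v) := by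
  rw [Set.disjoint_left]
  intro x hu hv
  rcases le_total u.length v.length with hl | hl
  · exact h (prefix_of_mem_cone hu hv hl)
  · exact h' (prefix_of_mem_cone hv hu hl)

lemma dyadicWords_add (a b : ℕ) :
    dyadicWords (a + b) = (dyadicWords a).flatMap fun u => (dyadicWords b).map (u ++ ·) := by
  induction b with
  | zero => simp [dyadicWords]
  | succ b ih =>
    rw [← add_assoc, dyadicWords, ih, List.flatMap_assoc]
    refine List.flatMap_congr fun u _ => ?_
    rw [dyadicWords, List.flatMap_map, List.map_flatMap]
    simp

lemma length_of_mem_dyadicWords {n : ℕ} {u : List Bool} (h : u ∈ dyadicWords n) :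
    u.length = n := by
  induction n generalizing u with
  | zero => simp [dyadicWords] at h; simp [h]
  | succ n ih =>
    obtain ⟨v, hv, hu⟩ := List.mem_flatMap.1 h
    simp only [List.mem_cons, List.not_mem_nil, or_false] at hu
    rcases hu with rfl | rfl <;> simp [ih hv]

/-- The vertices of depth `n` below the vertex `u`, from left to right. -/
def descendants (n : ℕ) (u : List Bool) : List (List Bool) :=
  (dyadicWords (n - u.length)).map (u ++ ·)

lemma descendants_self {n : ℕ} {u : List Bool} (h : u.length = n) : descendants n u = [u] := by
  simp [descendants, h, dyadicWords]

lemma length_of_mem_descendants {n : ℕ} {u v : List Bool} (hu : u.length ≤ n)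
    (h : v ∈ descendants n u) : v.length = n := by
  obtain ⟨w, hw, rfl⟩ := List.mem_map.1 h
  have := length_of_mem_dyadicWords hw
  simp; omega

lemma descendants_descendants {m n : ℕ} {u : List Bool} (hu : u.length ≤ n) (hnm : n ≤ m) :
    (descendants n u).flatMap (descendants m) = descendants m u := by
  have h1 : ∀ v ∈ descendants n u, descendants m v = (dyadicWords (m - n)).map (v ++ ·) :=
    fun v hv => by rw [descendants, length_of_mem_descendants hu hv]
  rw [List.flatMap_congr h1, descendants, descendants,
    show m - u.length = (n - u.length) + (m - n) by omega, dyadicWords_add,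
    List.flatMap_map, List.map_flatMap]
  refine List.flatMap_congr fun w _ => ?_
  simp

lemma descendants_children {n : ℕ} {u : List Bool} (hu : u.length < n) :
    descendants n u = descendants n (u ++ [false]) ++ descendants n (u ++ [true]) := by
  have h : descendants (u.length + 1) u = [u ++ [false], u ++ [true]] := by
    simp [descendants, dyadicWords]
  rw [← descendants_descendants (n := u.length + 1) (by omega) hu, h]
  simp

lemma region_descendants (n : ℕ) (u : List Bool) : region (descendants n u) = cone u := by
  ext x
  constructor
  · rintro ⟨v, hv, hx⟩
    obtain ⟨w, -, rfl⟩ := List.mem_map.1 hv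
    exact cone_append_subset _ _ hx
  · rintro ⟨y, rfl⟩
    obtain ⟨w, hw, z, rfl⟩ := (dyadicWords_spec (n - u.length)).2 y
    exact ⟨_, List.mem_map_of_mem hw, z, Stream'.append_append_stream _ _ _⟩

lemma descendants_ne_nil (n : ℕ) (u : List Bool) : descendants n u ≠ [] := by
  rw [← List.length_pos_iff]
  simp [descendants, length_dyadicWords]

lemma disjCones_descendants (n : ℕ) (u : List Bool) : DisjCones (descendants n u) := by
  rw [DisjCones, descendants, List.pairwise_map]
  refine (dyadicWords_spec (n - u.length)).1.imp fun {v w} h => ?_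
  rw [Set.disjoint_left] at h ⊢
  rintro _ ⟨x, rfl⟩ ⟨y, hy⟩
  simp only [Stream'.append_append_stream] at hy
  exact h ⟨x, rfl⟩ ⟨y, append_right_inj u hy⟩

/-- The vertices of depth `n` below the members of a list. -/
def deepen (n : ℕ) (L : List (List Bool)) : List (List Bool) := L.flatMap (descendants n)

lemma deepen_append (n : ℕ) (L L' : List (List Bool)) :
    deepen n (L ++ L') = deepen n L ++ deepen n L' := List.flatMap_append

lemma deepen_cons (n : ℕ) (u : List Bool) (L : List (List Bool)) :
    deepen n (u :: L) = descendants n u ++ deepen n L := List.flatMap_cons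

lemma deepen_nil (n : ℕ) : deepen n [] = [] := rfl

lemma deepen_self {n : ℕ} {L : List (List Bool)} (h : ∀ u ∈ L, u.length = n) :
    deepen n L = L := by
  induction L with
  | nil => rfl
  | cons u L ih =>
    rw [deepen_cons, descendants_self (h u (by simp)), ih fun v hv => h v (by simp [hv])]
    rfl

lemma deepen_deepen {m n : ℕ} {L : List (List Bool)} (h : ∀ u ∈ L, u.length ≤ n) (hnm : n ≤ m) :
    deepen m (deepen n L) = deepen m L := by
  rw [deepen, deepen, List.flatMap_assoc]
  exact List.flatMap_congr fun u hu => descendants_descendants (h u hu) hnm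

lemma region_deepen (n : ℕ) (L : List (List Bool)) : region (deepen n L) = region L := by
  induction L with
  | nil => rfl
  | cons u L ih => rw [deepen_cons, region_append, region_cons, ih, region_descendants]

lemma disjCones_deepen (n : ℕ) {L : List (List Bool)} (h : DisjCones L) :
    DisjCones (deepen n L) := by
  rw [DisjCones, deepen, List.pairwise_flatMap]
  refine ⟨fun u _ => disjCones_descendants n u, h.imp ?_⟩
  intro u v huv a ha b hb
  refine huv.mono ?_ ?_
  · rw [← region_descendants n u]; exact fun x hx => ⟨a, ha, hx⟩
  · rw [← region_descendants n v]; exact fun x hx => ⟨b, hb, hx⟩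

lemma desc_deepen (n : ℕ) {L M : List (List Bool)} (hLM : ∀ u ∈ L, u ∈ M) (hL : DisjCones L)
    (hM : DisjCones M) : desc (deepen n M) (deepen n L) = desc M L :=
  desc_flatMap hLM hL.nodup (disjCones_deepen n hM).nodup fun u _ => descendants_ne_nil n u

/-- Reversing an expanded block also reverses the descendants of each leaf, whereas a reflection of
the unexpanded tree leaves these in order. Reversing each cone separately repairs the difference. -/
lemma flips_deepen_reverse {V : Set (Set Bdry)} (n : ℕ) {b : List (List Bool)}
    (h : ∀ u ∈ b, cone u ∈ V) : Flips V (deepen n b).reverse (deepen n b.reverse) := by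
  induction b with
  | nil => exact .refl
  | cons u b ih =>
    have h1 : Flips V (descendants n u).reverse (descendants n u) :=
      .single ⟨[], (descendants n u).reverse, [], by simp, by simp, by
        rw [region_reverse, region_descendants]; exact h u (by simp)⟩
    have h2 := (ih fun v hv => h v (by simp [hv])).append [] (descendants n u).reverse
    have h3 := h1.append (deepen n b.reverse) []
    rw [deepen_cons, List.reverse_append, List.reverse_cons, deepen_append, deepen_cons, deepen_nil]
    simpa using! h2.trans (by simpa using h3)

lemma flips_deepen {V : Set (Set Bdry)} (n : ℕ) {l b r : List (List Bool)}
    (h : ∀ u ∈ b, cone u ∈ V) (hb : region b ∈ V) :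
    Flips V (deepen n (l ++ b ++ r)) (deepen n (l ++ b.reverse ++ r)) := by
  rw [deepen_append, deepen_append, deepen_append, deepen_append]
  exact .head ⟨_, _, _, rfl, rfl, by rwa [region_deepen]⟩ ((flips_deepen_reverse n h).append _ _)

/-! ### Words and blocks of a labelled tree along the elementary moves -/

namespace LTree

/-- The largest length of a label. -/
def depth (x : LTree) : ℕ := (x.labels.map List.length).foldr max 0

lemma length_le_depth (x : LTree) {u : List Bool} (hu : u ∈ x.labels) : u.length ≤ x.depth := by
  rw [depth]
  generalize x.labels = L at hu
  induction L with
  | nil => simp at hu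
  | cons v L ih =>
    rcases List.mem_cons.1 hu with rfl | h
    · simp
    · simpa using .inr (ih h)

/-- The labels of the tree after complete expansion to depth `n`. -/
def words (x : LTree) (n : ℕ) : List (List Bool) := deepen n x.labels

lemma disjCones_words (x : LTree) (n : ℕ) : DisjCones (x.words n) := disjCones_deepen n x.disj

lemma region_labels (x : LTree) : region x.labels = Set.univ :=
  Set.eq_univ_of_forall x.cover

lemma length_of_mem_words (x : LTree) {n : ℕ} (h : x.depth ≤ n) {v : List Bool}
    (hv : v ∈ x.words n) : v.length = n := by
  obtain ⟨u, hu, hv⟩ := List.mem_flatMap.1 hv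
  exact length_of_mem_descendants ((x.length_le_depth hu).trans h) hv

lemma mem_words (x : LTree) {n : ℕ} (h : x.depth ≤ n) {v : List Bool} :
    v ∈ x.words n ↔ v.length = n := by
  refine ⟨x.length_of_mem_words h, fun hv => ?_⟩
  obtain ⟨z, hz⟩ := cone_nonempty v
  obtain ⟨u, hu, hzu⟩ : z ∈ region (x.words n) := by
    rw [words, region_deepen, region_labels]; trivial
  have hl := x.length_of_mem_words h hu
  have := take_of_mem_cone hzu
  rw [hl, ← hv, take_of_mem_cone hz] at this
  rwa [this]

lemma deepen_words (x : LTree) {m n : ℕ} (h : x.depth ≤ n) (hnm : n ≤ m) :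
    deepen m (x.words n) = x.words m :=
  deepen_deepen (fun _ hu => (x.length_le_depth hu).trans h) hnm

/-- The vertices of the tree other than the root, together with the vertices obtained by
all dyadic expansions. -/
def blocks (x : LTree) : Set (Set Bdry) :=
  x.verts ∪ {A | ∃ u ∈ x.labels, ∃ w, A = cone (u ++ w)}

lemma cone_mem_blocks (x : LTree) {u : List Bool} (hu : u ∈ x.labels) : cone u ∈ x.blocks :=
  .inr ⟨u, hu, [], by simp⟩

lemma nested_blocks (x : LTree) : Nested x.blocks := by
  have key : ∀ A ∈ x.verts, ∀ u ∈ x.labels, ∀ w, cone (u ++ w) ⊆ A ∨ Disjoint (cone (u ++ w)) A := by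
    intro A hA u hu w
    obtain ⟨l, b, r, hx, -, -, rfl⟩ := x.block A hA
    by_cases h : u ∈ b
    · exact .inl ((cone_append_subset u w).trans fun z hz => ⟨u, h, hz⟩)
    · refine .inr (Set.disjoint_left.2 fun z hz hz' => h ?_)
      exact DisjCones.mem_of_mem_region x.disj hu (fun v hv => by simp [hx, hv])
        (cone_append_subset _ _ hz) hz'
  rintro A (hA | ⟨u, hu, w, rfl⟩) B (hB | ⟨v, hv, w', rfl⟩)
  · exact x.nested A hA B hB
  · rcases key A hA v hv w' with h | h
    · exact .inr (.inl h)
    · exact .inr (.inr h.symm)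
  · rcases key B hB u hu w with h | h
    · exact .inl h
    · exact .inr (.inr h)
  · exact cone_nested _ _

/-- A cone below a label `u` meets no other label, so it cannot be the region of two or more leaves;
such a region must come from a vertex actually present. -/
lemma mem_verts_of_mem_blocks (x : LTree) {l b r : List (List Bool)} (h : x.labels = l ++ b ++ r)
    (hb : 2 ≤ b.length) (hx : region b ∈ x.blocks) : region b ∈ x.verts := by
  rcases hx with hx | ⟨u, hu, w, hw⟩
  · exact hx
  · exfalso
    have hmem : ∀ v ∈ b, v ∈ x.labels := fun v hv => by simp [h, hv]
    have hvu : ∀ v ∈ b, v = u := fun v hv => by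
      obtain ⟨z, hz⟩ := cone_nonempty v
      have hz' : z ∈ region b := ⟨v, hv, hz⟩
      rw [hw] at hz'
      exact DisjCones.eq_of_mem x.disj (hmem v hv) hu hz (cone_append_subset _ _ hz')
    have hnd : b.Nodup := (DisjCones.nodup x.disj).sublist (by
      rw [h]; exact (List.sublist_append_right _ _).trans (List.sublist_append_left _ _))
    rcases b with _ | ⟨a, _ | ⟨c, b⟩⟩
    · simp at hb
    · simp at hb
    · have h1 := hvu a (by simp)
      have h2 := hvu c (by simp)
      subst h1; subst h2
      simp at hnd

end LTree

open LTree

/-- The blocks already contain all vertices that dyadic expansions can create; an expansion only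
turns the potential vertex `u` into an actual one. -/
lemma Expand.blocks_eq {x y : LTree} (h : Expand x y) : y.blocks = x.blocks := by
  obtain ⟨l, u, r, s, h1, h2, h3⟩ := h
  ext A
  constructor
  · rintro (hA | ⟨v, hv, w, rfl⟩)
    · rw [h3] at hA
      rcases hA with rfl | hA
      · exact x.cone_mem_blocks (by simp [h1])
      · exact .inl hA
    · rw [h2] at hv
      simp only [List.mem_append, List.mem_cons] at hv
      rcases hv with hv | rfl | rfl | hv
      · exact .inr ⟨v, by simp [h1, hv], w, rfl⟩
      · exact .inr ⟨u, by simp [h1], s :: w, by simp⟩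
      · exact .inr ⟨u, by simp [h1], (!s) :: w, by simp⟩
      · exact .inr ⟨v, by simp [h1, hv], w, rfl⟩
  · rintro (hA | ⟨v, hv, w, rfl⟩)
    · exact .inl (by rw [h3]; exact .inr hA)
    · rw [h1] at hv
      simp only [List.mem_append, List.mem_cons] at hv
      rcases hv with hv | rfl | hv
      · exact .inr ⟨v, by simp [h2, hv], w, rfl⟩
      · rcases w with _ | ⟨c, w⟩
        · exact .inl (by rw [h3]; exact .inl (by simp))
        · by_cases hc : c = s
          · exact .inr ⟨v ++ [s], by simp [h2], w, by simp [hc]⟩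
          · have hc : c = !s := by revert hc; cases c <;> cases s <;> simp
            exact .inr ⟨v ++ [!s], by simp [h2], w, by simp [hc]⟩
      · exact .inr ⟨v, by simp [h2, hv], w, rfl⟩

lemma Expand.flips {x y : LTree} (h : Expand x y) {n : ℕ} (hy : y.depth ≤ n) :
    Flips x.blocks (x.words n) (y.words n) := by
  obtain ⟨l, u, r, s, h1, h2, h3⟩ := id h
  have hu : u.length < n := by
    have := (y.length_le_depth (u := u ++ [s]) (by simp [h2])).trans hy
    simpa using this
  have e : x.words n = deepen n (l ++ [u ++ [false], u ++ [true]] ++ r) := by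
    rw [words, h1, deepen_append, deepen_append, deepen_append, deepen_cons, deepen_cons,
      deepen_cons, deepen_nil, descendants_children hu]
    simp
  rw [e, words, h2]
  -- For `s = false` the new leaves are in their standard order and the words coincide. Otherwise
  -- the two halves below `u` are exchanged, which is a flip of the block `cone u`.
  cases s
  · simp only [Bool.not_false]
    rw [show l ++ (u ++ [false]) :: (u ++ [true]) :: r = l ++ [u ++ [false], u ++ [true]] ++ r by simp]
  · have := flips_deepen (V := x.blocks) n (l := l) (b := [u ++ [false], u ++ [true]]) (r := r) (by
      intro v hv
      refine .inr ⟨u, by simp [h1], ?_⟩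
      simp only [List.mem_cons, List.not_mem_nil, or_false] at hv
      rcases hv with rfl | rfl <;> exact ⟨_, rfl⟩) (by
      refine .inr ⟨u, by simp [h1], [], ?_⟩
      rw [region_cons, region_cons, region_nil, List.append_nil, cone_child u false]; simp)
    simpa using this

lemma Step.blocks_flips {x y : LTree} (h : Step x y) : y.blocks ⊆ x.blocks ∧
    ∀ n, x.depth ≤ n → y.depth ≤ n → Flips x.blocks (x.words n) (y.words n) := by
  rcases h with ⟨hl, hv⟩ | ⟨l, b, r, hx, hy, hb, hv⟩ | h | h
  · refine ⟨?_, fun n _ _ => ?_⟩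
    · rintro A (hA | hA)
      · exact .inl (hv hA)
      · exact .inr (by rwa [hl] at hA)
    · rw [words, words, hl]
  · refine ⟨?_, fun n _ _ => ?_⟩
    · rintro A (hA | ⟨u, hu, w, rfl⟩)
      · exact .inl (hv ▸ hA)
      · exact .inr ⟨u, by rw [hy] at hu; rw [hx]; simpa using hu, w, rfl⟩
    · rw [words, words, hx, hy]
      exact flips_deepen n (fun u hu => x.cone_mem_blocks (by simp [hx, hu])) (.inl hb)
  · exact ⟨h.blocks_eq.subset, fun n _ hy => h.flips hy⟩
  · refine ⟨h.blocks_eq.symm.subset, fun n hx _ => ?_⟩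
    rw [h.blocks_eq]
    exact (h.flips hx).symm

lemma blocks_anti {x y : LTree} (h : x ≤ y) : y.blocks ⊆ x.blocks := by
  change Relation.ReflTransGen Step x y at h
  induction h with
  | refl => exact subset_rfl
  | tail _ h ih => exact h.blocks_flips.1.trans ih

/-- A chain of moves from `x` to `y` may pass through trees deeper than both, so the words are
compared only beyond the depths of all trees of the chain. The blocks shrink along it, so all flips
belong to the nested family of `x`. -/
lemma eventually_flips {x y : LTree} (h : x ≤ y) :
    ∃ n₀, ∀ n ≥ n₀, Flips x.blocks (x.words n) (y.words n) := by
  change Relation.ReflTransGen Step x y at h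
  induction h with
  | refl => exact ⟨0, fun _ _ => .refl⟩
  | @tail y z hxy h ih =>
    obtain ⟨n₀, hn⟩ := ih
    refine ⟨max n₀ (max y.depth z.depth), fun n hm => ?_⟩
    have h1 := h.blocks_flips.2 n (by omega) (by omega)
    exact (hn n (by omega)).trans (h1.mono (blocks_anti hxy))

/-! ### The descent cocycle -/

/-- The parity of the number of descents of the leaves of `x` with respect to the leaves of `y`,
after complete expansion to some common depth. -/
def descParity (x y : LTree) : ZMod 2 :=
  desc (y.words (max x.depth y.depth)) (x.words (max x.depth y.depth))

lemma descParity_eq {x y : LTree} {n : ℕ} (hx : x.depth ≤ n) (hy : y.depth ≤ n) :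
    descParity x y = desc (y.words n) (x.words n) := by
  rw [← x.deepen_words (le_max_left x.depth y.depth) (by omega : _ ≤ n),
    ← y.deepen_words (le_max_right x.depth y.depth) (by omega : _ ≤ n), desc_deepen n ?_
      (x.disjCones_words _) (y.disjCones_words _), descParity]
  intro u hu
  rw [mem_words _ (by omega)] at hu ⊢
  exact hu

/-- At a large common depth the three orders of leaves are related by flips from the single nested
family `x.blocks`, where descents are additive. -/
lemma descParity_add {x y z : LTree} (h : x ≤ y) (h' : y ≤ z) :
    descParity x z = descParity x y + descParity y z := by
  obtain ⟨n₁, h₁⟩ := eventually_flips h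
  obtain ⟨n₂, h₂⟩ := eventually_flips h'
  obtain ⟨n, hn⟩ : ∃ n, n₁ ≤ n ∧ n₂ ≤ n ∧ x.depth ≤ n ∧ y.depth ≤ n ∧ z.depth ≤ n :=
    ⟨n₁ + n₂ + x.depth + y.depth + z.depth, by omega⟩
  rw [descParity_eq (n := n), descParity_eq (n := n), descParity_eq (n := n)]
  any_goals omega
  have hf := h₁ n (by omega)
  exact Flips.desc_eq x.nested_blocks hf (hf.trans ((h₂ n (by omega)).mono (blocks_anti h)))
    (x.disjCones_words n)

lemma descParity_self (x : LTree) : descParity x x = 0 :=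
  desc_of_sublist (x.disjCones_words _).nodup (List.Sublist.refl _)

lemma descParity_comm {x y : LTree} (h : x ≤ y) (h' : y ≤ x) :
    descParity x y = descParity y x := by
  have := descParity_add h h'
  rw [descParity_self] at this
  exact (CharTwo.add_eq_zero.1 this.symm)

/-! ### Realization of expansions and flips by labelled trees -/

namespace LTree

lemma exists_expand (x : LTree) {n : ℕ} (h : x.depth ≤ n) :
    ∃ y, Relation.ReflTransGen Expand x y ∧ y.labels = x.words n := by
  -- The number `2 ^ (n - u.length) - 1` counts the simple expansions needed to bring the leaf `u`
  -- to depth `n`; the induction is on the total number of them.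
  suffices H : ∀ (N : ℕ) (x : LTree), (∀ u ∈ x.labels, u.length ≤ n) →
      (x.labels.map fun u => 2 ^ (n - u.length) - 1).sum ≤ N →
      ∃ y, Relation.ReflTransGen Expand x y ∧ y.labels = x.words n from
    H _ x (fun u hu => (x.length_le_depth hu).trans h) le_rfl
  intro N
  induction N with
  | zero =>
    intro x hx hN
    refine ⟨x, .refl, (deepen_self fun u hu => ?_).symm⟩
    have h0 := List.sum_eq_zero_iff.1 (Nat.le_zero.1 hN) _ (List.mem_map_of_mem hu)
    refine le_antisymm (hx u hu) ?_
    by_contra hlt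
    have : 1 < 2 ^ (n - u.length) := Nat.one_lt_two_pow (by omega)
    omega
  | succ N ih =>
    intro x hx hN
    by_cases h : ∃ u ∈ x.labels, u.length < n
    · obtain ⟨u, hu, hlt⟩ := h
      obtain ⟨l, r, hlr⟩ := List.append_of_mem hu
      obtain ⟨y, h1, h2⟩ := ih (x.grow l u r false hlr) (by
        intro v hv
        simp only [LTree.grow, List.mem_append, List.mem_cons] at hv
        rcases hv with hv | rfl | rfl | hv
        · exact hx v (by simp [hlr, hv])
        · simpa using hlt
        · simpa using hlt
        · exact hx v (by simp [hlr, hv])) (by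
        rw [hlr] at hN
        simp only [LTree.grow, List.map_append, List.map_cons, List.sum_append, List.sum_cons,
          List.length_append, List.length_singleton] at hN ⊢
        have e : n - u.length = (n - (u.length + 1)) + 1 := by omega
        rw [e, pow_succ] at hN
        have : 0 < 2 ^ (n - (u.length + 1)) := by positivity
        omega)
      refine ⟨y, .head (x.expand_grow _ _) h1, ?_⟩
      rw [h2, words, words, hlr, LTree.grow, deepen_append, deepen_append, deepen_cons, deepen_cons,
        deepen_cons, descendants_children hlt, List.append_assoc]
      rfl
    · push Not at h
      exact ⟨x, .refl, (deepen_self fun u hu => le_antisymm (hx u hu) (h u hu)).symm⟩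

lemma exists_flip (x : LTree) {l b r : List (List Bool)} (h : x.labels = l ++ b ++ r)
    (hb : region b ∈ x.verts) : ∃ y : LTree, y.labels = l ++ b.reverse ++ r ∧ y.verts = x.verts := by
  have hp : x.labels.Perm (l ++ b.reverse ++ r) := by
    rw [h]; exact ((List.reverse_perm b).symm.append_left l).append_right r
  refine ⟨⟨l ++ b.reverse ++ r, x.verts, hp.length_eq ▸ x.two_le, DisjCones.perm x.disj hp,
    fun z => ?_, fun A hA => ?_, x.nested⟩, rfl, rfl⟩
  · obtain ⟨u, hu, hz⟩ := x.cover z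
    exact ⟨u, hp.subset hu, hz⟩
  · obtain ⟨l', b', r', h', h1, h2, rfl⟩ := x.block A hA
    obtain ⟨l₂, b₂, r₂, h3, h4⟩ := block_flip x.disj h h' (x.nested _ hb _ hA)
    exact ⟨l₂, b₂, r₂, h3, by rwa [h4.length_eq], by rwa [h4.length_eq, ← hp.length_eq],
      region_perm h4⟩

/-- A reversed block of at least two leaves lies above a vertex of the tree by
`mem_verts_of_mem_blocks`, so its reversal is a reflection; reversing a shorter block does nothing.
-/
lemma exists_of_flips (x : LTree) {L : List (List Bool)} (h : Flips x.blocks x.labels L) :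
    ∃ y : LTree, y.labels = L ∧ y.verts = x.verts ∧ x ≤ y ∧ y ≤ x := by
  induction h with
  | refl => exact ⟨x, rfl, rfl, le_rfl, le_rfl⟩
  | tail _ h ih =>
    obtain ⟨y, h1, h2, h3, h4⟩ := ih
    obtain ⟨l, b, r, rfl, rfl, hb⟩ := h
    by_cases hl : 2 ≤ b.length
    · have hbv := y.mem_verts_of_mem_blocks h1 hl (blocks_anti h4 hb)
      obtain ⟨z, h5, h6⟩ := y.exists_flip h1 hbv
      refine ⟨z, h5, h6.trans h2, h3.trans (Step.flip l b r h1 h5 hbv h6).le,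
        (Step.flip l b.reverse r h5 (by rw [h1]; simp) (by rwa [region_reverse, h6])
          h6.symm).le.trans h4⟩
    · refine ⟨y, ?_, h2, h3, h4⟩
      rcases b with _ | ⟨a, _ | ⟨c, b⟩⟩
      · simpa using h1
      · simpa using h1
      · simp at hl

lemma exists_equiv_of_flips (x : LTree) {n : ℕ} (hn : x.depth ≤ n) {L : List (List Bool)}
    (h : Flips x.blocks (x.words n) L) : ∃ y : LTree, y.labels = L ∧ x ≤ y ∧ y ≤ x := by
  obtain ⟨z, h1, h2⟩ := x.exists_expand hn
  have e := expands_le h1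
  rw [← h2] at h
  obtain ⟨y, h3, -, h4, h5⟩ := z.exists_of_flips (h.mono (blocks_anti e.2))
  exact ⟨y, h3, e.1.trans h4, h5.trans e.2⟩

end LTree

/-! ### Universal cover, deck transformations and lifts -/

/-- Induction on the morphisms of a free groupoid with a given source. -/
lemma freeGroupoid_induction {C : Type*} [Category C] {X : C}
    (Q : ∀ Y : C, (FreeGroupoid.mk X ⟶ FreeGroupoid.mk Y) → Prop)
    (id : Q X (𝟙 _))
    (comp : ∀ (Y Z : C) (γ : FreeGroupoid.mk X ⟶ FreeGroupoid.mk Y) (f : Y ⟶ Z),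
      Q Y γ → Q Z (γ ≫ FreeGroupoid.homMk f))
    (comp_inv : ∀ (Y Z : C) (γ : FreeGroupoid.mk X ⟶ FreeGroupoid.mk Y) (f : Z ⟶ Y),
      Q Y γ → Q Z (γ ≫ Groupoid.inv (FreeGroupoid.homMk f)))
    (Y : C) (γ : FreeGroupoid.mk X ⟶ FreeGroupoid.mk Y) : Q Y γ := by
  induction γ using Quot.inductionOn with | h γ => ?_
  induction γ using Quot.inductionOn with | h p => ?_
  suffices H : ∀ (Z : Quiver.Symmetrify C) (p : Quiver.Path (V := Quiver.Symmetrify C) X Z),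
      Q Z (Quot.mk _ (Quot.mk _ p)) from H Y p
  intro Z p
  induction p with
  | nil => exact id
  | @cons Y Z p e ih =>
    rcases e with e | e
    · exact comp _ _ _ e ih
    · exact comp_inv _ _ _ e ih

/-- The base point of the universal cover. -/
noncomputable def coverBase : Cover := ⟨base, 𝟙 _⟩

/-- This is the connectedness of the cover: every cell is a path from the base point, hence is
reached by successive incidences. -/
lemma cover_induction {P : Cover → Prop} (h₀ : P coverBase)
    (h : ∀ x y : Cover, x ≤ y → (P x ↔ P y)) (x : Cover) : P x := by
  obtain ⟨s, γ⟩ := x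
  refine freeGroupoid_induction (fun s γ => P ⟨s, γ⟩) h₀ ?_ ?_ s γ
  · intro s t γ f hs
    exact (h ⟨s, γ⟩ ⟨t, _⟩ ⟨leOfHom f, rfl⟩).1 hs
  · intro s t γ f hs
    refine (h ⟨t, _⟩ ⟨s, γ⟩ ⟨leOfHom f, ?_⟩).2 hs
    change γ = (γ ≫ Groupoid.inv (FreeGroupoid.homMk f)) ≫ FreeGroupoid.homMk f
    simp

lemma cover_eq_of_ge {x y y' : Cover} (h : x ≤ y) (h' : x ≤ y') (e : y.pt = y'.pt) : y = y' := by
  obtain ⟨s, γ⟩ := x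
  obtain ⟨t, δ⟩ := y
  obtain ⟨t', δ'⟩ := y'
  obtain ⟨h, e1⟩ := h
  obtain ⟨h', e2⟩ := h'
  dsimp only at *
  subst e
  rw [e1, e2]

lemma cover_eq_of_le {x x' y : Cover} (h : x ≤ y) (h' : x' ≤ y) (e : x.pt = x'.pt) : x = x' := by
  obtain ⟨s, γ⟩ := x
  obtain ⟨s', γ'⟩ := x'
  obtain ⟨t, δ⟩ := y
  obtain ⟨h, e1⟩ := h
  obtain ⟨h', e2⟩ := h'
  dsimp only at *
  subst e
  rw [e1] at e2
  rw [(cancel_mono _).1 e2]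

lemma deckIso_pt (p : PureQBraid) (x : Cover) : (deckIso p x).pt = x.pt := rfl

lemma exists_deckIso_eq {x y : Cover} (h : x.pt = y.pt) : ∃ p, deckIso p x = y := by
  obtain ⟨s, γ⟩ := x
  obtain ⟨t, δ⟩ := y
  dsimp only at h
  subst h
  refine ⟨δ ≫ Groupoid.inv γ, ?_⟩
  simp [deckIso]

lemma deckIso_injective {p q : PureQBraid} {x : Cover} (h : deckIso p x = deckIso q x) : p = q := by
  obtain ⟨s, γ⟩ := x
  simp only [deckIso, RelIso.coe_fn_mk, Equiv.coe_fn_mk, Cover.mk.injEq, heq_eq_eq, true_and] at h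
  exact (cancel_mono γ).1 h

/-- Unique lifting: the deck transformation that agrees with `F` at the base point agrees with it at
every incident cell, hence everywhere. -/
lemma exists_deckIso_of_monotone {F : Cover → Cover} (hF : Monotone F) (h : ∀ x, (F x).pt = x.pt) :
    ∃ p, ∀ x, F x = deckIso p x := by
  obtain ⟨p, hp⟩ := exists_deckIso_eq (h coverBase).symm
  refine ⟨p, cover_induction hp.symm fun x y hxy => ⟨fun hx => ?_, fun hy => ?_⟩⟩
  · exact cover_eq_of_ge (hF hxy) (hx ▸ (deckIso p).monotone hxy) (h y)
  · exact cover_eq_of_le (hF hxy) (hy ▸ (deckIso p).monotone hxy) (h x)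

lemma deck_injective : Function.Injective deck := fun p q h =>
  deckIso_injective (x := coverBase) (by
    have := congrArg (fun f : liftGroup => f.1.2 coverBase) h
    exact this)

lemma deck_range : deck.range = proj.ker := by
  ext f
  constructor
  · rintro ⟨p, rfl⟩
    rfl
  · intro hf
    have hf : f.1.1 = 1 := hf
    obtain ⟨p, hp⟩ := exists_deckIso_of_monotone f.1.2.monotone fun x => by
      rw [f.2 x, hf, map_one]; rfl
    exact ⟨p, Subtype.ext (Prod.ext hf.symm (RelIso.ext fun x => (hp x).symm))⟩

/-- The action of a lift on the universal cover. -/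
abbrev liftAct (f : liftGroup) (x : Cover) : Cover := f.1.2 x

lemma liftAct_pt (f : liftGroup) (x : Cover) : (liftAct f x).pt = act (proj f) x.pt := f.2 x

lemma liftAct_mul (f f' : liftGroup) (x : Cover) :
    liftAct (f * f') x = liftAct f (liftAct f' x) := rfl

lemma liftAct_inv_eq {f : liftGroup} {x y : Cover} (h : liftAct f x = y) : liftAct f⁻¹ y = x := by
  rw [← h, ← liftAct_mul, inv_mul_cancel]; rfl

lemma liftAct_deck (p : PureQBraid) (x : Cover) : liftAct (deck p) x = deckIso p x := rfl

/-- Two lifts of the same element differ by a deck transformation, and deck transformations act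
freely. -/
lemma lift_ext {f f' : liftGroup} (h : proj f = proj f') {x : Cover}
    (hx : liftAct f x = liftAct f' x) : f = f' := by
  have h1 : f⁻¹ * f' ∈ deck.range := by
    rw [deck_range, MonoidHom.mem_ker, map_mul, map_inv, h, inv_mul_cancel]
  obtain ⟨p, hp⟩ := h1
  have h2 : deckIso p x = deckIso 1 x := by
    rw [← liftAct_deck, ← liftAct_deck, hp, liftAct_mul, liftAct_inv_eq hx, map_one]; rfl
  rw [deckIso_injective h2, map_one, eq_comm, inv_mul_eq_one] at hp
  exact hp

/-- The transport of the universal cover along the action of `g`, when the base point is moved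
along the path `γ`. -/
noncomputable def transport (g : neretin)
    (γ : FreeGroupoid.mk base ⟶ FreeGroupoid.mk (act g base)) (x : Cover) : Cover :=
  ⟨act g x.pt, γ ≫ (FreeGroupoid.map (act g).monotone.functor).map x.path⟩

lemma transport_monotone (g : neretin)
    (γ : FreeGroupoid.mk base ⟶ FreeGroupoid.mk (act g base)) : Monotone (transport g γ) := by
  rintro x y ⟨h, e⟩
  refine ⟨(act g).monotone h, ?_⟩
  change γ ≫ (FreeGroupoid.map (act g).monotone.functor).map y.path =
    (γ ≫ (FreeGroupoid.map (act g).monotone.functor).map x.path) ≫ _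
  rw [e, Functor.map_comp]
  exact (Category.assoc _ _ _).symm

/-- Connectedness supplies a path from the base point to its image, along which the cover is
transported. Transports for `g` and `g⁻¹` compose to monotone lifts of the identity, which are deck
transformations; hence each transport is bijective and reflects the order. -/
lemma exists_lift (hconn : ∀ s : Stratum, ∃ x : Cover, x.pt = s) (g : neretin) :
    ∃ f : liftGroup, proj f = g := by
  have hγ : ∀ g : neretin, ∃ F : Cover → Cover, Monotone F ∧ ∀ x, (F x).pt = act g x.pt := by
    intro g
    obtain ⟨⟨s, γ⟩, hs⟩ := hconn (act g base)
    dsimp only at hs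
    subst hs
    exact ⟨transport g γ, transport_monotone g γ, fun x => rfl⟩
  obtain ⟨F, hF, hF'⟩ := hγ g
  obtain ⟨G, hG, hG'⟩ := hγ g⁻¹
  obtain ⟨p, hp⟩ := exists_deckIso_of_monotone (hF.comp hG) fun x => by
    rw [Function.comp, hF', hG', map_inv]; exact (act g).apply_symm_apply _
  obtain ⟨q, hq⟩ := exists_deckIso_of_monotone (hG.comp hF) fun x => by
    rw [Function.comp, hG', hF', map_inv]; exact (act g).symm_apply_apply _
  have hinj : Function.Injective F := fun x y h => (deckIso q).injective (by
    rw [← hq, ← hq, Function.comp, h]; rfl)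
  have hsurj : Function.Surjective F := fun y => ⟨G ((deckIso p).symm y), by
    have := hp ((deckIso p).symm y)
    rwa [OrderIso.apply_symm_apply] at this⟩
  refine ⟨⟨(g, ⟨Equiv.ofBijective F ⟨hinj, hsurj⟩, ?_⟩), hF'⟩, rfl⟩
  intro x y
  refine ⟨fun h => ?_, fun h => hF h⟩
  have h2 : (G ∘ F) x ≤ (G ∘ F) y := hG h
  rwa [hq, hq, (deckIso q).le_iff_le] at h2

lemma exists_lift_apply_eq (hconn : ∀ s : Stratum, ∃ x : Cover, x.pt = s) (g : neretin)
    {x y : Cover} (h : act g x.pt = y.pt) : ∃ f : liftGroup, proj f = g ∧ liftAct f x = y := by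
  obtain ⟨f, hf⟩ := exists_lift hconn g
  obtain ⟨p, hp⟩ := exists_deckIso_eq (x := liftAct f x) (y := y) (by rw [liftAct_pt, hf, h])
  refine ⟨deck p * f, ?_, hp⟩
  have : proj (deck p) = 1 := rfl
  rw [map_mul, hf, this, one_mul]

/-- Fixed cells propagate along incidences over fixed strata, by unique lifting. This is how lifts
with different fixed points are compared. -/
lemma liftAct_eq_self_of_ge {f : liftGroup} {x y : Cover} (hx : liftAct f x = x) (h : x ≤ y)
    (hy : act (proj f) y.pt = y.pt) : liftAct f y = y := by
  refine cover_eq_of_ge (x := x) ?_ h ((liftAct_pt f y).trans hy)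
  rw [← hx]; exact f.1.2.monotone h

lemma liftAct_eq_self_of_le {f : liftGroup} {x y : Cover} (hy : liftAct f y = y) (h : x ≤ y)
    (hx : act (proj f) x.pt = x.pt) : liftAct f x = x := by
  refine cover_eq_of_le (y := y) ?_ h ((liftAct_pt f x).trans hx)
  rw [← hy]; exact f.1.2.monotone h

/-- A point of the cover above `x` over a given stratum. -/
lemma exists_cover_ge (x : Cover) {t : Stratum} (h : x.pt ≤ t) : ∃ y : Cover, x ≤ y ∧ y.pt = t :=
  ⟨⟨t, x.path ≫ FreeGroupoid.homMk (homOfLE h)⟩, ⟨h, rfl⟩, rfl⟩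

lemma exists_cover_le (y : Cover) {s : Stratum} (h : s ≤ y.pt) : ∃ x : Cover, x ≤ y ∧ x.pt = s :=
  ⟨⟨s, y.path ≫ Groupoid.inv (FreeGroupoid.homMk (homOfLE h))⟩, ⟨h, by simp⟩, rfl⟩

/-! ### Parity of paths and the stable length -/

/-- A labelled tree representing a stratum. -/
noncomputable def rep (s : Stratum) : LTree := ofAntisymmetrization (· ≤ ·) s

lemma stratum_rep (s : Stratum) : stratum (rep s) = s := toAntisymmetrization_ofAntisymmetrization _ s

lemma rep_le_rep {s t : Stratum} (h : s ≤ t) : rep s ≤ rep t :=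
  ofAntisymmetrization_le_ofAntisymmetrization_iff.2 h

lemma le_of_stratum_le {x y : LTree} (h : stratum x ≤ stratum y) : x ≤ y :=
  toAntisymmetrization_le_toAntisymmetrization_iff.1 h

lemma rep_stratum_le (x : LTree) : rep (stratum x) ≤ x :=
  le_of_stratum_le (stratum_rep _).le

lemma le_rep_stratum (x : LTree) : x ≤ rep (stratum x) :=
  le_of_stratum_le (stratum_rep _).ge

/-- The parity of the number of descents, as a cocycle on the poset of strata. -/
noncomputable def parityFunctor : Stratum ⥤ SingleObj (Multiplicative (ZMod 2)) where
  obj _ := SingleObj.star _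
  map {s t} _ := (Multiplicative.ofAdd (descParity (rep s) (rep t)) : Multiplicative (ZMod 2))
  map_id s := by rw [descParity_self]; rfl
  map_comp {s t u} f g := by
    rw [descParity_add (rep_le_rep (leOfHom f)) (rep_le_rep (leOfHom g)), add_comm]; rfl

/-- The parity of a homotopy class of paths in the tower. -/
noncomputable def pathParity {s t : Stratum} (γ : FreeGroupoid.mk s ⟶ FreeGroupoid.mk t) : ZMod 2 :=
  Multiplicative.toAdd (α := ZMod 2) ((FreeGroupoid.lift parityFunctor).map γ)

lemma pathParity_comp {s t u : Stratum} (γ : FreeGroupoid.mk s ⟶ FreeGroupoid.mk t)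
    (δ : FreeGroupoid.mk t ⟶ FreeGroupoid.mk u) :
    pathParity (γ ≫ δ) = pathParity γ + pathParity δ := by
  rw [pathParity, Functor.map_comp, add_comm]; rfl

lemma pathParity_id (s : Stratum) : pathParity (𝟙 (FreeGroupoid.mk s)) = 0 := by
  rw [pathParity, CategoryTheory.Functor.map_id]; rfl

lemma pathParity_inv {s t : Stratum} (γ : FreeGroupoid.mk s ⟶ FreeGroupoid.mk t) :
    pathParity (Groupoid.inv γ) = pathParity γ := by
  have h := pathParity_comp γ (Groupoid.inv γ)
  rw [Groupoid.comp_inv, pathParity_id] at h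
  exact (CharTwo.add_eq_zero.1 h.symm).symm

lemma pathParity_homMk {s t : Stratum} (f : s ⟶ t) :
    pathParity (FreeGroupoid.homMk f) = descParity (rep s) (rep t) := by
  rw [pathParity, FreeGroupoid.lift_map_homMk]; rfl

lemma pathParity_eqToHom {s t : Stratum} (h : FreeGroupoid.mk s = FreeGroupoid.mk t) :
    pathParity (eqToHom h) = 0 := by
  obtain rfl := FreeGroupoid.of_obj_bijective.1 h
  exact pathParity_id s

/-- The cocycle is defined on arbitrarily chosen representatives. Passing to convenient trees costs
one correction at each end, and these corrections cancel along a loop. -/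
lemma pathParity_homMk_stratum {x y : LTree} (h : x ≤ y) (f : stratum x ⟶ stratum y) :
    pathParity (FreeGroupoid.homMk f) =
      descParity x (rep (stratum x)) + descParity x y + descParity y (rep (stratum y)) := by
  rw [pathParity_homMk, descParity_add ((rep_stratum_le x).trans h) (le_rep_stratum y),
    descParity_add (rep_stratum_le x) h, descParity_comm (rep_stratum_le x) (le_rep_stratum x)]

/-- The stable length modulo two. -/
noncomputable def stableLength : PureQBraid →* Multiplicative (ZMod 2) where
  toFun p := Multiplicative.ofAdd (pathParity p)
  map_one' := by
    have : pathParity (1 : PureQBraid) = 0 := pathParity_id _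
    rw [this]; rfl
  map_mul' p q := by
    have : pathParity (p * q) = pathParity p + pathParity q := pathParity_comp p q
    rw [this]; rfl

lemma length_of_mem_permLabels {n : ℕ} {σ : Equiv.Perm (Fin (2 ^ n))} {u : List Bool}
    (hu : u ∈ permLabels n σ) : u.length = n := by
  obtain ⟨i, rfl⟩ := List.mem_ofFn.1 hu
  exact length_of_mem_dyadicWords (List.getElem_mem _)

lemma depth_le {x : LTree} {n : ℕ} (h : ∀ u ∈ x.labels, u.length ≤ n) : x.depth ≤ n := by
  rw [LTree.depth]
  generalize x.labels = L at h
  induction L with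
  | nil => simp
  | cons v L ih =>
    simpa using ⟨h v (by simp), by simpa using ih fun u hu => h u (by simp [hu])⟩

lemma descParity_eq_desc {x y : LTree} {n : ℕ} (hx : ∀ u ∈ x.labels, u.length = n)
    (hy : ∀ u ∈ y.labels, u.length = n) : descParity x y = desc y.labels x.labels := by
  rw [descParity_eq (depth_le fun u hu => (hx u hu).le) (depth_le fun u hu => (hy u hu).le),
    LTree.words, LTree.words, deepen_self hx, deepen_self hy]

lemma descParity_of_labels_eq {x y : LTree} (h : x.labels = y.labels) : descParity x y = 0 := by
  rw [descParity, LTree.words, LTree.words, h]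
  exact desc_of_sublist (y.disjCones_words _).nodup (List.Sublist.refl _)

lemma permLabels_mul_rev {m : ℕ} (σ : Equiv.Perm (Fin (2 ^ m))) (T : Itv (2 ^ m)) :
    permLabels m (σ * T.rev) = (permLabels m σ).take T.a ++
      (((permLabels m σ).drop T.a).take T.size).reverse ++ ((permLabels m σ).drop T.a).drop T.size := by
  have h1 := T.lt; have h2 := T.lt_n
  have hl := length_permLabels m σ
  set L := permLabels m σ with hL
  apply List.ext_getElem
  · simp [length_permLabels, hl, Itv.size]; omega
  · intro i hi hi'
    have hin : i < 2 ^ m := by simpa [length_permLabels] using hi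
    have key : ∀ j k : Fin (2 ^ m), T.rev j = k →
        (permLabels m (σ * T.rev))[(j : ℕ)]'(by simp [length_permLabels]) =
          L[(k : ℕ)]'(by simp [hl]) := by
      rintro j _ rfl
      simp [hL, permLabels]
    simp only [List.getElem_append, List.getElem_reverse, List.getElem_take, List.getElem_drop,
      List.length_take, List.length_drop, List.length_append, List.length_reverse, hl, Itv.size]
    split_ifs with c1 c2
    · exact key ⟨i, hin⟩ ⟨_, by omega⟩ (by
        ext; rw [Itv.rev_val, if_neg] <;> simp <;> omega)
    · exact key ⟨i, hin⟩ ⟨_, by omega⟩ (by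
        ext; rw [Itv.rev_val, if_pos] <;> simp <;> omega)
    · exact key ⟨i, hin⟩ ⟨_, by omega⟩ (by
        ext; rw [Itv.rev_val, if_neg] <;> simp <;> omega)

lemma take_drop_eq {m : ℕ} (σ : Equiv.Perm (Fin (2 ^ m))) (T : Itv (2 ^ m)) :
    permLabels m σ = (permLabels m σ).take T.a ++
      ((permLabels m σ).drop T.a).take T.size ++ ((permLabels m σ).drop T.a).drop T.size := by
  rw [List.append_assoc, List.take_append_drop, List.take_append_drop]

/-- The reversed interval has `|T| - 1` gaps, which has the parity of `1 + |T|`; without reversal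
there would be no descent. -/
lemma desc_permLabels_mul_rev {m : ℕ} (σ : Equiv.Perm (Fin (2 ^ m))) (T : Itv (2 ^ m)) :
    desc (permLabels m (σ * T.rev)) (permLabels m σ) = ((1 + T.size : ℕ) : ZMod 2) := by
  have h1 := T.lt; have h2 := T.lt_n
  have e1 := take_drop_eq σ T
  have e2 := permLabels_mul_rev σ T
  have hl : (((permLabels m σ).drop T.a).take T.size).length = T.size := by
    simp [length_permLabels, Itv.size]; omega
  rcases hb : ((permLabels m σ).drop T.a).take T.size with _ | ⟨c, b⟩
  · rw [hb] at hl
    simp [Itv.size] at hl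
  · rw [hb] at hl e1 e2
    have hn : (permLabels m σ).Nodup := DisjCones.nodup (disj_permLabels m σ)
    have hn' : (permLabels m (σ * T.rev)).Nodup := DisjCones.nodup (disj_permLabels m _)
    generalize (permLabels m σ).take T.a = l at e1 e2
    generalize ((permLabels m σ).drop T.a).drop T.size = r at e1 e2
    rw [e1] at hn
    have hd := desc_flip hn (e2 ▸ hn') (List.reverse_perm (c :: b))
      (((List.reverse_perm (c :: b)).symm.append_left l).append_right r)
    rw [e2]
    nth_rw 1 [e1]
    rw [hd, desc_of_sublist (e2 ▸ hn') (List.Sublist.refl _), add_zero, ← hl]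
    have h2 : (2 : ZMod 2) = 0 := rfl
    push_cast [List.length_cons]
    linear_combination -h2

/-- The correction between a tree and the chosen representative of its stratum. -/
noncomputable def repParity (x : LTree) : ZMod 2 := descParity x (rep (stratum x))

lemma pathParity_cross (n : ℕ) (σ : Equiv.Perm (Fin (2 ^ (n + 1)))) (T : Itv (2 ^ (n + 1))) :
    pathParity (cross n σ T) = ((1 + T.size : ℕ) : ZMod 2) + repParity (topTree n σ) +
      repParity (topTree n (σ * T.rev)) := by
  rw [cross, pathParity_comp, pathParity_inv,
    pathParity_homMk_stratum (le_of_stratum_le (wall_le_left n σ T)),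
    pathParity_homMk_stratum (le_of_stratum_le (wall_le_right n σ T)),
    descParity_of_labels_eq (x := wallTree n σ T) (y := topTree n σ) rfl,
    descParity_eq_desc (x := wallTree n σ T) (y := topTree n (σ * T.rev)) (n := n + 1)
      (fun u hu => length_of_mem_permLabels hu) (fun u hu => length_of_mem_permLabels hu)]
  have h := desc_permLabels_mul_rev σ T
  change desc (permLabels (n + 1) (σ * T.rev)) (permLabels (n + 1) σ) = _ at h
  change _ + _ + (_ + desc (permLabels (n + 1) (σ * T.rev)) (permLabels (n + 1) σ) + _) = _
  rw [h, repParity, repParity]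
  have h2 : (2 : ZMod 2) = 0 := rfl
  -- The correction at the wall is met once on the way down and once on the way up; only those at
  -- the two top cells survive.
  linear_combination (descParity (wallTree n σ T) (rep (stratum (wallTree n σ T)))) * h2

lemma length_gen {n : ℕ} (T : Itv n) :
    QBraid.length n (QBraid.gen T) = Multiplicative.ofAdd ((1 + T.size : ℕ) : ZMod 2) :=
  PresentedGroup.toGroup.of _

lemma pathParity_walk (n : ℕ) (σ : Equiv.Perm (Fin (2 ^ (n + 1)))) (t : List (Itv (2 ^ (n + 1)))) :
    pathParity (walk n σ t) = Multiplicative.toAdd (QBraid.length _ (wordBraid t)) +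
      repParity (topTree n σ) + repParity (topTree n (walkEnd σ t)) := by
  induction t generalizing σ with
  | nil =>
    have h : pathParity (walk n σ []) = 0 := pathParity_id _
    rw [h]
    simp [wordBraid, walkEnd, CharTwo.add_self_eq_zero]
  | cons T t ih =>
    have h : pathParity (walk n σ (T :: t)) =
        pathParity (cross n σ T) + pathParity (walk n (σ * T.rev) t) := pathParity_comp _ _
    rw [h, pathParity_cross, ih]
    have e : wordBraid (T :: t) = QBraid.gen T * wordBraid t := by simp [wordBraid]
    rw [e, map_mul, length_gen, toAdd_mul, toAdd_ofAdd, walkEnd]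
    have h2 : (2 : ZMod 2) = 0 := rfl
    linear_combination (repParity (topTree n (σ * T.rev))) * h2

lemma pathParity_loop (n : ℕ) (t : List (Itv (2 ^ (n + 1))))
    (h : wordBraid t ∈ QBraid.pure (2 ^ (n + 1))) :
    pathParity (loop n t h) = Multiplicative.toAdd (QBraid.length _ (wordBraid t)) := by
  have e : walkEnd 1 t = 1 := by rw [walkEnd_eq, MonoidHom.mem_ker.1 h, mul_one]
  rw [loop, pathParity_comp, pathParity_comp, pathParity_comp, pathParity_eqToHom, pathParity_inv,
    pathParity_walk, e]
  have h2 : (2 : ZMod 2) = 0 := rfl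
  -- The walk closes up at the cell `1`, so the correction there occurs twice, as does the path
  -- joining it to the base point.
  linear_combination (repParity (topTree n 1) + pathParity (FreeGroupoid.homMk (homOfLE (base_le n)))) * h2

/-! ### Every path is homotopic to one given by a word -/

/-- The order of the leaves of the star `σ` is obtained from a tree representing `s` by
reversals at its inner vertices. -/
def Adjacent (n : ℕ) (s : Stratum) (σ : Equiv.Perm (Fin (2 ^ (n + 1)))) : Prop :=
  (rep s).depth ≤ n + 1 ∧ Flips (rep s).blocks ((rep s).words (n + 1)) (permLabels (n + 1) σ)

lemma Adjacent.exists_tree {n : ℕ} {s : Stratum} {σ : Equiv.Perm (Fin (2 ^ (n + 1)))}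
    (h : Adjacent n s σ) : ∃ y : LTree, y.labels = permLabels (n + 1) σ ∧ rep s ≤ y ∧ y ≤ rep s :=
  (rep s).exists_equiv_of_flips h.1 h.2

lemma Adjacent.le {n : ℕ} {s : Stratum} {σ : Equiv.Perm (Fin (2 ^ (n + 1)))}
    (h : Adjacent n s σ) : s ≤ cell n σ := by
  obtain ⟨y, h1, h2, -⟩ := h.exists_tree
  rw [← stratum_rep s]
  exact stratum_le (h2.trans (Step.contract (y := topTree n σ) h1.symm (Set.empty_subset _)).le)

lemma eventually_adjacent {s t : Stratum} (h : s ≤ t) :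
    ∃ n₀, ∀ n ≥ n₀, ∀ σ, Adjacent n t σ → Adjacent n s σ := by
  obtain ⟨n₀, hn⟩ := eventually_flips (rep_le_rep h)
  refine ⟨max n₀ (rep s).depth, fun n hm σ hσ => ⟨by omega, (hn (n + 1) (by omega)).trans ?_⟩⟩
  exact hσ.2.mono (blocks_anti (rep_le_rep h))

lemma permLabels_one (m : ℕ) : permLabels m 1 = dyadicWords m := by
  rw [← ofFn_dyadicWord]; rfl

lemma permLabels_injective (m : ℕ) : Function.Injective (permLabels m) := by
  intro σ τ h
  have hd : Function.Injective (dyadicWord m) := by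
    rw [← List.nodup_ofFn, ofFn_dyadicWord]
    exact DisjCones.nodup (dyadicWords_spec m).1
  ext i
  rw [permLabels, permLabels, List.ofFn_inj] at h
  rw [hd (congrFun h i)]

lemma exists_permLabels {m : ℕ} {L : List (List Bool)} (h : L.Perm (dyadicWords m)) :
    ∃ σ, L = permLabels m σ := by
  have hl : L.length = 2 ^ m := by rw [h.length_eq, length_dyadicWords]
  have hnd : L.Nodup := h.symm.nodup (DisjCones.nodup (dyadicWords_spec m).1)
  have hf : ∀ i : Fin (2 ^ m), ∃ j, dyadicWord m j = L[(i : ℕ)]'(by omega) := fun i => by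
    have := h.subset (List.getElem_mem (l := L) (n := i) (by omega))
    rw [← ofFn_dyadicWord, List.mem_ofFn] at this
    exact this
  choose f hf using hf
  have hinj : Function.Injective f := fun i j hij => by
    have := (hf i).symm.trans ((congrArg _ hij).trans (hf j))
    exact Fin.ext ((hnd.getElem_inj_iff).1 this)
  refine ⟨Equiv.ofBijective f (Finite.injective_iff_bijective.1 hinj), ?_⟩
  apply List.ext_getElem
  · simp [hl, permLabels]
  · intro i h1 h2
    simp [permLabels, hf]

lemma words_perm {x : LTree} {m : ℕ} (h : x.depth ≤ m) : (x.words m).Perm (dyadicWords m) := by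
  refine (List.perm_ext_iff_of_nodup (x.disjCones_words m).nodup
    (DisjCones.nodup (dyadicWords_spec m).1)).2 fun u => ?_
  rw [x.mem_words h]
  refine ⟨fun hu => ?_, length_of_mem_dyadicWords⟩
  obtain ⟨z, hz⟩ := cone_nonempty u
  obtain ⟨v, hv, hzv⟩ := (dyadicWords_spec m).2 z
  have hl := length_of_mem_dyadicWords hv
  have := take_of_mem_cone hzv
  rw [hl, ← hu, take_of_mem_cone hz] at this
  rwa [this]

lemma exists_adjacent {n : ℕ} {s : Stratum} (h : (rep s).depth ≤ n + 1) : ∃ σ, Adjacent n s σ := by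
  obtain ⟨σ, hσ⟩ := exists_permLabels (words_perm h)
  exact ⟨σ, h, hσ ▸ .refl⟩

/-- The paths given by words. -/
inductive IsWalk (n : ℕ) : ∀ σ τ : Equiv.Perm (Fin (2 ^ (n + 1))),
    (FreeGroupoid.mk (cell n σ) ⟶ FreeGroupoid.mk (cell n τ)) → Prop
  | nil (σ) : IsWalk n σ σ (𝟙 _)
  | cons (σ T τ γ) (h : IsWalk n (σ * T.rev) τ γ) : IsWalk n σ τ (cross n σ T ≫ γ)

lemma IsWalk.trans {n : ℕ} {σ τ ρ : Equiv.Perm (Fin (2 ^ (n + 1)))}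
    {γ : FreeGroupoid.mk (cell n σ) ⟶ FreeGroupoid.mk (cell n τ)}
    {δ : FreeGroupoid.mk (cell n τ) ⟶ FreeGroupoid.mk (cell n ρ)} (h : IsWalk n σ τ γ)
    (h' : IsWalk n τ ρ δ) : IsWalk n σ ρ (γ ≫ δ) := by
  induction h with
  | nil σ => rwa [Category.id_comp]
  | cons σ T τ γ h ih => rw [Category.assoc]; exact .cons _ _ _ _ (ih h')

lemma IsWalk.exists_word {n : ℕ} {σ τ : Equiv.Perm (Fin (2 ^ (n + 1)))}
    {γ : FreeGroupoid.mk (cell n σ) ⟶ FreeGroupoid.mk (cell n τ)} (h : IsWalk n σ τ γ) :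
    ∃ t, ∃ e : walkEnd σ t = τ, γ = walk n σ t ≫ eqToHom (by rw [e]) := by
  induction h with
  | nil σ => exact ⟨[], rfl, (Category.comp_id _).symm⟩
  | cons σ T τ γ h ih =>
    obtain ⟨t, e, rfl⟩ := ih
    exact ⟨T :: t, e, (Category.assoc _ _ _).symm⟩

lemma homMk_comp_homMk {s t u : Stratum} (h : s ≤ t) (h' : t ≤ u) :
    FreeGroupoid.homMk (homOfLE h) ≫ FreeGroupoid.homMk (homOfLE h') =
      FreeGroupoid.homMk (homOfLE (h.trans h')) := by
  rw [← Functor.map_comp]; rfl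

/-- A flip around `s` is a generator of the quasi-braid group whose wall contains `s` in its
closure: contracting all inner edges but the one of the reversed block leads from `s` to the wall.
-/
lemma exists_itv_of_block {n : ℕ} {s : Stratum} {σ : Equiv.Perm (Fin (2 ^ (n + 1)))}
    (h : Adjacent n s σ) {l b r : List (List Bool)} (hL : permLabels (n + 1) σ = l ++ b ++ r)
    (hb : region b ∈ (rep s).blocks) (hb2 : 2 ≤ b.length) :
    ∃ T : Itv (2 ^ (n + 1)), permLabels (n + 1) (σ * T.rev) = l ++ b.reverse ++ r ∧
      s ≤ wall n σ T := by
  obtain ⟨y, h1, h2, h3⟩ := h.exists_tree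
  have hv := y.mem_verts_of_mem_blocks (h1.trans hL) hb2 (blocks_anti h3 hb)
  obtain ⟨l', b', r', h4, h5, h6, h7⟩ := y.block _ hv
  have hlen := length_permLabels (n + 1) σ
  have hlen' : l.length + b.length + r.length = 2 ^ (n + 1) := by
    rw [← hlen, hL]; simp; ring
  -- The interval is proper because the vertex of the block is not the root: if `b` were the whole
  -- list, the proper block `b'` with the same region would contain all labels.
  have hne : ¬ (l.length = 0 ∧ l.length + b.length - 1 + 1 = 2 ^ (n + 1)) := by
    rintro ⟨hl, hb'⟩
    have hl : l = [] := List.length_eq_zero_iff.1 hl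
    have hr : r = [] := List.length_eq_zero_iff.1 (by omega)
    subst hl; subst hr
    have hsub : y.labels ⊆ b' := fun u hu => by
      obtain ⟨z, hz⟩ := cone_nonempty u
      refine DisjCones.mem_of_mem_region y.disj hu (fun v hv => by simp [h4, hv]) hz ?_
      rw [h7]
      exact ⟨u, by simpa [h1, hL] using hu, hz⟩
    have := ((DisjCones.nodup y.disj).subperm hsub).length_le
    omega
  let T : Itv (2 ^ (n + 1)) := ⟨l.length, l.length + b.length - 1, by omega, by omega, hne⟩
  have hsize : T.size = b.length := by simp only [Itv.size, T]; omega
  have e1 : (permLabels (n + 1) σ).take T.a = l := by rw [hL]; simp [T]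
  have e2 : (permLabels (n + 1) σ).drop T.a = b ++ r := by rw [hL]; simp [T]
  refine ⟨T, ?_, ?_⟩
  · rw [permLabels_mul_rev, e1, e2, hsize]; simp
  · rw [← stratum_rep s]
    refine stratum_le (h2.trans (Step.contract (y := wallTree n σ T) h1.symm ?_).le)
    rintro _ rfl
    rw [e2, hsize]
    simpa using hv

/-- Two adjacent top cells are connected by a walk around the stratum. -/
lemma exists_walk {n : ℕ} {s : Stratum} {σ τ : Equiv.Perm (Fin (2 ^ (n + 1)))}
    (h : Adjacent n s σ) (h' : Adjacent n s τ) :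
    ∃ γ, IsWalk n σ τ γ ∧
      FreeGroupoid.homMk (homOfLE h.le) ≫ γ = FreeGroupoid.homMk (homOfLE h'.le) := by
  have hf : Flips (rep s).blocks (permLabels (n + 1) σ) (permLabels (n + 1) τ) := h.2.symm.trans h'.2
  generalize hL : permLabels (n + 1) σ = L at hf
  induction hf using Relation.ReflTransGen.head_induction_on generalizing σ with
  | refl =>
    obtain rfl := permLabels_injective _ hL
    exact ⟨𝟙 _, .nil _, Category.comp_id _⟩
  | head hs _ ih =>
    obtain ⟨l, b, r, rfl, rfl, hb⟩ := hs
    by_cases hb2 : 2 ≤ b.length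
    · obtain ⟨T, hT, hw⟩ := exists_itv_of_block h hL hb hb2
      have hadj : Adjacent n s (σ * T.rev) := ⟨h.1, h.2.tail ⟨l, b, r, hL, hT, hb⟩⟩
      obtain ⟨γ, hγ, e⟩ := ih hadj hT
      refine ⟨_, .cons _ T _ _ hγ, ?_⟩
      -- Both morphisms from `s` to the adjacent top cells factor through the wall, so crossing it
      -- transforms the first into the second.
      rw [← e, ← homMk_comp_homMk hw (wall_le_left n σ T), ← homMk_comp_homMk hw (wall_le_right n σ T),
        cross]
      simp
    · refine ih h ?_
      rw [hL]
      rcases b with _ | ⟨a, _ | ⟨c, b⟩⟩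
      · rfl
      · rfl
      · simp at hb2

/-- The complete expansion of the base tree lists the dyadic words in their standard order, that is
the star `1`. The depth must only be large enough for the chosen representative of the base point.
-/
lemma eventually_adjacent_base : ∃ n₀, ∀ n ≥ n₀, Adjacent n base 1 := by
  obtain ⟨n₀, hn⟩ := eventually_flips (rep_stratum_le (topTree 0 1))
  refine ⟨max n₀ (rep base).depth, fun n hm => ⟨by omega, ?_⟩⟩
  have := hn (n + 1) (by omega)
  have e : (topTree 0 1).words (n + 1) = permLabels (n + 1) 1 := by
    have h0 : (topTree 0 1).labels = descendants 1 [] := by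
      change permLabels 1 1 = _
      rw [permLabels_one]
      simp [descendants]
    rw [LTree.words, h0, deepen, descendants_descendants (by simp) (by omega), permLabels_one]
    simp [descendants]
  rwa [e] at this

/-- Every path from the base point is eventually given by a word. -/
lemma eventually_isWalk (x : Cover) : ∃ n₀, ∀ n ≥ n₀, ∀ σ, ∀ h : Adjacent n x.pt σ,
    ∃ γ, IsWalk n 1 σ γ ∧ x.path ≫ FreeGroupoid.homMk (homOfLE h.le) =
      FreeGroupoid.homMk (homOfLE (base_le n)) ≫ γ := by
  induction x using cover_induction with
  | h₀ =>
    obtain ⟨n₀, hn⟩ := eventually_adjacent_base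
    refine ⟨n₀, fun n hm σ h => ?_⟩
    obtain ⟨γ, hγ, e⟩ := exists_walk (hn n hm) h
    exact ⟨γ, hγ, (Category.id_comp _).trans e.symm⟩
  | h x y hxy =>
  refine ⟨?_, ?_⟩
  · rintro ⟨n₁, h₁⟩
    obtain ⟨hle, hp⟩ := hxy
    obtain ⟨n₂, h₂⟩ := eventually_adjacent hle
    refine ⟨max n₁ n₂, fun n hn σ h => ?_⟩
    obtain ⟨γ, hγ, e⟩ := h₁ n (by omega) σ (h₂ n (by omega) σ h)
    refine ⟨γ, hγ, ?_⟩
    rw [← e, hp, Category.assoc, homMk_comp_homMk]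
  · rintro ⟨n₁, h₁⟩
    obtain ⟨hle, hp⟩ := hxy
    obtain ⟨n₂, h₂⟩ := eventually_adjacent hle
    refine ⟨max (max n₁ n₂) (rep y.pt).depth, fun n hn σ h => ?_⟩
    -- To descend from `y` to `x`, the walk ends first at a top cell `τ` adjacent to `y`, hence to
    -- `x`, and then goes around `x` from `τ` to `σ`.
    obtain ⟨τ, hτ⟩ := exists_adjacent (n := n) (s := y.pt) (by omega)
    obtain ⟨γ, hγ, e⟩ := h₁ n (by omega) τ hτ
    obtain ⟨δ, hδ, e'⟩ := exists_walk (h₂ n (by omega) τ hτ) h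
    refine ⟨γ ≫ δ, hγ.trans hδ, ?_⟩
    rw [← e', ← Category.assoc, ← Category.assoc, ← e, hp, Category.assoc, Category.assoc,
      ← homMk_comp_homMk hle hτ.le]
    simp

lemma stableLength_eq_iff (p : PureQBraid) (a : Multiplicative (ZMod 2)) :
    stableLength p = a ↔ HasStableLength p a := by
  constructor
  · rintro rfl
    obtain ⟨n₁, h₁⟩ := eventually_isWalk ⟨base, p⟩
    obtain ⟨n₂, h₂⟩ := eventually_adjacent_base
    obtain ⟨γ, hγ, e⟩ := h₁ (max n₁ n₂) (by omega) 1 (h₂ _ (by omega))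
    obtain ⟨t, ht, rfl⟩ := hγ.exists_word
    have hpure : wordBraid t ∈ QBraid.pure (2 ^ (max n₁ n₂ + 1)) := by
      rw [walkEnd_eq, one_mul] at ht
      exact ht
    have hp : p = loop _ t hpure := by
      rw [← cancel_mono (FreeGroupoid.homMk (homOfLE (base_le (max n₁ n₂))))]
      refine e.trans ?_
      rw [loop]
      simp
    refine ⟨_, t, hpure, hp, ?_⟩
    have := pathParity_loop _ t hpure
    rw [← hp] at this
    exact congrArg Multiplicative.ofAdd this
  · rintro ⟨n, t, h, rfl, rfl⟩
    exact congrArg Multiplicative.ofAdd (pathParity_loop n t h)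

/-- Adjacent transpositions generate the symmetric group. With two letters the only such interval
would not be proper, hence the bound on `m`. -/
lemma mem_closure_rev {m : ℕ} (hm : 3 ≤ m) (σ : Equiv.Perm (Fin m)) :
    σ ∈ Submonoid.closure (Set.range fun T : Itv m => T.rev) := by
  obtain ⟨k, rfl⟩ : ∃ k, m = k + 1 := ⟨m - 1, by omega⟩
  have h : σ ∈ (⊤ : Submonoid (Equiv.Perm (Fin (k + 1)))) := trivial
  rw [← Equiv.Perm.mclosure_swap_castSucc_succ k] at h
  refine Submonoid.closure_mono ?_ h
  rintro _ ⟨i, rfl⟩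
  refine ⟨⟨i, i + 1, by omega, by omega, by omega⟩, ?_⟩
  ext j
  rw [Itv.rev_val, Equiv.swap_apply_def]
  simp only [Fin.ext_iff, Fin.val_castSucc, Fin.val_succ]
  split_ifs <;> first | omega | (simp only [Fin.val_castSucc, Fin.val_succ]; omega)

/-- The tower is connected. -/
lemma exists_cover_pt_eq (s : Stratum) : ∃ x : Cover, x.pt = s := by
  -- With `1 ≤ n` there are at least four leaves, as required by `mem_closure_rev`.
  obtain ⟨n, hn⟩ : ∃ n, 1 ≤ n ∧ (rep s).depth ≤ n + 1 := ⟨(rep s).depth + 1, by omega⟩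
  obtain ⟨σ, hσ⟩ := exists_adjacent hn.2
  have key : ∀ τ : Equiv.Perm (Fin (2 ^ (n + 1))),
      Nonempty (FreeGroupoid.mk (cell n τ) ⟶ FreeGroupoid.mk (cell n (τ * σ))) := by
    have h3 : 3 ≤ 2 ^ (n + 1) := by
      have : 2 ^ 2 ≤ 2 ^ (n + 1) := Nat.pow_le_pow_right (by norm_num) (by omega)
      omega
    have hmem := mem_closure_rev h3 σ
    clear hσ
    induction hmem using Submonoid.closure_induction with
    | mem _ h =>
      obtain ⟨T, rfl⟩ := h
      exact fun τ => ⟨cross n τ T⟩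
    | one => exact fun τ => by rw [mul_one]; exact ⟨𝟙 _⟩
    | mul ρ ρ' _ _ h h' =>
      intro τ
      obtain ⟨γ⟩ := h τ
      obtain ⟨δ⟩ := h' (τ * ρ)
      rw [← mul_assoc]
      exact ⟨γ ≫ δ⟩
  obtain ⟨γ⟩ := key 1
  rw [one_mul] at γ
  exact ⟨⟨s, FreeGroupoid.homMk (homOfLE (base_le n)) ≫ γ ≫
    Groupoid.inv (FreeGroupoid.homMk (homOfLE hσ.le))⟩, rfl⟩

/-! ### Equivariance of the parity under lifts -/

/-- The parity of the path defining a point of the universal cover. -/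
noncomputable def coverParity (x : Cover) : ZMod 2 := pathParity x.path

lemma coverParity_of_le {x y : Cover} (h : x ≤ y) :
    coverParity y = coverParity x + descParity (rep x.pt) (rep y.pt) := by
  obtain ⟨h, e⟩ := h
  rw [coverParity, e, pathParity_comp, pathParity_homMk, coverParity]

lemma coverParity_deckIso (p : PureQBraid) (x : Cover) :
    coverParity (deckIso p x) = pathParity p + coverParity x := pathParity_comp p x.path

lemma descParity_rep {x y : LTree} (h : x ≤ y) :
    descParity (rep (stratum x)) (rep (stratum y)) = repParity x + descParity x y + repParity y := by
  rw [← pathParity_homMk (homOfLE (stratum_le h))]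
  exact pathParity_homMk_stratum h _

lemma descParity_eq_desc_labels {x y : LTree} (h : ∀ u ∈ x.labels, u ∈ y.labels) :
    descParity x y = desc y.labels x.labels := desc_deepen _ h x.disj y.disj

lemma desc_map {α β : Type*} [DecidableEq α] [DecidableEq β] {f : α → β} {L M : List α}
    (hLM : ∀ u ∈ L, u ∈ M) (hL : L.Nodup) (hM : (M.map f).Nodup) :
    desc (M.map f) (L.map f) = desc M L := by
  rw [List.map_eq_flatMap, List.map_eq_flatMap]
  rw [List.map_eq_flatMap] at hM
  exact desc_flatMap hLM hL hM fun _ _ => by simp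

/-- When the labels of `x` occur among those of `y`, descents depend only on relative positions in
the two lists, which an injective relabelling does not change. -/
lemma descParity_relabel {g : Equiv.Perm Bdry} {x y : LTree} (hx : Regular g x) (hy : Regular g y)
    (h : ∀ u ∈ x.labels, u ∈ y.labels) :
    descParity (relabel g x hx) (relabel g y hy) = descParity x y := by
  rw [descParity_eq_desc_labels, descParity_eq_desc_labels h]
  · exact desc_map h (DisjCones.nodup x.disj) (DisjCones.nodup (relabel g y hy).disj)
  · intro u hu
    obtain ⟨v, hv, rfl⟩ := List.mem_map.1 hu
    exact List.mem_map_of_mem (h v hv)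

/-- The labels of the tree are the words of length `n`. -/
def IsFull (n : ℕ) (x : LTree) : Prop := ∀ u, u ∈ x.labels ↔ u.length = n

lemma LTree.exists_isFull (x : LTree) {n : ℕ} (h : x.depth ≤ n) :
    ∃ y, IsFull n y ∧ stratum y = stratum x ∧ y.labels = x.words n := by
  obtain ⟨y, h1, h2⟩ := x.exists_expand h
  exact ⟨y, fun u => by rw [h2, x.mem_words h], (stratum_eq h1).symm, h2⟩

lemma exists_forall_mapsCone (g : neretin) :
    ∃ n₀, ∀ u : List Bool, n₀ ≤ u.length → ∃ v, MapsCone g u v := by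
  obtain ⟨n, hn⟩ := g.2
  refine ⟨n, fun u hu => ?_⟩
  obtain ⟨v, hv⟩ := hn (u.take n) (by simpa using hu)
  obtain ⟨w, -, hw⟩ := hv.extend (u.drop n)
  rw [List.take_append_drop] at hw
  exact ⟨_, hw⟩

lemma exists_regular_isFull (g : neretin) (s : Stratum) :
    ∃ n₀, ∀ n ≥ n₀, ∃ x, IsFull n x ∧ stratum x = s ∧ Regular g x := by
  obtain ⟨n₁, h₁⟩ := exists_forall_mapsCone g
  refine ⟨max n₁ (rep s).depth, fun n hn => ?_⟩
  obtain ⟨x, hx, hs, -⟩ := (rep s).exists_isFull (n := n) (by omega)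
  exact ⟨x, hx, hs.trans (stratum_rep s), fun u hu => h₁ u (by rw [(hx u).1 hu]; omega)⟩

/-- The change of the correction term of a tree under `g`. -/
noncomputable def twist (g : neretin) (x : LTree) (hx : Regular g x) : ZMod 2 :=
  repParity x + repParity (relabel g x hx)

lemma act_stratum (g : neretin) (x : LTree) (hx : Regular g x) :
    act g (stratum x) = stratum (relabel g x hx) := actFun_mk g x hx

/-- For trees with all leaves at the same depth the parity of descents is invariant under
relabelling, so an incidence and its image differ only by the corrections relating the trees to the
chosen representatives. -/
lemma coverParity_liftAct_of_le (f : liftGroup) {x y : Cover} (h : x ≤ y) {n : ℕ} {X Y : LTree}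
    (hX : IsFull n X) (hY : IsFull n Y) (eX : stratum X = x.pt) (eY : stratum Y = y.pt)
    (rX : Regular (proj f) X) (rY : Regular (proj f) Y) :
    coverParity (liftAct f x) + coverParity (liftAct f y) =
      coverParity x + coverParity y + twist (proj f) X rX + twist (proj f) Y rY := by
  have h' : liftAct f x ≤ liftAct f y := f.1.2.monotone h
  rw [coverParity_of_le h, coverParity_of_le h']
  have h1 : X ≤ Y := le_of_stratum_le (by rw [eX, eY]; exact h.1)
  have h2 : relabel (proj f) X rX ≤ relabel (proj f) Y rY := relabel_mono h1 rX rY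
  rw [liftAct_pt, liftAct_pt, ← eX, ← eY, act_stratum _ _ rX, act_stratum _ _ rY, descParity_rep h1,
    descParity_rep h2, descParity_relabel rX rY fun u hu => (hY u).2 ((hX u).1 hu), twist, twist]
  have e2 : (2 : ZMod 2) = 0 := rfl
  linear_combination (coverParity (liftAct f x) - coverParity x - repParity X - repParity Y) * e2

lemma coverParity_liftAct_base (f : liftGroup) (x : Cover) : ∃ n₀, ∀ n ≥ n₀, ∀ X Y : LTree,
    IsFull n X → IsFull n Y → stratum X = coverBase.pt → stratum Y = x.pt →
    ∀ (rX : Regular (proj f) X) (rY : Regular (proj f) Y),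
    coverParity (liftAct f coverBase) + coverParity (liftAct f x) =
      coverParity coverBase + coverParity x + twist (proj f) X rX + twist (proj f) Y rY := by
  induction x using cover_induction with
  | h₀ =>
    exact ⟨0, fun n _ X Y hX hY eX eY rX rY =>
      coverParity_liftAct_of_le f le_rfl hX hY eX eY rX rY⟩
  | h x y hxy =>
    have e2 : (2 : ZMod 2) = 0 := rfl
    constructor
    · rintro ⟨n₁, h₁⟩
      -- The intermediate stratum needs a tree of depth `n` on which the element acts, whence the
      -- restriction to large `n`; its twist occurs twice and cancels.
      obtain ⟨n₂, h₂⟩ := exists_regular_isFull (proj f) x.pt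
      refine ⟨max n₁ n₂, fun n hn X Y hX hY eX eY rX rY => ?_⟩
      obtain ⟨Z, hZ, eZ, rZ⟩ := h₂ n (by omega)
      have h3 := h₁ n (by omega) X Z hX hZ eX eZ rX rZ
      have h4 := coverParity_liftAct_of_le f hxy hZ hY eZ eY rZ rY
      linear_combination h3 + h4 + (coverParity x + twist (proj f) Z rZ - coverParity (liftAct f x)) * e2
    · rintro ⟨n₁, h₁⟩
      obtain ⟨n₂, h₂⟩ := exists_regular_isFull (proj f) y.pt
      refine ⟨max n₁ n₂, fun n hn X Y hX hY eX eY rX rY => ?_⟩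
      obtain ⟨Z, hZ, eZ, rZ⟩ := h₂ n (by omega)
      have h3 := h₁ n (by omega) X Z hX hZ eX eZ rX rZ
      have h4 := coverParity_liftAct_of_le f hxy hY hZ eY eZ rY rZ
      linear_combination h3 + h4 + (coverParity y + twist (proj f) Z rZ - coverParity (liftAct f y)) * e2

/-- The parity of paths is equivariant up to a coboundary. -/
lemma coverParity_liftAct (f : liftGroup) (x y : Cover) : ∃ n₀, ∀ n ≥ n₀, ∀ X Y : LTree,
    IsFull n X → IsFull n Y → stratum X = x.pt → stratum Y = y.pt →
    ∀ (rX : Regular (proj f) X) (rY : Regular (proj f) Y),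
    coverParity (liftAct f x) + coverParity (liftAct f y) =
      coverParity x + coverParity y + twist (proj f) X rX + twist (proj f) Y rY := by
  obtain ⟨n₁, h₁⟩ := coverParity_liftAct_base f x
  obtain ⟨n₂, h₂⟩ := coverParity_liftAct_base f y
  obtain ⟨n₃, h₃⟩ := exists_regular_isFull (proj f) coverBase.pt
  refine ⟨max n₁ (max n₂ n₃), fun n hn X Y hX hY eX eY rX rY => ?_⟩
  obtain ⟨Z, hZ, eZ, rZ⟩ := h₃ n (by omega)
  have h4 := h₁ n (by omega) Z X hZ hX eZ eX rZ rX
  have h5 := h₂ n (by omega) Z Y hZ hY eZ eY rZ rY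
  have e2 : (2 : ZMod 2) = 0 := rfl
  linear_combination h4 + h5 +
    (coverParity coverBase + twist (proj f) Z rZ - coverParity (liftAct f coverBase)) * e2

/-- The base cell and its translate by `p` lie over the same stratum, so the same tree serves for
both and its two twists cancel. -/
lemma pathParity_conj {f : liftGroup} {p q : PureQBraid} (h : f * deck p * f⁻¹ = deck q) :
    pathParity q = pathParity p := by
  obtain ⟨n₁, h₁⟩ := coverParity_liftAct f (deckIso p coverBase) coverBase
  obtain ⟨n₂, h₂⟩ := exists_regular_isFull (proj f) coverBase.pt
  obtain ⟨Z, hZ, eZ, rZ⟩ := h₂ (max n₁ n₂) (by omega)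
  have h3 := h₁ (max n₁ n₂) (by omega) Z Z hZ hZ eZ eZ rZ rZ
  have h4 : liftAct f (deckIso p coverBase) = deckIso q (liftAct f coverBase) := by
    rw [← liftAct_deck, ← liftAct_deck, ← liftAct_mul, ← liftAct_mul, ← h]
    simp
  rw [h4, coverParity_deckIso, coverParity_deckIso] at h3
  have e2 : (2 : ZMod 2) = 0 := rfl
  linear_combination h3 + (coverParity coverBase + twist (proj f) Z rZ - coverParity (liftAct f coverBase)) * e2

lemma proj_deck (p : PureQBraid) : proj (deck p) = 1 := rfl

lemma exists_deck_conj (f : liftGroup) (p : PureQBraid) :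
    ∃ q, deck q = f * deck p * f⁻¹ ∧ stableLength q = stableLength p := by
  have h : f * deck p * f⁻¹ ∈ deck.range := by
    rw [deck_range, MonoidHom.mem_ker, map_mul, map_mul, proj_deck, map_inv, mul_one, mul_inv_cancel]
  obtain ⟨q, hq⟩ := h
  exact ⟨q, hq, congrArg Multiplicative.ofAdd (pathParity_conj hq.symm)⟩

lemma normal_map_ker : (stableLength.ker.map deck).Normal := by
  constructor
  rintro _ ⟨p, hp, rfl⟩ f
  obtain ⟨q, hq, h⟩ := exists_deck_conj f p
  exact ⟨q, h.trans hp, hq⟩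

/-! ### Twists, exchanges of subtrees and local automorphisms -/

/-- A vertex whose subtree is translated by `g`. -/
def Rigid (g : Equiv.Perm Bdry) (u v : List Bool) : Prop := ∀ x : Bdry, g (u ++ₛ x) = v ++ₛ x

lemma Rigid.append {g : Equiv.Perm Bdry} {u v : List Bool} (h : Rigid g u v) (w : List Bool) :
    Rigid g (u ++ w) (v ++ w) := fun x => by
  rw [Stream'.append_append_stream, h, Stream'.append_append_stream]

lemma Rigid.mapsCone {g : Equiv.Perm Bdry} {u v : List Bool} (h : Rigid g u v) :
    MapsCone g u v := ⟨1, isTreeAut_one, h⟩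

lemma Rigid.mul {g h : Equiv.Perm Bdry} {u v w : List Bool} (hg : Rigid g v w) (hh : Rigid h u v) :
    Rigid (g * h) u w := fun x => by rw [Equiv.Perm.mul_apply, hh, hg]

lemma map_vmap_deepen {g : Equiv.Perm Bdry} {n : ℕ} {L : List (List Bool)} {φ : List Bool → List Bool}
    (h : ∀ u ∈ L, Rigid g u (φ u) ∧ (φ u).length = u.length) :
    (deepen n L).map (vmap g) = deepen n (L.map φ) := by
  rw [deepen, deepen, List.map_flatMap, List.flatMap_map]
  refine List.flatMap_congr fun u hu => ?_
  obtain ⟨h1, h2⟩ := h u hu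
  rw [descendants, descendants, h2, List.map_map]
  exact List.map_congr_left fun w _ => (h1.append w).mapsCone.vmap_eq

/-- Over a fixed stratum both corrections refer to the same representative, which drops out by
additivity. The twist becomes computable. -/
lemma twist_of_act_eq {g : neretin} {x : LTree} (hx : Regular g x)
    (h : act g (stratum x) = stratum x) :
    twist g x hx = descParity x (relabel g x hx) := by
  rw [act_stratum g x hx] at h
  rw [twist, repParity, repParity, h]
  have h1 : x ≤ relabel g x hx := le_of_stratum_le h.ge
  have h2 : relabel g x hx ≤ rep (stratum x) := le_of_stratum_le (by rw [h, stratum_rep])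
  have := descParity_add h1 h2
  rw [this, add_assoc, CharTwo.add_self_eq_zero, add_zero]

/-- The twist at a stratum fixed by an element which permutes the leaves of some tree
representing the stratum. -/
lemma twist_eq_desc {g : neretin} {x : LTree} {φ : List Bool → List Bool}
    (h : ∀ u ∈ x.labels, Rigid g u (φ u) ∧ (φ u).length = u.length)
    (hφ : (x.labels.map φ).Perm x.labels) (hfix : act g (stratum x) = stratum x) {n : ℕ}
    (hn : x.depth ≤ n) : ∃ X, ∃ rX : Regular g X, IsFull n X ∧ stratum X = stratum x ∧
      twist g X rX = desc (x.labels.map φ) x.labels := by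
  obtain ⟨X, hX, eX, hl⟩ := x.exists_isFull hn
  have rX : Regular g X := by
    intro u hu
    rw [hl] at hu
    obtain ⟨v, hv, hu⟩ := List.mem_flatMap.1 hu
    obtain ⟨w, -, rfl⟩ := List.mem_map.1 hu
    exact ⟨_, ((h v hv).1.append w).mapsCone⟩
  refine ⟨X, rX, hX, eX, ?_⟩
  rw [twist_of_act_eq rX (by rw [eX, hfix])]
  have e : (relabel g X rX).labels = deepen n (x.labels.map φ) := by
    change X.labels.map (vmap g) = _
    rw [hl, LTree.words, map_vmap_deepen h]
  have hmem : ∀ u ∈ x.labels, u ∈ x.labels.map φ := fun u hu => hφ.symm.subset hu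
  rw [descParity_eq_desc_labels, e, hl, LTree.words,
    desc_deepen n hmem x.disj (DisjCones.perm x.disj hφ.symm)]
  rw [e, hl]
  intro u hu
  obtain ⟨v, hv, hu⟩ := List.mem_flatMap.1 hu
  exact List.mem_flatMap.2 ⟨v, hmem v hv, hu⟩

lemma act_stratum_eq_self {g : neretin} {x : LTree} (h : ∀ u ∈ x.labels, MapsCone g u u) :
    act g (stratum x) = stratum x := by
  have hx : Regular g x := fun u hu => ⟨u, h u hu⟩
  rw [act_stratum g x hx]
  congr 1
  ext1
  · exact (List.map_congr_left fun u hu => (h u hu).vmap_eq).trans (List.map_id _)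
  · have key : ∀ A ∈ x.verts, g.1 '' A = A := by
      intro A hA
      obtain ⟨l, b, r, hl, -, -, rfl⟩ := x.block A hA
      have hb : ∀ u ∈ b, MapsCone g u u := fun u hu => h u (by simp [hl, hu])
      rw [← region_map fun u hu => ⟨u, hb u hu⟩]
      congr 1
      exact (List.map_congr_left fun u hu => (hb u hu).vmap_eq).trans (List.map_id _)
    change (fun A => g.1 '' A) '' x.verts = x.verts
    rw [Set.image_congr key, Set.image_id']

lemma mem_cone_append (u : List Bool) (x : Bdry) : u ++ₛ x ∈ cone u := ⟨x, rfl⟩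

/-- The exchange of the subtrees below two vertices. -/
def coneSwap (u v : List Bool) (h : ¬ u <+: v ∧ ¬ v <+: u) : Equiv.Perm Bdry :=
  Function.Involutive.toPerm
    (fun x => if x.take u.length = u then v ++ₛ x.drop u.length
      else if x.take v.length = v then u ++ₛ x.drop v.length else x) (by
    have hd := Set.disjoint_left.1 (disjoint_cone h.1 h.2)
    intro x
    by_cases hu : x.take u.length = u
    · have hv : (v ++ₛ x.drop u.length).take u.length ≠ u := fun h' =>
        hd (mem_cone_iff.2 h') (mem_cone_append _ _)
      have e := append_take_drop x u.length
      rw [hu] at e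
      simp only [if_pos hu, if_neg hv, if_pos (take_append v _), Stream'.drop_append_stream]
      exact e
    · by_cases hv : x.take v.length = v
      · have e := append_take_drop x v.length
        rw [hv] at e
        simp only [if_neg hu, if_pos hv, if_pos (take_append u _), Stream'.drop_append_stream]
        exact e
      · simp only [if_neg hu, if_neg hv])

lemma coneSwap_apply (u v : List Bool) (h : ¬ u <+: v ∧ ¬ v <+: u) (x : Bdry) :
    coneSwap u v h x = if x.take u.length = u then v ++ₛ x.drop u.length
      else if x.take v.length = v then u ++ₛ x.drop v.length else x := rfl

/-- The action of `coneSwap` on the long words. -/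
def wordSwap (u v w : List Bool) : List Bool :=
  if u <+: w then v ++ w.drop u.length else if v <+: w then u ++ w.drop v.length else w

lemma rigid_coneSwap_left {u v : List Bool} (h : ¬ u <+: v ∧ ¬ v <+: u) :
    Rigid (coneSwap u v h) u v := by
  intro x
  rw [coneSwap_apply, if_pos (take_append u x), Stream'.drop_append_stream]

lemma rigid_coneSwap_right {u v : List Bool} (h : ¬ u <+: v ∧ ¬ v <+: u) :
    Rigid (coneSwap u v h) v u := by
  intro x
  have hu : (v ++ₛ x).take u.length ≠ u := fun h' =>
    Set.disjoint_left.1 (disjoint_cone h.1 h.2) (mem_cone_iff.2 h') (mem_cone_append _ _)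
  rw [coneSwap_apply, if_neg hu, if_pos (take_append v x), Stream'.drop_append_stream]

lemma rigid_coneSwap_of_not_prefix {u v w : List Bool} (h : ¬ u <+: v ∧ ¬ v <+: u)
    (h1 : ¬ u <+: w) (h2 : ¬ w <+: u) (h3 : ¬ v <+: w) (h4 : ¬ w <+: v) :
    Rigid (coneSwap u v h) w w := by
  intro x
  have hu : (w ++ₛ x).take u.length ≠ u := fun h' =>
    Set.disjoint_left.1 (disjoint_cone h1 h2) (mem_cone_iff.2 h') (mem_cone_append _ _)
  have hv : (w ++ₛ x).take v.length ≠ v := fun h' =>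
    Set.disjoint_left.1 (disjoint_cone h3 h4) (mem_cone_iff.2 h') (mem_cone_append _ _)
  rw [coneSwap_apply, if_neg hu, if_neg hv]

lemma rigid_coneSwap {u v w : List Bool} (h : ¬ u <+: v ∧ ¬ v <+: u) (hu : w <+: u → w = u)
    (hv : w <+: v → w = v) : Rigid (coneSwap u v h) w (wordSwap u v w) := by
  rw [wordSwap]
  split_ifs with h1 h2
  · obtain ⟨b, rfl⟩ := h1
    rw [List.drop_left]
    exact (rigid_coneSwap_left h).append b
  · obtain ⟨b, rfl⟩ := h2
    rw [List.drop_left]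
    exact (rigid_coneSwap_right h).append b
  · exact rigid_coneSwap_of_not_prefix h h1 (fun h' => h1 (hu h' ▸ List.prefix_rfl)) h2
      (fun h' => h2 (hv h' ▸ List.prefix_rfl))

lemma length_wordSwap {u v : List Bool} (h : u.length = v.length) (w : List Bool) :
    (wordSwap u v w).length = w.length := by
  rw [wordSwap]
  split_ifs with h1 h2
  · have := h1.length_le
    rw [List.length_append, List.length_drop]; omega
  · have := h2.length_le
    rw [List.length_append, List.length_drop]; omega
  · rfl

lemma coneSwap_mem_neretin {u v : List Bool} (h : ¬ u <+: v ∧ ¬ v <+: u) :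
    coneSwap u v h ∈ neretin :=
  ⟨max u.length v.length, fun w hw => ⟨_, (rigid_coneSwap h (fun h' => h'.eq_of_length_le (by omega))
    fun h' => h'.eq_of_length_le (by omega)).mapsCone⟩⟩

/-- The exchange of the subtrees below two vertices, in Neretin's group. -/
def vertexSwap (u v : List Bool) (h : ¬ u <+: v ∧ ¬ v <+: u) : neretin :=
  ⟨coneSwap u v h, coneSwap_mem_neretin h⟩

lemma rigid_vertexSwap {u v w w' : List Bool} {h : ¬ u <+: v ∧ ¬ v <+: u} (hu : w <+: u → w = u)
    (hv : w <+: v → w = v) (e : wordSwap u v w = w') : Rigid (vertexSwap u v h).1 w w' :=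
  e ▸ rigid_coneSwap h hu hv

lemma isTreeAut_coneSwap : IsTreeAut (coneSwap [false] [true] (by decide)) := by
  have h : ∀ (e : Bool) (x : Bdry), coneSwap [false] [true] (by decide) (Stream'.cons e x) = Stream'.cons (!e) x := by
    rintro (_ | _) x
    · exact rigid_coneSwap_left _ x
    · exact rigid_coneSwap_right _ x
  intro x y k
  obtain ⟨a, x, rfl⟩ : ∃ a x', x = Stream'.cons a x' := ⟨_, _, (Stream'.eta x).symm⟩
  obtain ⟨b, y, rfl⟩ : ∃ a x', y = Stream'.cons a x' := ⟨_, _, (Stream'.eta y).symm⟩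
  rw [h, h]
  cases k with
  | zero => simp
  | succ k => simp [Stream'.take_succ_cons]

/-- Exchanging two brothers is a tree automorphism below their father, so it fixes the stratum of
any tree having the father as a leaf. -/
lemma mapsCone_coneSwap (u : List Bool) (h : ¬ u ++ [false] <+: u ++ [true] ∧ ¬ u ++ [true] <+: u ++ [false]) :
    MapsCone (coneSwap (u ++ [false]) (u ++ [true]) h) u u := by
  refine ⟨_, isTreeAut_coneSwap, fun x => ?_⟩
  obtain ⟨a, x, rfl⟩ : ∃ a x', x = Stream'.cons a x' := ⟨_, _, (Stream'.eta x).symm⟩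
  cases a
  · have h1 := rigid_coneSwap_left h x
    have h2 := rigid_coneSwap_left (u := [false]) (v := [true]) (by decide) x
    rw [Stream'.append_append_stream, Stream'.append_append_stream] at h1
    exact h1.trans (congrArg (u ++ₛ ·) h2.symm)
  · have h1 := rigid_coneSwap_right h x
    have h2 := rigid_coneSwap_right (u := [false]) (v := [true]) (by decide) x
    rw [Stream'.append_append_stream, Stream'.append_append_stream] at h1
    exact h1.trans (congrArg (u ++ₛ ·) h2.symm)

/-- The action of `q` on the boundary points below the vertex `u`. -/
def localAct (u : List Bool) (q : Equiv.Perm Bdry) : Equiv.Perm Bdry where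
  toFun x := if x.take u.length = u then u ++ₛ q (x.drop u.length) else x
  invFun x := if x.take u.length = u then u ++ₛ q.symm (x.drop u.length) else x
  left_inv x := by
    by_cases hu : x.take u.length = u
    · have e := append_take_drop x u.length
      rw [hu] at e
      simp only [if_pos hu, if_pos (take_append u _), Stream'.drop_append_stream,
        Equiv.symm_apply_apply, e]
    · simp only [if_neg hu]
  right_inv x := by
    by_cases hu : x.take u.length = u
    · have e := append_take_drop x u.length
      rw [hu] at e
      simp only [if_pos hu, if_pos (take_append u _), Stream'.drop_append_stream,
        Equiv.apply_symm_apply, e]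
    · simp only [if_neg hu]

lemma localAct_append (u : List Bool) (q : Equiv.Perm Bdry) (x : Bdry) :
    localAct u q (u ++ₛ x) = u ++ₛ q x := by
  change (if _ then _ else _) = _
  rw [if_pos (take_append u x), Stream'.drop_append_stream]

lemma rigid_localAct {u w : List Bool} (q : Equiv.Perm Bdry) (h : ¬ u <+: w) (h' : ¬ w <+: u) :
    Rigid (localAct u q) w w := by
  intro x
  have hu : (w ++ₛ x).take u.length ≠ u := fun e =>
    Set.disjoint_left.1 (disjoint_cone h h') (mem_cone_iff.2 e) (mem_cone_append _ _)
  change (if _ then _ else _) = _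
  rw [if_neg hu]

lemma mapsCone_localAct (u : List Bool) {q : Equiv.Perm Bdry} (hq : IsTreeAut q) :
    MapsCone (localAct u q) u u := ⟨q, hq, localAct_append u q⟩

lemma localAct_mem_neretin (u : List Bool) {q : Equiv.Perm Bdry} (hq : IsTreeAut q) :
    localAct u q ∈ neretin := by
  refine ⟨u.length, fun w hw => ⟨w, ?_⟩⟩
  by_cases h : w = u
  · rw [h]; exact mapsCone_localAct u hq
  · refine (rigid_localAct q (fun h' => h ?_) (fun h' => h ?_)).mapsCone
    · exact (h'.eq_of_length hw.symm).symm
    · exact h'.eq_of_length hw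

/-! ### The self-similar automorphism -/

section FlipAfter

/-- `n` is the position of the first `false`. -/
def IsFirstFalse (n : ℕ) (x : Bdry) : Prop := x.get n = false ∧ ∀ i < n, x.get i = true

open Classical in
/-- The change of the letter which follows the first `false`. -/
noncomputable def flipAfterFun (x : Bdry) : Bdry
  | 0 => x.get 0
  | n + 1 => if IsFirstFalse n x then !x.get (n + 1) else x.get (n + 1)

lemma get_succ_flipAfterFun (x : Bdry) (n : ℕ) [Decidable (IsFirstFalse n x)] :
    (flipAfterFun x).get (n + 1) = if IsFirstFalse n x then !x.get (n + 1) else x.get (n + 1) := by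
  by_cases h : IsFirstFalse n x
  · exact (if_pos h).trans (if_pos h).symm
  · exact (if_neg h).trans (if_neg h).symm

lemma isFirstFalse_congr {n : ℕ} {x y : Bdry} (h : ∀ i ≤ n, x.get i = y.get i) :
    IsFirstFalse n x ↔ IsFirstFalse n y := by
  rw [IsFirstFalse, IsFirstFalse, h n le_rfl]
  refine and_congr_right fun _ => forall₂_congr fun i hi => ?_
  rw [h i hi.le]

/-- The modified letter comes after the first `false`, so everything up to that position is
unchanged. -/
lemma isFirstFalse_flipAfterFun (n : ℕ) (x : Bdry) :
    IsFirstFalse n (flipAfterFun x) ↔ IsFirstFalse n x := by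
  classical
  constructor
  · intro h
    have key : ∀ i ≤ n, (flipAfterFun x).get i = x.get i := by
      intro i
      induction i with
      | zero => exact fun _ => rfl
      | succ j ih =>
        intro hj
        rw [get_succ_flipAfterFun, if_neg]
        intro h'
        have := h.2 j (by omega)
        rw [ih (by omega), h'.1] at this
        cases this
    exact (isFirstFalse_congr key).1 h
  · intro h
    have key : ∀ i ≤ n, (flipAfterFun x).get i = x.get i := by
      rintro (_ | j) hj
      · rfl
      · rw [get_succ_flipAfterFun, if_neg]
        intro h'
        have := h.2 j (by omega)
        rw [h'.1] at this
        cases this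
    exact (isFirstFalse_congr key).2 h

lemma flipAfterFun_involutive : Function.Involutive flipAfterFun := by
  classical
  intro x
  ext n
  cases n with
  | zero => rfl
  | succ n =>
    rw [get_succ_flipAfterFun, get_succ_flipAfterFun]
    simp only [isFirstFalse_flipAfterFun]
    split_ifs <;> simp

/-- The change of the letter which follows the first `false`, as a permutation. -/
noncomputable def flipAfter : Equiv.Perm Bdry := flipAfterFun_involutive.toPerm

lemma flipAfter_apply (x : Bdry) : flipAfter x = flipAfterFun x := rfl

lemma take_eq_take_iff {x y : Bdry} {k : ℕ} :
    x.take k = y.take k ↔ ∀ i < k, x.get i = y.get i := by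
  induction k generalizing x y with
  | zero => simp
  | succ k ih =>
    rw [Stream'.take_succ, Stream'.take_succ, List.cons.injEq, ih]
    constructor
    · rintro ⟨h0, h⟩ (_ | i) hi
      · exact h0
      · exact h i (by omega)
    · exact fun h => ⟨h 0 (by omega), fun i hi => h (i + 1) (by omega)⟩

lemma isTreeAut_flipAfter : IsTreeAut flipAfter := by
  classical
  have key : ∀ (x y : Bdry) (k : ℕ), x.take k = y.take k →
      (flipAfterFun x).take k = (flipAfterFun y).take k := by
    intro x y k h
    rw [take_eq_take_iff] at h ⊢
    rintro (_ | i) hi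
    · exact h 0 hi
    · rw [get_succ_flipAfterFun, get_succ_flipAfterFun, h (i + 1) hi]
      simp only [isFirstFalse_congr (n := i) (x := x) (y := y) fun j hj => h j (by omega)]
  intro x y k
  refine ⟨fun h => ?_, key x y k⟩
  have := key _ _ k h
  rwa [flipAfter_apply, flipAfter_apply, flipAfterFun_involutive, flipAfterFun_involutive] at this

lemma flipAfter_false (e : Bool) (x : Bdry) :
    flipAfter ([false, e] ++ₛ x) = [false, !e] ++ₛ x := by
  classical
  rw [flipAfter_apply]
  ext n
  rcases n with _ | _ | n
  · rfl
  · rw [get_succ_flipAfterFun, if_pos]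
    · rfl
    · exact ⟨rfl, fun i hi => by omega⟩
  · rw [get_succ_flipAfterFun, if_neg]
    · rfl
    · intro h
      have := h.2 0 (by omega)
      cases this

/-- Together with `flipAfter_false` this is the recursion behind the swindle: an exchange of
grandsons on the `false` side and a copy of itself on the `true` side. -/
lemma flipAfter_true (x : Bdry) : flipAfter ([true] ++ₛ x) = [true] ++ₛ flipAfter x := by
  classical
  rw [flipAfter_apply, flipAfter_apply]
  ext n
  rcases n with _ | _ | n
  · rfl
  · rw [get_succ_flipAfterFun, if_neg]
    · rfl
    · intro h
      have := h.1
      cases this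
  · have h : IsFirstFalse (n + 1) ([true] ++ₛ x) ↔ IsFirstFalse n x := by
      constructor
      · rintro ⟨h1, h2⟩
        exact ⟨h1, fun i hi => h2 (i + 1) (by omega)⟩
      · rintro ⟨h1, h2⟩
        refine ⟨h1, ?_⟩
        rintro (_ | i) hi
        · rfl
        · exact h2 i (by omega)
    rw [get_succ_flipAfterFun]
    change _ = (flipAfterFun x).get (n + 1)
    rw [get_succ_flipAfterFun]
    simp only [h]
    rfl

end FlipAfter

/-! ### Explicit elements of Neretin's group and their relations -/

lemma LTree.perm_ext (x : LTree) {g h : Equiv.Perm Bdry}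
    (H : ∀ u ∈ x.labels, ∀ y : Bdry, g (u ++ₛ y) = h (u ++ₛ y)) : g = h := by
  ext1 z
  obtain ⟨u, hu, y, rfl⟩ := x.cover z
  exact H u hu y

lemma LTree.exists_grow (x : LTree) {l r : List (List Bool)} {u : List Bool}
    (h : x.labels = l ++ u :: r) : ∃ y : LTree, stratum y = stratum x ∧
      y.labels = l ++ (u ++ [false]) :: (u ++ [true]) :: r ∧ y.verts = insert (cone u) x.verts :=
  ⟨x.grow l u r false h, (stratum_eq (.single (x.expand_grow _ h))).symm, rfl, rfl⟩

/-- The star with the leaves of `x`. -/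
def LTree.star (x : LTree) : LTree where
  __ := x
  verts := ∅
  block := fun _ h => h.elim
  nested := fun _ h => h.elim

lemma LTree.le_star (x : LTree) : x ≤ x.star :=
  (Step.contract (x := x) (y := x.star) rfl (Set.empty_subset _)).le

/-- Three trees labelling the base point. -/
lemma exists_base_trees : ∃ x y z : LTree,
    (stratum x = base ∧ x.labels = [[false, false], [false, true], [true]] ∧
      cone [false] ∈ x.verts) ∧
    (stratum y = base ∧
      y.labels = [[false, false, false], [false, false, true], [false, true], [true]]) ∧
    (stratum z = base ∧ z.labels = [[false, false, false, false], [false, false, false, true],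
      [false, false, true, false], [false, false, true, true], [false, true], [true]]) := by
  obtain ⟨x, h1, h2, h3⟩ := (topTree 0 1).exists_grow (l := []) (u := [false]) (r := [[true]])
    (permLabels_one 1)
  obtain ⟨y, h4, h5, -⟩ := x.exists_grow (l := []) (u := [false, false])
    (r := [[false, true], [true]]) h2
  obtain ⟨w, h6, h7, -⟩ := y.exists_grow (l := []) (u := [false, false, false])
    (r := [[false, false, true], [false, true], [true]]) h5
  obtain ⟨z, h8, h9, -⟩ := w.exists_grow (u := [false, false, true])
    (l := [[false, false, false, false], [false, false, false, true]])
    (r := [[false, true], [true]]) h7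
  refine ⟨x, y, z, ⟨h1, h2, ?_⟩, ⟨h4.trans h1, h5⟩, (h8.trans h6).trans (h4.trans h1), h9⟩
  rw [h3]
  exact Set.mem_insert _ _

/-- The translation of `00`, `01`, `1` to `10`, `0`, `11`. -/
def shift : neretin :=
  vertexSwap [false] [true, true] (by decide) * vertexSwap [false] [true] (by decide)

lemma rigid_shift₁ : Rigid shift.1 [false, false] [true, false] :=
  Rigid.mul (v := [true, false]) (rigid_vertexSwap (by decide) (by decide) rfl)
    (rigid_vertexSwap (by decide) (by decide) rfl)

lemma rigid_shift₂ : Rigid shift.1 [false, true] [false] :=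
  Rigid.mul (v := [true, true]) (rigid_vertexSwap (by decide) (by decide) rfl)
    (rigid_vertexSwap (by decide) (by decide) rfl)

lemma rigid_shift₃ : Rigid shift.1 [true] [true, true] :=
  Rigid.mul (v := [false]) (rigid_vertexSwap (by decide) (by decide) rfl)
    (rigid_vertexSwap (by decide) (by decide) rfl)

/-- The automorphism `flipAfter` below the vertex `01`. -/
noncomputable def smallFlip : neretin :=
  ⟨localAct [false, true] flipAfter, localAct_mem_neretin _ isTreeAut_flipAfter⟩

/-- The automorphism `flipAfter` below the vertex `0`. -/
noncomputable def bigFlip : neretin :=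
  ⟨localAct [false] flipAfter, localAct_mem_neretin _ isTreeAut_flipAfter⟩

/-- The exchange of the vertices `000` and `001`. -/
def swap : neretin := vertexSwap [false, false, false] [false, false, true] (by decide)

/-- The exchange of the vertices `0000` and `0001`. -/
def swapFirst : neretin :=
  vertexSwap [false, false, false, false] [false, false, false, true] (by decide)

/-- The exchange of the vertices `0001` and `0010`. -/
def swapMiddle : neretin :=
  vertexSwap [false, false, false, true] [false, false, true, false] (by decide)

/-- `shift` translates the subtree below 01 onto the one below 0, and so carries the local action at
the first vertex to the local action at the second. -/
lemma shift_mul_smallFlip : shift * smallFlip = bigFlip * shift := by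
  obtain ⟨x, -, -, ⟨-, hx, -⟩, -⟩ := exists_base_trees
  refine Subtype.ext (x.perm_ext fun u hu y => ?_)
  rw [hx] at hu
  change shift.1 (localAct _ _ _) = localAct _ _ (shift.1 _)
  simp only [List.mem_cons, List.not_mem_nil, or_false] at hu
  rcases hu with rfl | rfl | rfl
  · rw [rigid_localAct _ (by decide) (by decide), rigid_shift₁,
      rigid_localAct _ (by decide) (by decide)]
  · rw [localAct_append, rigid_shift₂, rigid_shift₂, localAct_append]
  · rw [rigid_localAct _ (by decide) (by decide), rigid_shift₃,
      rigid_localAct _ (by decide) (by decide)]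

lemma rigid_swap {w : List Bool} (h : w <+: [false, false, false] → w = [false, false, false])
    (h' : w <+: [false, false, true] → w = [false, false, true]) :
    Rigid swap.1 w (wordSwap [false, false, false] [false, false, true] w) :=
  rigid_vertexSwap h h' rfl

/-- Below 00 the automorphism `flipAfter` of the subtree at 0 exchanges 000 and 001; below 01 it
repeats itself. With `shift_mul_smallFlip` this makes `swap` the commutator of `shift` and
`smallFlip`. -/
lemma swap_mul_smallFlip : swap * smallFlip = bigFlip := by
  obtain ⟨-, x, -, -, ⟨-, hx⟩, -⟩ := exists_base_trees
  refine Subtype.ext (x.perm_ext fun u hu y => ?_)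
  rw [hx] at hu
  change swap.1 (localAct _ _ _) = localAct _ _ _
  have key : ∀ (e : Bool) (y : Bdry), localAct [false] flipAfter ([false, false, e] ++ₛ y) =
      [false, false, !e] ++ₛ y := fun e y => by
    have := localAct_append [false] flipAfter ([false, e] ++ₛ y)
    rw [flipAfter_false] at this
    exact this
  simp only [List.mem_cons, List.not_mem_nil, or_false] at hu
  rcases hu with rfl | rfl | rfl | rfl
  · rw [rigid_localAct _ (by decide) (by decide), key, rigid_swap (by decide) (by decide)]; rfl
  · rw [rigid_localAct _ (by decide) (by decide), key, rigid_swap (by decide) (by decide)]; rfl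
  · have := localAct_append [false] flipAfter ([true] ++ₛ y)
    rw [flipAfter_true] at this
    rw [localAct_append, rigid_swap (by decide) (by decide)]
    exact this.symm
  · rw [rigid_localAct _ (by decide) (by decide), rigid_localAct _ (by decide) (by decide),
      rigid_swap (by decide) (by decide)]
    rfl

lemma rigid_swapFirst {w : List Bool} (h : w.length = 4) : Rigid swapFirst.1 w
    (wordSwap [false, false, false, false] [false, false, false, true] w) :=
  rigid_vertexSwap (fun h' => h'.eq_of_length h) (fun h' => h'.eq_of_length h) rfl

lemma rigid_swapMiddle {w : List Bool}
    (h : w <+: [false, false, false, true] → w = [false, false, false, true])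
    (h' : w <+: [false, false, true, false] → w = [false, false, true, false]) :
    Rigid swapMiddle.1 w (wordSwap [false, false, false, true] [false, false, true, false] w) :=
  rigid_vertexSwap h h' rfl

/-- The commutator of `swapFirst` and `swap` exchanges 0000 with 0001 and 0010 with 0011;
conjugation by `swapMiddle` turns this into the exchange of 000 and 001. All factors permute the
sixteen words of length 4, so the identity is a finite check. -/
lemma swapMiddle_mul : swapMiddle * swapFirst * swap = swap * swapMiddle * swap * swapFirst := by
  have key : ∀ w ∈ dyadicWords 4,
      wordSwap [false, false, false, true] [false, false, true, false]
        (wordSwap [false, false, false, false] [false, false, false, true]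
          (wordSwap [false, false, false] [false, false, true] w)) =
      wordSwap [false, false, false] [false, false, true]
        (wordSwap [false, false, false, true] [false, false, true, false]
          (wordSwap [false, false, false] [false, false, true]
            (wordSwap [false, false, false, false] [false, false, false, true] w))) := by
    decide
  have h1 : ∀ {w : List Bool}, w.length = 4 →
      Rigid swap.1 w (wordSwap [false, false, false] [false, false, true] w) := fun h =>
    rigid_swap (fun h' => h'.eq_of_length_le (by rw [h]; decide))
      fun h' => h'.eq_of_length_le (by rw [h]; decide)
  have h2 : ∀ {w : List Bool}, w.length = 4 → Rigid swapMiddle.1 w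
      (wordSwap [false, false, false, true] [false, false, true, false] w) := fun h =>
    rigid_swapMiddle (fun h' => h'.eq_of_length h) fun h' => h'.eq_of_length h
  refine Subtype.ext ((topTree 3 1).perm_ext fun w hw y => ?_)
  replace hw : w ∈ dyadicWords 4 := permLabels_one 4 ▸ hw
  have hl : w.length = 4 := length_of_mem_dyadicWords hw
  change swapMiddle.1 (swapFirst.1 (swap.1 _)) = swap.1 (swapMiddle.1 (swap.1 (swapFirst.1 _)))
  have e1 : ∀ {w : List Bool}, w.length = 4 →
    (wordSwap [false, false, false] [false, false, true] w).length = 4 := fun h =>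
    (length_wordSwap (by rfl) _).trans h
  have e2 : ∀ {w : List Bool}, w.length = 4 →
    (wordSwap [false, false, false, false] [false, false, false, true] w).length = 4 := fun h =>
    (length_wordSwap (by rfl) _).trans h
  have e3 : ∀ {w : List Bool}, w.length = 4 →
    (wordSwap [false, false, false, true] [false, false, true, false] w).length = 4 := fun h =>
    (length_wordSwap (by rfl) _).trans h
  rw [h1 hl, rigid_swapFirst (e1 hl), h2 (e2 (e1 hl)), rigid_swapFirst hl, h1 (e2 hl),
    h2 (e1 (e2 hl)), h1 (e3 (e1 (e2 hl))), key w hw]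

/-! ### An odd deck transformation in the commutator subgroup -/

section

open scoped commutatorElement

lemma act_smallFlip_base : act smallFlip base = base := by
  obtain ⟨x, -, -, ⟨h, hx, -⟩, -⟩ := exists_base_trees
  rw [← h]
  refine act_stratum_eq_self fun u hu => ?_
  rw [hx] at hu
  simp only [List.mem_cons, List.not_mem_nil, or_false] at hu
  rcases hu with rfl | rfl | rfl
  · exact (rigid_localAct _ (by decide) (by decide)).mapsCone
  · exact mapsCone_localAct _ isTreeAut_flipAfter
  · exact (rigid_localAct _ (by decide) (by decide)).mapsCone

lemma act_swap_base : act swap base = base := by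
  obtain ⟨x, -, -, ⟨h, hx, -⟩, -⟩ := exists_base_trees
  rw [← h]
  refine act_stratum_eq_self fun u hu => ?_
  rw [hx] at hu
  simp only [List.mem_cons, List.not_mem_nil, or_false] at hu
  rcases hu with rfl | rfl | rfl
  · exact mapsCone_coneSwap [false, false] (by decide)
  · exact (rigid_swap (by decide) (by decide)).mapsCone
  · exact (rigid_swap (by decide) (by decide)).mapsCone

lemma act_swapFirst_base : act swapFirst base = base := by
  obtain ⟨-, x, -, -, ⟨h, hx⟩, -⟩ := exists_base_trees
  rw [← h]
  refine act_stratum_eq_self fun u hu => ?_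
  rw [hx] at hu
  simp only [List.mem_cons, List.not_mem_nil, or_false] at hu
  rcases hu with rfl | rfl | rfl | rfl
  · exact mapsCone_coneSwap [false, false, false] (by decide)
  all_goals exact (rigid_vertexSwap (by decide) (by decide) rfl).mapsCone

/-- A stratum fixed by `bigFlip` and adjacent to the base point and to its image under `shift`,
which is fixed by `bigFlip` too. -/
lemma exists_adjacent_stratum : ∃ s : Stratum, base ≤ s ∧ act shift base ≤ s ∧
    act bigFlip s = s ∧ act bigFlip (act shift base) = act shift base := by
  obtain ⟨x, -, -, ⟨h, hx, hx'⟩, -⟩ := exists_base_trees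
  obtain ⟨y, h1, h2, -⟩ := (topTree 0 1).exists_grow (l := [[false]]) (u := [true]) (r := [])
    (permLabels_one 1)
  replace h2 : y.labels = [[false], [true, false], [true, true]] := h2
  have rx : Regular shift x := by
    intro u hu
    rw [hx] at hu
    simp only [List.mem_cons, List.not_mem_nil, or_false] at hu
    rcases hu with rfl | rfl | rfl
    · exact ⟨_, rigid_shift₁.mapsCone⟩
    · exact ⟨_, rigid_shift₂.mapsCone⟩
    · exact ⟨_, rigid_shift₃.mapsCone⟩
  have e : act shift base = stratum (relabel shift x rx) := by rw [← h]; exact act_stratum _ x rx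
  have hl : (relabel shift x rx).labels = [[true, false], [false], [true, true]] := by
    change x.labels.map _ = _
    rw [hx]
    simp only [List.map_cons, List.map_nil, rigid_shift₁.mapsCone.vmap_eq,
      rigid_shift₂.mapsCone.vmap_eq, rigid_shift₃.mapsCone.vmap_eq]
  have hv : region [[true, false], [false]] ∈ (relabel shift x rx).verts := by
    refine ⟨_, hx', ?_⟩
    change shift.1 '' _ = _
    rw [cone_child [false] false, Set.image_union, region_cons, region_cons, region_nil,
      Set.union_empty]
    exact congrArg₂ _ rigid_shift₁.mapsCone.image rigid_shift₂.mapsCone.image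
  -- Reflecting the block of 10 and 0 gives the leaf order 0, 10, 11 of `y`; contraction then leads
  -- to the same star.
  obtain ⟨z, h3, h4⟩ := (relabel shift x rx).exists_flip (l := []) (r := [[true, true]]) hl hv
  have key : ∀ u ∈ [[false], [true, false], [true, true]], MapsCone bigFlip u u := by
    intro u hu
    simp only [List.mem_cons, List.not_mem_nil, or_false] at hu
    rcases hu with rfl | rfl | rfl
    · exact mapsCone_localAct _ isTreeAut_flipAfter
    all_goals exact (rigid_localAct _ (by decide) (by decide)).mapsCone
  refine ⟨stratum y.star, ?_, ?_, ?_, ?_⟩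
  · rw [base, cell, ← h1]
    exact stratum_le y.le_star
  · rw [e]
    refine stratum_le ((Step.flip [] _ _ hl h3 hv h4).le.trans
      (Step.contract ?_ (Set.empty_subset _)).le)
    exact h2.trans h3.symm
  · exact act_stratum_eq_self fun u hu => key u (h2 ▸ hu)
  · rw [e]
    refine act_stratum_eq_self fun u hu => key u ?_
    rw [hl] at hu
    simp only [List.mem_cons, List.not_mem_nil, or_false] at hu ⊢
    tauto

/-- The identity `swap = ⁅shift, smallFlip⁆` must be lifted with control of fixed points. With `t`,
`a` fixing the base cell and `h` carrying it to `z`, both `t * a` and `h * a * h⁻¹` lift `bigFlip`;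
the second fixes `z`, and so does the first since `bigFlip` fixes the strata on the way from the
base cell to `z`. Hence they coincide. -/
lemma exists_commutator_lift_swap : ∃ f ∈ commutator liftGroup, proj f = swap ∧
    liftAct f coverBase = coverBase := by
  obtain ⟨s, h1, h2, h3, h4⟩ := exists_adjacent_stratum
  obtain ⟨y, hy, rfl⟩ := exists_cover_ge coverBase h1
  obtain ⟨z, hz, ez⟩ := exists_cover_le y h2
  obtain ⟨t, ht, ht'⟩ := exists_lift_apply_eq exists_cover_pt_eq swap
    (x := coverBase) (y := coverBase) act_swap_base
  obtain ⟨a, ha, ha'⟩ := exists_lift_apply_eq exists_cover_pt_eq smallFlip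
    (x := coverBase) (y := coverBase) act_smallFlip_base
  obtain ⟨h, hh, hh'⟩ := exists_lift_apply_eq exists_cover_pt_eq shift
    (x := coverBase) (y := z) ez.symm
  have e1 : proj (t * a) = bigFlip := by rw [map_mul, ht, ha, swap_mul_smallFlip]
  have e2 : proj (h * a * h⁻¹) = bigFlip := by
    rw [map_mul, map_mul, map_inv, hh, ha, shift_mul_smallFlip, mul_inv_cancel_right]
  have e3 : liftAct (t * a) coverBase = coverBase := by rw [liftAct_mul, ha', ht']
  have e4 : liftAct (t * a) z = z := by
    refine liftAct_eq_self_of_le (liftAct_eq_self_of_ge e3 hy (by rw [e1, h3])) hz ?_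
    rw [e1, ez, h4]
  have e5 : liftAct (h * a * h⁻¹) z = z := by
    rw [liftAct_mul, liftAct_inv_eq hh', liftAct_mul, ha', hh']
  have e6 : t = ⁅h, a⁆ := by
    rw [commutatorElement_def, eq_mul_inv_iff_mul_eq]
    exact lift_ext (e1.trans e2.symm) (e4.trans e5.symm)
  exact ⟨t, e6 ▸ Subgroup.commutator_mem_commutator (Subgroup.mem_top _) (Subgroup.mem_top _),
    ht, ht'⟩

/-- Two trees whose strata are fixed by `swap`: the first one labels the base point and the second
one its image under `swapMiddle`. -/
lemma exists_twisted_trees : ∃ x y : LTree, stratum x = base ∧ stratum y = act swapMiddle base ∧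
    x.labels = [[false, false, false, false], [false, false, false, true],
      [false, false, true, false], [false, false, true, true], [false, true], [true]] ∧
    y.labels = [[false, false, false, false], [false, false, true, false],
      [false, false, false, true], [false, false, true, true], [false, true], [true]] := by
  obtain ⟨-, -, x, -, -, h, hx⟩ := exists_base_trees
  have key : ∀ u ∈ x.labels, Rigid swapMiddle.1 u
      (wordSwap [false, false, false, true] [false, false, true, false] u) := by
    have : ∀ u ∈ x.labels, (u <+: [false, false, false, true] → u = [false, false, false, true]) ∧
        (u <+: [false, false, true, false] → u = [false, false, true, false]) := by
      rw [hx]; decide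
    exact fun u hu => rigid_swapMiddle (this u hu).1 (this u hu).2
  have rx : Regular swapMiddle x := fun u hu => ⟨_, (key u hu).mapsCone⟩
  refine ⟨x, relabel swapMiddle x rx, h, ?_, hx, ?_⟩
  · rw [← h, act_stratum swapMiddle x rx]
  · change x.labels.map _ = _
    rw [List.map_congr_left fun u hu => (key u hu).mapsCone.vmap_eq, hx]
    decide

lemma exists_twist_swap {g : neretin} (hg : g = swap) {x : LTree}
    (hfix : act g (stratum x) = stratum x)
    (hx : x.labels.Perm [[false, false, false, false], [false, false, false, true],
      [false, false, true, false], [false, false, true, true], [false, true], [true]]) {n : ℕ}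
    (hn : x.depth ≤ n) : ∃ X, ∃ rX : Regular g X, IsFull n X ∧ stratum X = stratum x ∧
      twist g X rX =
        desc (x.labels.map (wordSwap [false, false, false] [false, false, true])) x.labels := by
  subst hg
  refine twist_eq_desc (fun u hu => ⟨?_, length_wordSwap (by rfl) u⟩) ?_ hfix hn
  · have : ∀ u ∈ [[false, false, false, false], [false, false, false, true],
        [false, false, true, false], [false, false, true, true], [false, true], [true]],
        (u <+: [false, false, false] → u = [false, false, false]) ∧
        (u <+: [false, false, true] → u = [false, false, true]) := by
      decide
    have := this u (hx.subset hu)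
    exact rigid_swap this.1 this.2
  · refine (hx.map _).trans (List.Perm.trans ?_ hx.symm)
    decide

lemma exists_odd_mem_commutator :
    ∃ p, stableLength p = Multiplicative.ofAdd 1 ∧ deck p ∈ commutator liftGroup := by
  obtain ⟨t, ht, e1, e2⟩ := exists_commutator_lift_swap
  obtain ⟨c, hc, hc'⟩ := exists_lift_apply_eq exists_cover_pt_eq swapFirst
    (x := coverBase) (y := coverBase) act_swapFirst_base
  obtain ⟨k, hk⟩ := exists_lift exists_cover_pt_eq swapMiddle
  have h1 : proj (k * ⁅c, t⁆ * k⁻¹) = proj t := by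
    rw [map_mul, map_mul, map_inv, map_commutatorElement, hk, hc, e1, commutatorElement_def,
      mul_inv_eq_iff_eq_mul, ← mul_assoc, mul_inv_eq_iff_eq_mul, ← mul_assoc,
      mul_inv_eq_iff_eq_mul, ← mul_assoc, swapMiddle_mul]
  -- `c` and `t` fix the base cell, so their commutator does, and its conjugate by `k` fixes the
  -- translate by `k`.
  have h2 : liftAct (k * ⁅c, t⁆ * k⁻¹) (liftAct k coverBase) = liftAct k coverBase := by
    rw [liftAct_mul, liftAct_inv_eq rfl, liftAct_mul, commutatorElement_def, liftAct_mul,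
      liftAct_mul, liftAct_mul, liftAct_inv_eq e2, liftAct_inv_eq hc', e2, hc']
  obtain ⟨p, hp⟩ : t * (k * ⁅c, t⁆ * k⁻¹)⁻¹ ∈ deck.range := by
    rw [deck_range, MonoidHom.mem_ker, map_mul, map_inv, h1, mul_inv_cancel]
  have h3 : liftAct t (liftAct k coverBase) = deckIso p (liftAct k coverBase) := by
    rw [← liftAct_deck, hp, liftAct_mul, liftAct_inv_eq h2]
  refine ⟨p, congrArg Multiplicative.ofAdd ?_, ?_⟩
  · obtain ⟨x, y, hx, hy, lx, ly⟩ := exists_twisted_trees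
    have fx : act (proj t) (stratum x) = stratum x := by rw [hx, e1, act_swap_base]
    have ey : stratum y = (liftAct k coverBase).pt := by rw [hy, liftAct_pt, hk]; rfl
    have fy : act (proj t) (stratum y) = stratum y := by
      rw [ey, ← liftAct_pt, h3, deckIso_pt]
    obtain ⟨n, hn⟩ := coverParity_liftAct t coverBase (liftAct k coverBase)
    obtain ⟨X, rX, iX, eX, wX⟩ := exists_twist_swap e1 fx (by rw [lx])
      (n := max n (max x.depth y.depth)) (by omega)
    obtain ⟨Y, rY, iY, eY, wY⟩ := exists_twist_swap e1 fy (by rw [ly]; decide)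
      (n := max n (max x.depth y.depth)) (by omega)
    have key := hn _ (le_max_left _ _) X Y iX iY (eX.trans hx) (eY.trans ey) rX rY
    -- In the standard order only the step from 0001 to 0010 is a descent for the swapped order.
    have dX : desc (x.labels.map (wordSwap [false, false, false] [false, false, true])) x.labels
        = 1 := by rw [lx]; decide
    -- With 0001 and 0010 interchanged there are two descents, from 0000 to 0010 and from 0001 to
    -- 0011.
    have dY : desc (y.labels.map (wordSwap [false, false, false] [false, false, true])) y.labels
        = 0 := by rw [ly]; decide
    rw [e2, h3, coverParity_deckIso, wX, wY, dX, dY] at key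
    change pathParity p = 1
    linear_combination key
  · rw [hp]
    have h4 : ⁅c, t⁆ ∈ commutator liftGroup :=
      Subgroup.commutator_mem_commutator (Subgroup.mem_top _) (Subgroup.mem_top _)
    exact mul_mem ht (inv_mem (Subgroup.Normal.conj_mem inferInstance _ h4 k))

end

/-! ### Central extensions and their classes -/

section ExtensionClass

open groupCohomology

variable {A G : Type} [Group A] [Group G] {E : GroupExtension (Multiplicative (ZMod 2)) A G}

lemma exists_inl_mul_eq {a b : A} (h : E.rightHom a = E.rightHom b) :
    ∃ c : ZMod 2, E.inl (Multiplicative.ofAdd c) * a = b := by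
  have : b * a⁻¹ ∈ E.inl.range := by
    rw [E.range_inl_eq_ker_rightHom, MonoidHom.mem_ker, map_mul, map_inv, h, mul_inv_cancel]
  obtain ⟨c, hc⟩ := this
  exact ⟨c.toAdd, by rw [ofAdd_toAdd, hc, inv_mul_cancel_right]⟩

lemma inl_mul_injective {a : A} {c d : ZMod 2}
    (h : E.inl (Multiplicative.ofAdd c) * a = E.inl (Multiplicative.ofAdd d) * a) : c = d :=
  Multiplicative.ofAdd.injective (E.inl_injective (mul_right_cancel h))

lemma inl_mul_comm (hE : E.inl.range ≤ Subgroup.center A) (c : Multiplicative (ZMod 2)) (a : A) :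
    a * E.inl c = E.inl c * a :=
  Subgroup.mem_center_iff.1 (hE ⟨c, rfl⟩) a

lemma exists_cocycle (hE : E.inl.range ≤ Subgroup.center A) (σ : E.Section) :
    ∃ c : cocycles₂ (Rep.trivial (ZMod 2) G (ZMod 2)), ∀ g h : G,
      E.inl (Multiplicative.ofAdd (c (g, h) : ZMod 2)) * σ (g * h) = σ g * σ h := by
  have hc : ∀ p : G × G, ∃ c : ZMod 2,
      E.inl (Multiplicative.ofAdd c) * σ (p.1 * p.2) = σ p.1 * σ p.2 := fun p =>
    exists_inl_mul_eq (by simp)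
  choose c hc using hc
  refine ⟨⟨c, (mem_cocycles₂_iff (A := Rep.trivial (ZMod 2) G (ZMod 2)) c).2 fun g h j => ?_⟩,
    fun g h => hc (g, h)⟩
  change c (g * h, j) + c (g, h) = c (h, j) + c (g, h * j)
  apply inl_mul_injective (E := E) (a := σ (g * h * j))
  have h1 := hc (g * h, j)
  have h2 := hc (g, h)
  have h3 := hc (h, j)
  have h4 := hc (g, h * j)
  dsimp only at h1 h2 h3 h4
  rw [add_comm, ofAdd_add, map_mul, mul_assoc, h1, ← mul_assoc, h2, ofAdd_add, map_mul, mul_assoc,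
    mul_assoc g, mul_assoc (E.inl _), h4, ← mul_assoc (E.inl _), ← inl_mul_comm hE _ (σ g),
    mul_assoc (σ g), h3]

lemma coboundary_iff (c : G × G → ZMod 2) :
    c ∈ coboundaries₂ (Rep.trivial (ZMod 2) G (ZMod 2)) ↔
      ∃ f : G → ZMod 2, ∀ g h, c (g, h) = f h - f (g * h) + f g :=
  exists_congr fun _ => ⟨fun e g h => (congrFun e (g, h)).symm,
    fun e => funext fun p => (e p.1 p.2).symm⟩

/-- Two sections differ by a function `f` with values in the central kernel, and the coboundary of
`f` is the difference of the cocycles. -/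
lemma H2π_eq_of_sections (hE : E.inl.range ≤ Subgroup.center A) {σ τ : E.Section}
    {c d : cocycles₂ (Rep.trivial (ZMod 2) G (ZMod 2))}
    (hc : ∀ g h : G, E.inl (Multiplicative.ofAdd (c (g, h) : ZMod 2)) * σ (g * h) = σ g * σ h)
    (hd : ∀ g h : G, E.inl (Multiplicative.ofAdd (d (g, h) : ZMod 2)) * τ (g * h) = τ g * τ h) :
    H2π _ c = H2π _ d := by
  have hf : ∀ g : G, ∃ a : ZMod 2, E.inl (Multiplicative.ofAdd a) * τ g = σ g := fun g =>
    exists_inl_mul_eq (by simp)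
  choose f hf using hf
  rw [H2π_eq_iff]
  refine (coboundary_iff _).2 ⟨f, fun g h => ?_⟩
  change (c (g, h) : ZMod 2) - d (g, h) = _
  suffices (c (g, h) : ZMod 2) + f (g * h) = f g + f h + d (g, h) by linear_combination this
  apply inl_mul_injective (E := E) (a := τ (g * h))
  rw [ofAdd_add, map_mul, mul_assoc, hf, hc, ofAdd_add, map_mul, mul_assoc, hd, ofAdd_add, map_mul,
    ← hf g, ← hf h, mul_assoc, mul_assoc, ← mul_assoc (τ g), inl_mul_comm hE _ (τ g), mul_assoc]

lemma exists_extensionClass (hE : E.inl.range ≤ Subgroup.center A) (h : IsEmpty E.Splitting) :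
    ∃ e : H2 (Rep.trivial (ZMod 2) G (ZMod 2)), IsExtensionClass E e ∧ e ≠ 0 := by
  let σ : E.Section := ⟨_, Function.rightInverse_surjInv E.rightHom_surjective⟩
  obtain ⟨c, hc⟩ := exists_cocycle hE σ
  refine ⟨H2π _ c, fun τ => ?_, fun e => ?_⟩
  · obtain ⟨d, hd⟩ := exists_cocycle hE τ
    exact ⟨d, hd, H2π_eq_of_sections hE hd hc⟩
  · rw [H2π_eq_zero_iff] at e
    obtain ⟨f, hf⟩ := (coboundary_iff _).1 e
    -- If the cocycle is the coboundary of `f`, dividing the section by `f` makes it multiplicative,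
    -- that is a splitting.
    let s : G →* A := MonoidHom.mk' (fun g => E.inl (Multiplicative.ofAdd (-f g)) * σ g)
      fun g h => by
        have e1 : -f (g * h) = -f g + -f h + c (g, h) := by
          rw [show (c (g, h) : ZMod 2) = _ from hf g h]; ring
        rw [e1, ofAdd_add, map_mul, mul_assoc, hc, ofAdd_add, map_mul, mul_assoc, mul_assoc,
          ← mul_assoc (σ g), inl_mul_comm hE _ (σ g), mul_assoc]
    exact h.elim ⟨s, fun g => by simp [s]⟩

/-- A non-trivial element of the kernel which is a product of commutators prevents a central
extension from splitting. -/
lemma isEmpty_splitting (hE : E.inl.range ≤ Subgroup.center A) {c : Multiplicative (ZMod 2)}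
    (hc : c ≠ 1) (h : E.inl c ∈ commutator A) : IsEmpty E.Splitting := by
  refine ⟨fun s => hc ?_⟩
  have hr : ∀ a : A, ∃ x : ZMod 2, E.inl (Multiplicative.ofAdd x) * s (E.rightHom a) = a :=
    fun a => exists_inl_mul_eq (by simp)
  choose r hr using hr
  -- Centrality makes the kernel component relative to the splitting `s` a homomorphism. Its target
  -- is abelian, so it kills commutators, yet it restricts to the identity on the kernel.
  let ρ : A →* Multiplicative (ZMod 2) := MonoidHom.mk' (fun a => Multiplicative.ofAdd (r a))
    fun a b => by
      rw [← ofAdd_add]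
      refine congrArg _ (inl_mul_injective (E := E) (a := s (E.rightHom (a * b))) ?_)
      rw [hr, ofAdd_add, map_mul, map_mul, map_mul, mul_assoc,
        ← mul_assoc (E.inl (Multiplicative.ofAdd (r b))), ← inl_mul_comm hE _ (s (E.rightHom a)), mul_assoc (s _), hr,
        ← mul_assoc, hr]
  have h1 : ρ (E.inl c) = 1 := Abelianization.commutator_subset_ker ρ h
  have h2 := hr (E.inl c)
  change Multiplicative.ofAdd (r (E.inl c)) = 1 at h1
  rw [h1, map_one, one_mul, E.rightHom_inl, map_one] at h2
  exact E.inl_injective (h2.symm.trans (map_one _).symm)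

end ExtensionClass

/-! ### The extension defined by the stable length -/

lemma stableLength_surjective : Function.Surjective stableLength := by
  obtain ⟨p, hp, -⟩ := exists_odd_mem_commutator
  intro a
  have : a = 1 ∨ a = Multiplicative.ofAdd 1 := by revert a; decide
  rcases this with rfl | rfl
  · exact ⟨1, map_one _⟩
  · exact ⟨p, hp⟩

instance : (stableLength.ker.map deck).Normal := normal_map_ker

lemma mk_deck_eq_one_iff (p : PureQBraid) :
    (QuotientGroup.mk (deck p) : liftGroup ⧸ stableLength.ker.map deck) = 1 ↔
      stableLength p = 1 := by
  rw [QuotientGroup.eq_one_iff]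
  exact Subgroup.mem_map_iff_mem deck_injective

/-- The extension of Neretin's group by the values of the stable length. -/
noncomputable def eulerExtension : GroupExtension (Multiplicative (ZMod 2))
    (liftGroup ⧸ stableLength.ker.map deck) neretin where
  inl := stableLength.liftOfSurjective stableLength_surjective
    ⟨(QuotientGroup.mk' _).comp deck, fun p hp => (mk_deck_eq_one_iff p).2 hp⟩
  rightHom := QuotientGroup.lift _ proj (by
    rintro _ ⟨p, -, rfl⟩
    exact proj_deck p)
  inl_injective := by
    rw [injective_iff_map_eq_one]
    intro a ha
    obtain ⟨p, rfl⟩ := stableLength_surjective a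
    rw [MonoidHom.liftOfSurjective, MonoidHom.liftOfRightInverse_comp_apply] at ha
    exact (mk_deck_eq_one_iff p).1 ha
  range_inl_eq_ker_rightHom := by
    ext a
    constructor
    · rintro ⟨c, rfl⟩
      obtain ⟨p, rfl⟩ := stableLength_surjective c
      rw [MonoidHom.liftOfSurjective, MonoidHom.liftOfRightInverse_comp_apply]
      exact proj_deck p
    · obtain ⟨f, rfl⟩ := QuotientGroup.mk_surjective a
      intro hf
      obtain ⟨p, rfl⟩ : f ∈ deck.range := deck_range ▸ hf
      exact ⟨stableLength p, MonoidHom.liftOfRightInverse_comp_apply _ _ _ _ _⟩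
  rightHom_surjective := fun g => by
    obtain ⟨f, rfl⟩ := exists_lift exists_cover_pt_eq g
    exact ⟨QuotientGroup.mk f, rfl⟩

lemma eulerExtension_inl (p : PureQBraid) :
    eulerExtension.inl (stableLength p) = QuotientGroup.mk (deck p) :=
  MonoidHom.liftOfRightInverse_comp_apply _ _ _ _ _

lemma eulerExtension_rightHom (f : liftGroup) :
    eulerExtension.rightHom (QuotientGroup.mk f) = proj f := rfl

/-- Conjugation by a lift preserves the stable length of a deck transformation, hence its class
modulo the kernel. -/
lemma eulerExtension_central : eulerExtension.inl.range ≤ Subgroup.center _ := by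
  rintro _ ⟨a, rfl⟩
  obtain ⟨p, rfl⟩ := stableLength_surjective a
  refine Subgroup.mem_center_iff.2 fun b => ?_
  obtain ⟨f, rfl⟩ := QuotientGroup.mk_surjective b
  obtain ⟨q, h1, h2⟩ := exists_deck_conj f p
  rw [eulerExtension_inl, ← QuotientGroup.mk_mul, mul_inv_eq_iff_eq_mul.1 h1.symm,
    QuotientGroup.mk_mul, ← eulerExtension_inl q, h2, eulerExtension_inl]

lemma isEmpty_splitting_eulerExtension : IsEmpty eulerExtension.Splitting := by
  obtain ⟨p, h1, h2⟩ := exists_odd_mem_commutator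
  refine isEmpty_splitting eulerExtension_central (c := stableLength p) (by rw [h1]; decide) ?_
  rw [eulerExtension_inl]
  have h3 := Subgroup.mem_map_of_mem (QuotientGroup.mk' (stableLength.ker.map deck)) h2
  rw [commutator_def, Subgroup.map_commutator] at h3
  exact Subgroup.commutator_mono le_top le_top h3

end DyadicCircle

theorem theorem3 :
    -- the stable length modulo two on the infinite pure quasi-braid group
    ∃ ℓ : DyadicCircle.PureQBraid →* Multiplicative (ZMod 2),
      (∀ p a, ℓ p = a ↔ DyadicCircle.HasStableLength p a) ∧
      Function.Surjective ℓ ∧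
      -- the quasi-braid extension
      Function.Injective DyadicCircle.deck ∧
      DyadicCircle.deck.range = DyadicCircle.proj.ker ∧
      Function.Surjective DyadicCircle.proj ∧
      -- its quotient by the kernel of the stable length
      ∃ _ : (ℓ.ker.map DyadicCircle.deck).Normal,
        ∃ E : GroupExtension (Multiplicative (ZMod 2))
            (DyadicCircle.liftGroup ⧸ ℓ.ker.map DyadicCircle.deck) DyadicCircle.neretin,
          (∀ p, E.inl (ℓ p) = QuotientGroup.mk (DyadicCircle.deck p)) ∧
          (∀ f : DyadicCircle.liftGroup, E.rightHom (QuotientGroup.mk f) = DyadicCircle.proj f) ∧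
          -- the extension is central and non-trivial
          E.inl.range ≤ Subgroup.center _ ∧
          IsEmpty E.Splitting ∧
          (∃ p, ℓ p = Multiplicative.ofAdd 1 ∧
            DyadicCircle.deck p ∈ commutator DyadicCircle.liftGroup) ∧
          -- the class of the extension does not vanish
          ∃ Eu : groupCohomology.H2 (Rep.trivial (ZMod 2) DyadicCircle.neretin (ZMod 2)),
            DyadicCircle.IsExtensionClass E Eu ∧ Eu ≠ 0 := by
  exact ⟨DyadicCircle.stableLength, DyadicCircle.stableLength_eq_iff,
    DyadicCircle.stableLength_surjective, DyadicCircle.deck_injective, DyadicCircle.deck_range,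
    DyadicCircle.exists_lift DyadicCircle.exists_cover_pt_eq, DyadicCircle.normal_map_ker,
    DyadicCircle.eulerExtension, DyadicCircle.eulerExtension_inl,
    DyadicCircle.eulerExtension_rightHom, DyadicCircle.eulerExtension_central,
    DyadicCircle.isEmpty_splitting_eulerExtension, DyadicCircle.exists_odd_mem_commutator,
    DyadicCircle.exists_extensionClass DyadicCircle.eulerExtension_central
      DyadicCircle.isEmpty_splitting_eulerExtension⟩
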